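/- Let $N$ be a ground set with $|N|=n\ge 2$. An algorithm accesses a set function $f:2^N\to\mathbb R$ only through an evaluation oracle and may use internal randomness. In each *adaptive round* it submits a finite batch of queries that depends only on earlier rounds and on its randomness, and receives all answers; algorithms run in parallel share their rounds. The function $f$ is *monotone* if $f(S)\le f(T)$ for $S\subseteq T$, and *submodular* if $f(S\cup\{x\})-f(S)\ge f(T\cup\{x\})-f(T)$ for $S\subseteq T\subseteq N$, $x\in N\setminus T$. Put $\mathrm{OPT}=\max\{f(S):|S|\le k\}$. A *Threshold-Sampling* procedure with constant $C$ takes $A,S\subseteq N$, $k\in\mathbb N$, a threshold $\tau>0$ and $\varepsilon,\delta\in(0,1)$, and for every monotone submodular $f\ge 0$ it returns $T\subseteq A$ with $|T|\le k$ within $C\log(n/\delta)/\varepsilon$ rounds, makes at most $C|A|/\varepsilon$ queries in expectation, satisfies $\mathbb E\big[\tfrac{f(S\cup T)-f(S)}{|T|}\,\big|\,T\ne\emptyset\big]\ge(1-\varepsilon)\tau$ (if $\Pr[T\neq\emptyset]>0$), and with probability at least $1-\delta$ has $|T|=k$ or $f(S\cup T\cup\{x\})-f(S\cup T)<\tau$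 for all $x\in A$. Write $\mathrm{TS}(A,S,k,\tau,\varepsilon,\delta)$ for its output. **Subsample-Preprocessing**$(k,\delta)$ computes $D=\max_x f(\{x\})$ in one round and sets $L=D$, $R=k$, which gives the interval $[L,RL]$. While $R\ge R^*:=4\cdot10^6/\delta^2$, it puts $\ell=\log^2R$, $p=1/\log R$, $\delta_R=\delta/(2\log R)$, $t=\lceil\log_2R\rceil$. It draws $N'\subseteq N$ by including each element independently with probability $1/\ell$. In parallel for $\tau_i=2^iL/k$, $0\le i\le t$, it computes $v_i=f(S_i)$, where $S_i=\mathrm{TS}(N',\emptyset,k,\tau_i,1-p,\delta_R/(t+1))$. Let $j$ be the least $i$ with $v_i<pk\tau_i$, and $j=t+1$ if there is none. It replaces $L$ by $(D+L)/2$ if $j=0$ and by $(D+pk\tau_{j-1})/2$ otherwise, and $R$ by $16\ell/(\delta_Rp)=(32/\delta)\log^4R$. It returns $(L,R)$. **Exhaustive-Maximization**$(k,\varepsilon,\delta,L,R)$ puts $r=\lceil 2\log R/\varepsilon\rceil$, $m=\lceil\log 4/\varepsilon\rceil$, $\hat\delta=\delta/((r+1)(m+1))$. In parallel for $i=0,\dots,r$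 it starts with $S=\emptyset$ and $\tau=(1+\varepsilon)^iL/k$, and for $j=0,\dots,m$ replaces $S$ by $S\cup\mathrm{TS}(N,S,k-|S|,(1-\varepsilon)^j\tau,\varepsilon,\hat\delta)$, stopping early if $|S|=k$. It evaluates the resulting sets and $\emptyset$ and returns the one with the largest value of $f$. **Theorem.** There are absolute constants $C>0$ and $d\in\mathbb N$ such that for every ground set $N$ with $n=|N|\ge2$ there is a Threshold-Sampling procedure with constant $C$ for which the following holds. Let $1\le k\le n$, $0<\varepsilon<1-1/e$, and let $f:2^N\to\mathbb R_{\ge0}$ be monotone and submodular. Then Subsample-Preprocessing$(k,\varepsilon/4)$, followed by Exhaustive-Maximization$(k,\varepsilon/4,\varepsilon/4,L,R)$ on its output $(L,R)$, returns a set $S$ such that 1. $|S|\le k$ always, the number of adaptive rounds is always at most $C\log(n)/\varepsilon^2$, and the total number of queries is always at most $C(n/\varepsilon)^d$; 2. the expected number of oracle queries is at most $C\,n\log(1/\varepsilon)/\varepsilon^3$; 3. $\mathbb E[f(S)]\ge(1-1/e-\varepsilon)\,\mathrm{OPT}$. -/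

import Mathlib

namespace SubMax

/-! ### Set functions -/

section SetFunctions

variable {N : Type} [Fintype N] [DecidableEq N]

/-- Diminishing returns: the marginal gain of `x` with respect to `S` is at least its marginal gain
with respect to any larger `T` that does not contain `x`. -/
def Submodular (f : Finset N → ℝ) : Prop :=
  ∀ S T : Finset N, S ⊆ T → ∀ x, x ∉ T → f (insert x T) - f T ≤ f (insert x S) - f S

/-- The maximum of `f S` over all `S` with `|S| ≤ k`. -/
noncomputable def opt (f : Finset N → ℝ) (k : ℕ) : ℝ :=
  (Finset.univ.filter fun S : Finset N => S.card ≤ k).sup' ⟨∅, by simp⟩ f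

end SetFunctions

/-! ### Randomized adaptive algorithms with an evaluation oracle -/

/-- A randomized algorithm that accesses a set function on `2^N` only through an evaluation oracle.
It can stop with a result, draw a random element from a distribution of its choice, or perform one
adaptive round: submit a finite batch of `m` queries, which depends only on what happened before,
and continue with the `m` answers. -/
inductive Alg (N : Type) (α : Type) : Type 1
  | ret (a : α) : Alg N α
  | rand {β : Type} (μ : PMF β) (cont : β → Alg N α) : Alg N α
  | ask {m : ℕ} (q : Fin m → Finset N) (cont : (Fin m → ℝ) → Alg N α) : Alg N α

/-- The result of one execution: output, number of adaptive rounds, number of oracle queries. -/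
structure Outcome (α : Type) where
  output : α
  rounds : ℕ
  queries : ℕ

namespace Alg

variable {N α β γ : Type}

/-- Sequential composition. -/
def andThen : Alg N α → (α → Alg N β) → Alg N β
  | ret a, g => g a
  | rand μ c, g => rand μ fun b => (c b).andThen g
  | ask q c, g => ask q fun v => (c v).andThen g

instance : Monad (Alg N) where
  pure := ret
  bind := andThen

/-- Distribution of the outcome of an algorithm when the oracle answers according to `f`. -/
noncomputable def run (f : Finset N → ℝ) : Alg N α → PMF (Outcome α)
  | ret a => PMF.pure ⟨a, 0, 0⟩
  | rand μ c => μ.bind fun b => (c b).run f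
  | @ask _ _ m q c =>
      ((c fun i => f (q i)).run f).map fun o => ⟨o.output, o.rounds + 1, o.queries + m⟩

/-- Draw one random element. -/
def draw (μ : PMF α) : Alg N α := rand μ ret

/-- One round that asks for the values of all the sets in a list. -/
def askAll (l : List (Finset N)) : Alg N (List ℝ) :=
  ask (fun i : Fin l.length => l.get i) fun v => ret (List.ofFn v)

/-- Auxiliary to `par`: the left algorithm is about to perform a round with queries `q`. Rounds of
the two algorithms are merged into one. -/
def parAux {m : ℕ} (q : Fin m → Finset N) (c : (Fin m → ℝ) → Alg N β → Alg N γ) :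
    Alg N β → Alg N γ
  | ret b => ask q fun v => c v (ret b)
  | rand ν d => rand ν fun b => parAux q c (d b)
  | @ask _ _ m' q' d => ask (Fin.append q q') fun v =>
      c (fun i => v (Fin.castAdd m' i)) (d fun i => v (Fin.natAdd m i))

/-- Parallel composition of two algorithms, with independent randomness. The `i`-th rounds of the
two are performed as a single round. -/
def par : Alg N α → Alg N β → Alg N (α × β)
  | ret a => fun y => y.andThen fun b => ret (a, b)
  | rand μ c => fun y => rand μ fun b => par (c b) y
  | ask q c => parAux q fun v => par (c v)

/-- Parallel composition of a list of algorithms. -/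
def parList : List (Alg N α) → Alg N (List α)
  | [] => ret []
  | x :: xs => (par x (parList xs)).andThen fun r => ret (r.1 :: r.2)

end Alg

/-- Expectation of a nonnegative (extended) quantity. -/
noncomputable def expect {α : Type} (μ : PMF α) (g : α → ENNReal) : ENNReal := ∑' a, μ a * g a

/-- Probability of an event. -/
noncomputable def prob {α : Type} (μ : PMF α) (s : Set α) : ENNReal := μ.toOuterMeasure s

section Algorithms

variable {N : Type} [Fintype N] [DecidableEq N]

/-! ### The threshold-sampling subroutine -/

/-- The interface of Threshold-Sampling. `TS A S k τ ε δ` works on the ground set `A` with the set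
function `T ↦ f (S ∪ T) - f S`, size bound `k`, threshold `τ`, error `ε`, failure
probability `δ`. -/
abbrev ThresholdProc (N : Type) : Type 1 :=
  Finset N → Finset N → ℕ → ℝ → ℝ → ℝ → Alg N (Finset N)

/-- The guarantees of Threshold-Sampling, with constant `C` in the `O`-bounds: it returns
`T ⊆ A` with `|T| ≤ k` within `C log (n/δ) / ε` rounds, it makes at most `C |A| / ε` queries in
expectation, the average marginal gain of the returned elements is at least `(1 - ε) τ` in
expectation given that `T` is nonempty, and with probability at least `1 - δ` either `|T| = k`
or the marginal gain of every element with respect to `S ∪ T` is below `τ`. -/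
def IsThresholdSampling (C : ℝ) (TS : ThresholdProc N) : Prop :=
  ∀ f : Finset N → ℝ, Monotone f → Submodular f → (∀ S, 0 ≤ f S) →
  ∀ (A S : Finset N) (k : ℕ) (τ ε δ : ℝ), 0 < τ → 0 < ε → ε < 1 → 0 < δ → δ < 1 →
    (∀ o ∈ ((TS A S k τ ε δ).run f).support,
      o.output ⊆ A ∧ o.output.card ≤ k ∧
        (o.rounds : ℝ) ≤ C * Real.log (Fintype.card N / δ) / ε) ∧
    expect ((TS A S k τ ε δ).run f) (fun o => (o.queries : ENNReal)) ≤
      ENNReal.ofReal (C * A.card / ε) ∧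
    ENNReal.ofReal ((1 - ε) * τ) * prob ((TS A S k τ ε δ).run f) {o | o.output.Nonempty} ≤
      expect ((TS A S k τ ε δ).run f)
        (fun o => ENNReal.ofReal ((f (S ∪ o.output) - f S) / o.output.card)) ∧
    ENNReal.ofReal (1 - δ) ≤
      prob ((TS A S k τ ε δ).run f)
        {o | o.output.card = k ∨ ∀ x ∈ A, f (insert x (S ∪ o.output)) - f (S ∪ o.output) < τ}

/-! ### Exhaustive-Maximization -/

/-- The inner loop of Exhaustive-Maximization: for the exponents `j` in the list, call
Threshold-Sampling with threshold `(1 - ε) ^ j * τ` on top of the current solution `S`, and stop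
as soon as `|S| = k`. -/
noncomputable def greedyBlock (TS : ThresholdProc N) (k : ℕ) (ε δ τ : ℝ) :
    List ℕ → Finset N → Alg N (Finset N)
  | [], S => pure S
  | j :: js, S => do
      let T ← TS Finset.univ S (k - S.card) ((1 - ε) ^ j * τ) ε δ
      if (S ∪ T).card = k then pure (S ∪ T) else greedyBlock TS k ε δ τ js (S ∪ T)

/-- The better of two sets with known values; the first one on a tie. -/
noncomputable def better (x y : Finset N × ℝ) : Finset N × ℝ :=
  open Classical in if x.2 < y.2 then y else x

/-- Exhaustive-Maximization on a feasible interval `[L, R * L]` for the optimum: the greedy block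
is run in parallel for the initial thresholds `(1 + ε) ^ i * L / k`, `i = 0, …, r`, and the best
set is returned. -/
noncomputable def exhaustiveMaximization (TS : ThresholdProc N) (k : ℕ) (ε δ L R : ℝ) :
    Alg N (Finset N) := do
  let r : ℕ := ⌈2 * Real.log R / ε⌉₊
  let m : ℕ := ⌈Real.log 4 / ε⌉₊
  let δ' : ℝ := δ / ((r + 1) * (m + 1))
  let sets ← Alg.parList ((List.range (r + 1)).map fun i =>
    greedyBlock TS k ε δ' ((1 + ε) ^ i * L / k) (List.range (m + 1)) ∅)
  let vals ← Alg.askAll (∅ :: sets)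
  pure (((∅ :: sets).zip vals).foldl better (∅, vals.headD 0)).1

/-! ### Subsample-Preprocessing -/

/-- The random subset of `N` that contains each element independently with probability `q`
(with probability `1` if `q > 1`). -/
noncomputable def subsample (N : Type) [Fintype N] (q : NNReal) : PMF (Finset N) :=
  PMF.ofFintype
    (fun A => ((min q 1 : NNReal) : ENNReal) ^ A.card *
      ((1 - min q 1 : NNReal) : ENNReal) ^ (Fintype.card N - A.card))
    (by
      classical
      have h := Fintype.sum_pow_mul_eq_add_pow N
        ((min q 1 : NNReal) : ENNReal) ((1 - min q 1 : NNReal) : ENNReal)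
      rw [h, ← ENNReal.coe_add, add_tsub_cancel_of_le (min_le_right q 1)]
      simp)

/-- `max_x f {x}` (for nonnegative `f`), computed in one round of `n` queries. -/
noncomputable def maxSingleton (N : Type) [Fintype N] : Alg N ℝ := do
  let vals ← Alg.askAll ((Finset.univ : Finset N).toList.map fun x => {x})
  pure (vals.foldr max 0)

/-- Ratio below which the preprocessing stops. -/
noncomputable def ratioStop (δ : ℝ) : ℝ := 4 * 10 ^ 6 / δ ^ 2

/-- Failure probability that is allowed while reducing the ratio `R`. -/
noncomputable def stageFailure (δ R : ℝ) : ℝ := δ / (2 * Real.log R)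

/-- The ratio after one reduction step: `16 ℓ / (δ_R p)` with `ℓ = log² R` and `p = 1 / log R`,
which is `(32 / δ) log⁴ R`. -/
noncomputable def reducedRatio (δ R : ℝ) : ℝ :=
  16 * Real.log R ^ 2 / (stageFailure δ R * (1 / Real.log R))

/-- One ratio reduction. The feasible interval for the optimum is `[L, R * L]`, and `D` is the
maximum value of a singleton. With `ℓ = log² R` and `p = 1 / log R`, subsample the ground set with
rate `1 / ℓ`, run Threshold-Sampling with error `1 - p` in parallel for the thresholds
`τ_i = 2 ^ i * L / k`, `i = 0, …, i*`. The value `v` found for `τ_i` decides between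
`p k τ_i ≤ OPT'` (if `p k τ_i ≤ v`) and `OPT' ≤ 2 k τ_i` (otherwise), where `OPT'` is the optimum
of the subsample. The output is the lower end `L'` of the new interval
`[L', reducedRatio δ R * L']`: it is `(D + p k τ_{j-1}) / 2`, where `j` is the first index decided
in the second way (`j = i* + 1` if there is none), and `(D + L) / 2` if `j = 0`. -/
noncomputable def reduceRatio (TS : ThresholdProc N) (k : ℕ) (δ D R L : ℝ) : Alg N ℝ := do
  let p : ℝ := 1 / Real.log R
  let top : ℕ := ⌈Real.log R / Real.log 2⌉₊
  let N' ← Alg.draw (subsample N (Real.toNNReal (1 / Real.log R ^ 2)))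
  let sets ← Alg.parList ((List.range (top + 1)).map fun i =>
    TS N' ∅ k (2 ^ i * L / k) (1 - p) (stageFailure δ R / (top + 1)))
  let vals ← Alg.askAll sets
  let j : ℕ := (vals.zipIdx.takeWhile fun v =>
    open Classical in decide (p * (2 ^ v.2 * L) ≤ v.1)).length
  pure (if j = 0 then (D + L) / 2 else (D + p * (2 ^ (j - 1) * L)) / 2)

/-- The ratio reductions for `i = s, …, s + t - 1`, where the ratio in step `i` is the `i`-th iterate
`R_i` of `reducedRatio δ` at `R_0 = k`. -/
noncomputable def reduceLoop (TS : ThresholdProc N) (k : ℕ) (δ D : ℝ) : ℕ → ℕ → ℝ → Alg N ℝ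
  | 0, _, L => pure L
  | t + 1, s, L => do
      let L' ← reduceRatio TS k δ D ((reducedRatio δ)^[s] k) L
      reduceLoop TS k δ D t (s + 1) L'

/-- The number of ratio reductions: the first `i` with `R_i < R*`. -/
noncomputable def numStages (k : ℕ) (δ : ℝ) : ℕ :=
  sInf {i : ℕ | (reducedRatio δ)^[i] (k : ℝ) < ratioStop δ}

/-- Subsample-Preprocessing: start from the feasible interval `[D, k * D]`, `D = max_x f {x}`, and
reduce the ratio until it is below `ratioStop δ`. The output `(L, R)` stands for the interval
`[L, R * L]`. -/
noncomputable def subsamplePreprocessing (TS : ThresholdProc N) (k : ℕ) (δ : ℝ) :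
    Alg N (ℝ × ℝ) := do
  let D ← maxSingleton N
  let L ← reduceLoop TS k δ D (numStages k δ) 0 D
  pure (L, (reducedRatio δ)^[numStages k δ] k)

/-- Subsample-Preprocessing followed by Exhaustive-Maximization; the failure probabilities and the
error handed down are a fixed fraction of `ε`. -/
noncomputable def subsampleMaximization (TS : ThresholdProc N) (k : ℕ) (ε : ℝ) :
    Alg N (Finset N) := do
  let I ← subsamplePreprocessing TS k (ε / 4)
  exhaustiveMaximization TS k (ε / 4) (ε / 4) I.1 I.2

end Algorithms

end SubMax

namespace SubMax

open scoped ENNReal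

/-! ### Expectations of extended nonnegative quantities -/

section Expect

variable {α β : Type}

/-! Threshold-Sampling. Call an element a candidate if its gain over the current `T` is at least
`τ`. One iteration puts the candidates in uniformly random order, queries all prefixes in one round,
and moves along the order as long as after `i` steps at most `ε i` elements had gain below `τ`; a
second round removes the elements that are no longer candidates. Hence the average gain `(1 - ε) τ`
holds surely (`gain_extend`), and only saturation can fail.

The candidates shrink for the following reason. While more than a fraction `γ` of the batch are
still candidates, the next element has small gain with probability at most `1 - γ`, so with `y`
small elements after `i` steps `exp (θ (y - a i))` is a supermartingale, and a stop caused by `y > ε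
i` is unlikely (`expect_pending_extend`). For suitable parameters (`exists_parameters`) the expected
number of candidates drops by the factor `(1 - ε) ^ (1 / 10000)` per iteration. Markov's inequality
then gives the failure probability after `log (n / δ) / shrinkRate ε` iterations, and a geometric
series gives `O(|A| / ε)` expected queries. The rate is unbounded as `ε → 1`; the preprocessing,
which uses the error `1 - 1 / log R`, depends on this.

Preprocessing. The new lower end is at least `D / 2` and at most the optimum surely. If the optimum
is within the new ratio of `D / 2`, nothing can fail. Otherwise single elements are small compared
with the optimum, and a Chernoff bound for a modular minorant of `f` shows that the subsample keeps
a `1 / (4 log² R)` fraction of the optimum (`subsample_opt_tail`); saturation at the first threshold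
whose value is too small then bounds this part from above (`le_newLower`). Since `R` becomes `(32 /
δ) log⁴ R`, `log log R` falls by a constant factor per stage (`loglog_reducedRatio_le`). So the sums
of `1 / log log R` and `1 / log R` are bounded: the first controls the rounds, the second the
failure probability and the queries to subsamples of mean size `n / log² R`.

Maximization. The final ratio is `O(1 / ε²)`, so a geometric grid of `O(log (1 / ε) / ε)` guesses
contains a good initial threshold (`exists_threshold`). From there the deficit `OPT - f S` decays
like `exp (-(1 - ε)² |S| / k)` (`potential_union`), until `|S| = k` or the threshold is so low that
the deficit is at most `OPT / 4 ≤ OPT / e`. Everything fails with probability at most `ε / 2`, which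
costs a factor `1 - ε / 2` in expectation. -/

theorem expect_pure (a : α) (g : α → ℝ≥0∞) : expect (PMF.pure a) g = g a := by
  unfold expect
  rw [tsum_eq_single a]
  · simp
  · intro b hb
    simp [PMF.pure_apply, hb]

theorem expect_bind (μ : PMF α) (κ : α → PMF β) (g : β → ℝ≥0∞) :
    expect (μ.bind κ) g = expect μ fun a => expect (κ a) g := by
  unfold expect
  simp only [PMF.bind_apply, ← ENNReal.tsum_mul_left, ← ENNReal.tsum_mul_right]
  rw [ENNReal.tsum_comm]
  simp only [mul_assoc]

theorem expect_map (μ : PMF α) (φ : α → β) (g : β → ℝ≥0∞) :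
    expect (μ.map φ) g = expect μ fun a => g (φ a) := by
  unfold PMF.map
  rw [expect_bind]
  simp only [Function.comp_apply, expect_pure]

theorem expect_mono {μ : PMF α} {g h : α → ℝ≥0∞} (H : ∀ a ∈ μ.support, g a ≤ h a) :
    expect μ g ≤ expect μ h := by
  refine ENNReal.tsum_le_tsum fun a => ?_
  by_cases ha : a ∈ μ.support
  · gcongr
    exact H a ha
  · simp [(PMF.apply_eq_zero_iff μ a).2 ha]

theorem expect_const (μ : PMF α) (c : ℝ≥0∞) : expect μ (fun _ => c) = c := by
  simp [expect, ENNReal.tsum_mul_right, PMF.tsum_coe]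

theorem expect_le {μ : PMF α} {g : α → ℝ≥0∞} {c : ℝ≥0∞} (H : ∀ a ∈ μ.support, g a ≤ c) :
    expect μ g ≤ c :=
  (expect_mono H).trans (expect_const μ c).le

theorem expect_add (μ : PMF α) (g h : α → ℝ≥0∞) :
    expect μ (fun a => g a + h a) = expect μ g + expect μ h := by
  simp only [expect, mul_add, ENNReal.tsum_add]

theorem expect_mul_left (μ : PMF α) (c : ℝ≥0∞) (g : α → ℝ≥0∞) :
    expect μ (fun a => c * g a) = c * expect μ g := by
  simp only [expect, ← ENNReal.tsum_mul_left]
  exact tsum_congr fun a => by ring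

theorem expect_finsetSum {ι : Type*} (s : Finset ι) (μ : PMF α) (g : ι → α → ℝ≥0∞) :
    expect μ (fun a => ∑ i ∈ s, g i a) = ∑ i ∈ s, expect μ (g i) := by
  classical
  induction s using Finset.induction_on with
  | empty => simp [expect]
  | insert i s hi ih => simp only [Finset.sum_insert hi, expect_add, ih]

open Classical in
theorem prob_eq_expect (μ : PMF α) (s : Set α) :
    prob μ s = expect μ fun a => if a ∈ s then 1 else 0 := by
  unfold prob expect
  rw [PMF.toOuterMeasure_apply]
  exact tsum_congr fun a => by by_cases h : a ∈ s <;> simp [h]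

theorem expect_uniformOfFinset (s : Finset α) (hs : s.Nonempty) (g : α → ℝ≥0∞) :
    expect (PMF.uniformOfFinset s hs) g = (s.card : ℝ≥0∞)⁻¹ * ∑ a ∈ s, g a := by
  unfold expect
  rw [tsum_eq_sum (s := s)]
  · rw [Finset.mul_sum]
    refine Finset.sum_congr rfl fun a ha => ?_
    rw [PMF.uniformOfFinset_apply_of_mem hs ha]
  · intro a ha
    simp [PMF.uniformOfFinset_apply_of_notMem hs ha]

open Classical in
/-- A quantity that is at least `c` off an event of probability at most `δ` has expectation at
least `(1 - δ) c`. -/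
theorem mul_le_expect_of_prob {μ : PMF α} {g : α → ℝ≥0∞} {s : Set α} {c δ : ℝ≥0∞}
    (hs : (expect μ fun a => if a ∈ s then 1 else 0) ≤ δ)
    (hc : ∀ a ∈ μ.support, a ∉ s → c ≤ g a) : (1 - δ) * c ≤ expect μ g := by
  have h1 : (1 : ℝ≥0∞) ≤ (expect μ fun a => if a ∈ s then 0 else 1) + δ := by
    calc (1 : ℝ≥0∞) = expect μ (fun _ => 1) := (expect_const μ 1).symm
      _ = expect μ (fun a => (if a ∈ s then 0 else 1) + (if a ∈ s then 1 else 0)) := by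
          congr 1; funext a; by_cases h : a ∈ s <;> simp [h]
      _ ≤ _ := by rw [expect_add]; gcongr
  calc (1 - δ) * c ≤ (expect μ fun a => if a ∈ s then 0 else 1) * c := by
        gcongr; exact tsub_le_iff_right.2 h1
    _ = expect μ (fun a => c * if a ∈ s then 0 else 1) := by rw [expect_mul_left, mul_comm]
    _ ≤ expect μ g := expect_mono fun a ha => by
        by_cases h : a ∈ s
        · simp [h]
        · simpa [h] using hc a ha h

end Expect

/-! ### Runs of composed algorithms -/

namespace Outcome

variable {α β : Type}

/-- The outcome `o'` of a computation that is performed after one with the costs of `o`. -/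
def after (o : Outcome α) (o' : Outcome β) : Outcome β :=
  ⟨o'.output, o.rounds + o'.rounds, o.queries + o'.queries⟩

/-- The joint outcome of two computations that share their rounds. -/
def both (o : Outcome α) (o' : Outcome β) : Outcome (α × β) :=
  ⟨(o.output, o'.output), max o.rounds o'.rounds, o.queries + o'.queries⟩

end Outcome

namespace Alg

variable {N α β γ : Type} (f : Finset N → ℝ)

theorem run_ret (a : α) : (ret a : Alg N α).run f = PMF.pure ⟨a, 0, 0⟩ := rfl

theorem run_rand (μ : PMF β) (c : β → Alg N α) :
    (rand μ c).run f = μ.bind fun b => (c b).run f := rfl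

theorem run_ask {m : ℕ} (q : Fin m → Finset N) (c : (Fin m → ℝ) → Alg N α) :
    (ask q c).run f =
      ((c fun i => f (q i)).run f).map fun o => ⟨o.output, o.rounds + 1, o.queries + m⟩ := rfl

theorem run_andThen (x : Alg N α) (h : α → Alg N β) :
    (x.andThen h).run f =
      (x.run f).bind fun o => ((h o.output).run f).map fun o' => o.after o' := by
  induction x with
  | ret a =>
    simp only [andThen, run_ret, PMF.pure_bind, Outcome.after, zero_add]
    exact (PMF.map_id _).symm
  | rand μ c ih => simp only [andThen, run_rand, PMF.bind_bind, ih]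
  | ask q c ih =>
    simp only [andThen, run_ask, ih, PMF.map_bind, PMF.bind_map, PMF.map_comp, Function.comp_def,
      Outcome.after]
    congr 1; funext o; congr 1; funext o'
    congr 1 <;> omega

theorem run_draw (μ : PMF α) : (draw μ : Alg N α).run f = μ.map fun a => ⟨a, 0, 0⟩ := rfl

theorem run_askAll (l : List (Finset N)) :
    (askAll l).run f = PMF.pure ⟨l.map f, 1, l.length⟩ := by
  simp only [askAll, run_ask, run_ret, PMF.pure_map, zero_add]
  congr 2
  apply List.ext_get <;> simp

theorem run_parAux {m : ℕ} (q : Fin m → Finset N)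
    (c : (Fin m → ℝ) → Alg N β → Alg N (α × β)) (x : (Fin m → ℝ) → Alg N α)
    (hc : ∀ v y, (c v y).run f = ((x v).run f).bind fun o => (y.run f).map fun o' => o.both o')
    (y : Alg N β) :
    (parAux q c y).run f = ((ask q x).run f).bind fun o => (y.run f).map fun o' => o.both o' := by
  induction y with
  | ret b =>
    simp only [parAux, run_ask, hc, run_ret, PMF.pure_map, PMF.map_bind, PMF.bind_map,
      Function.comp_def, Outcome.both, Nat.max_zero, add_zero]
  | rand ν d ih =>
    simp only [parAux, run_rand, ih, PMF.map_bind]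
    -- The right algorithm draws before the merged round is asked; by independence this draw can be
    -- exchanged with the run of the left one.
    rw [PMF.bind_comm]
  | @ask m' q' d ih =>
    simp only [parAux, run_ask, hc, PMF.map_bind, PMF.bind_map, PMF.map_comp, Function.comp_def,
      Fin.append_left, Fin.append_right, Outcome.both]
    congr 1; funext o; congr 1; funext o'
    congr 1
    · simp
    · omega

/-- Merging rounds does not affect the joint law: the outputs stay independent, while rounds combine
by a maximum and queries by a sum. -/
theorem run_par (x : Alg N α) (y : Alg N β) :
    (par x y).run f = (x.run f).bind fun o => (y.run f).map fun o' => o.both o' := by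
  induction x generalizing y with
  | ret a =>
    simp only [par, run_andThen, run_ret, PMF.pure_map, PMF.pure_bind, Outcome.after,
      Outcome.both]
    unfold PMF.map
    congr 1; funext o
    simp
  | rand μ c ih => simp only [par, run_rand, PMF.bind_bind, ih]
  | ask q c ih =>
    rw [par]
    exact run_parAux f q (fun v => par (c v)) c (fun v y => ih v y) y

/-- Expectation of a quantity that depends on the output. -/
noncomputable def outE (x : Alg N α) (g : α → ℝ≥0∞) : ℝ≥0∞ :=
  expect (x.run f) fun o => g o.output

/-- Probability that the output does not have the property `P`. -/
noncomputable def failure (x : Alg N α) (P : α → Prop) : ℝ≥0∞ :=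
  open Classical in outE f x fun a => if P a then 0 else 1

/-- Expected number of queries. -/
noncomputable def cost (x : Alg N α) : ℝ≥0∞ :=
  expect (x.run f) fun o => (o.queries : ℝ≥0∞)

/-- Every possible output has the property `P`, and the number of rounds and the number of queries
are bounded by `r` and `w`. -/
def Ensures (x : Alg N α) (P : α → Prop) (r w : ℝ) : Prop :=
  ∀ o ∈ (x.run f).support, P o.output ∧ (o.rounds : ℝ) ≤ r ∧ (o.queries : ℝ) ≤ w

variable {f}

theorem outE_ret (a : α) (g : α → ℝ≥0∞) : outE f (ret a) g = g a := expect_pure _ _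

theorem outE_draw (μ : PMF α) (g : α → ℝ≥0∞) : outE f (draw μ) g = expect μ g := by
  rw [outE, run_draw, expect_map]

theorem outE_askAll (l : List (Finset N)) (g : List ℝ → ℝ≥0∞) :
    outE f (askAll l) g = g (l.map f) := by
  rw [outE, run_askAll, expect_pure]

theorem outE_andThen (x : Alg N α) (h : α → Alg N β) (g : β → ℝ≥0∞) :
    outE f (x.andThen h) g = outE f x fun a => outE f (h a) g := by
  simp only [outE, run_andThen, expect_bind, expect_map, Outcome.after]

theorem cost_ret (a : α) : cost f (ret a) = 0 := by
  simp [cost, run_ret, expect_pure]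

theorem cost_draw (μ : PMF α) : cost f (draw μ) = 0 := by
  simp [cost, run_draw, expect_map, expect_const]

theorem cost_askAll (l : List (Finset N)) : cost f (askAll l) = l.length := by
  simp [cost, run_askAll, expect_pure]

theorem cost_andThen (x : Alg N α) (h : α → Alg N β) :
    cost f (x.andThen h) = cost f x + outE f x fun a => cost f (h a) := by
  simp only [cost, outE, run_andThen, expect_bind, expect_map, Outcome.after, Nat.cast_add,
    expect_add, expect_const]

theorem outE_mono {x : Alg N α} {g h : α → ℝ≥0∞} (H : ∀ a, g a ≤ h a) :
    outE f x g ≤ outE f x h := expect_mono fun _ _ => H _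

theorem outE_mono_of_ensures {x : Alg N α} {P : α → Prop} {r w : ℝ} (hx : Ensures f x P r w)
    {g h : α → ℝ≥0∞} (H : ∀ a, P a → g a ≤ h a) :
    outE f x g ≤ outE f x h := expect_mono fun o ho => H _ (hx o ho).1

theorem outE_const (x : Alg N α) (c : ℝ≥0∞) : outE f x (fun _ => c) = c := expect_const _ _

theorem outE_le_of_ensures {x : Alg N α} {P : α → Prop} {r w : ℝ} (hx : Ensures f x P r w)
    {g : α → ℝ≥0∞} {c : ℝ≥0∞} (H : ∀ a, P a → g a ≤ c) : outE f x g ≤ c :=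
  (outE_mono_of_ensures hx H).trans (outE_const x c).le

theorem cost_andThen_le {x : Alg N α} {h : α → Alg N β} {P : α → Prop} {r w : ℝ} {c d : ℝ≥0∞}
    (hx : Ensures f x P r w) (hc : cost f x ≤ c) (H : ∀ a, P a → cost f (h a) ≤ d) :
    cost f (x.andThen h) ≤ c + d := by
  rw [cost_andThen]
  exact add_le_add hc (outE_le_of_ensures hx H)

theorem cost_le_of_ensures {x : Alg N α} {P : α → Prop} {r w : ℝ} (hx : Ensures f x P r w) :
    cost f x ≤ ENNReal.ofReal w := by
  refine expect_le fun o ho => ?_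
  rw [← ENNReal.ofReal_natCast]
  exact ENNReal.ofReal_le_ofReal (hx o ho).2.2

theorem Ensures.mono {x : Alg N α} {P Q : α → Prop} {r r' w w' : ℝ} (hx : Ensures f x P r w)
    (hPQ : ∀ a, P a → Q a) (hr : r ≤ r') (hw : w ≤ w') : Ensures f x Q r' w' :=
  fun o ho => ⟨hPQ _ (hx o ho).1, (hx o ho).2.1.trans hr, (hx o ho).2.2.trans hw⟩

theorem ensures_ret {a : α} {P : α → Prop} {r w : ℝ} (h : P a) (hr : 0 ≤ r) (hw : 0 ≤ w) :
    Ensures f (ret a) P r w := by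
  intro o ho
  rw [run_ret, PMF.mem_support_pure_iff] at ho
  subst ho
  exact ⟨h, by simpa using hr, by simpa using hw⟩

theorem ensures_draw {μ : PMF α} {P : α → Prop} (h : ∀ a ∈ μ.support, P a) :
    Ensures f (draw μ) P 0 0 := by
  intro o ho
  rw [run_draw, PMF.mem_support_map_iff] at ho
  obtain ⟨a, ha, rfl⟩ := ho
  exact ⟨h a ha, by simp, by simp⟩

theorem ensures_askAll (l : List (Finset N)) :
    Ensures f (askAll l) (fun v => v = l.map f) 1 l.length := by
  intro o ho
  rw [run_askAll, PMF.mem_support_pure_iff] at ho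
  subst ho
  exact ⟨rfl, by simp, by simp⟩

theorem ensures_andThen {x : Alg N α} {h : α → Alg N β} {P : α → Prop} {Q : β → Prop}
    {r r' w w' : ℝ} (hx : Ensures f x P r w) (hh : ∀ a, P a → Ensures f (h a) Q r' w') :
    Ensures f (x.andThen h) Q (r + r') (w + w') := by
  intro o ho
  rw [run_andThen, PMF.mem_support_bind_iff] at ho
  obtain ⟨o₁, h₁, ho⟩ := ho
  rw [PMF.mem_support_map_iff] at ho
  obtain ⟨o₂, h₂, rfl⟩ := ho
  obtain ⟨hP, hr, hw⟩ := hx o₁ h₁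
  obtain ⟨hQ, hr', hw'⟩ := hh _ hP o₂ h₂
  exact ⟨hQ, by simpa [Outcome.after] using add_le_add hr hr',
    by simpa [Outcome.after] using add_le_add hw hw'⟩

theorem ensures_par {x : Alg N α} {y : Alg N β} {P : α → Prop} {Q : β → Prop} {r w w' : ℝ}
    (hx : Ensures f x P r w) (hy : Ensures f y Q r w') :
    Ensures f (par x y) (fun z => P z.1 ∧ Q z.2) r (w + w') := by
  intro o ho
  rw [run_par, PMF.mem_support_bind_iff] at ho
  obtain ⟨o₁, h₁, ho⟩ := ho
  rw [PMF.mem_support_map_iff] at ho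
  obtain ⟨o₂, h₂, rfl⟩ := ho
  obtain ⟨hP, hr, hw⟩ := hx o₁ h₁
  obtain ⟨hQ, hr', hw'⟩ := hy o₂ h₂
  refine ⟨⟨hP, hQ⟩, ?_, by simpa [Outcome.both] using add_le_add hw hw'⟩
  simp only [Outcome.both, Nat.cast_max]
  exact max_le hr hr'

theorem cost_par (x : Alg N α) (y : Alg N β) : cost f (par x y) = cost f x + cost f y := by
  simp only [cost, run_par, expect_bind, expect_map, Outcome.both, Nat.cast_add, expect_add,
    expect_const]

theorem outE_par (x : Alg N α) (y : Alg N β) (g : α × β → ℝ≥0∞) :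
    outE f (par x y) g = outE f x fun a => outE f y fun b => g (a, b) := by
  simp only [outE, run_par, expect_bind, expect_map, Outcome.both]

/-- Outputs, rounds and queries of a parallel composition of a family of algorithms. -/
theorem ensures_parList {ι : Type} {F : ι → Alg N α} {P : ι → α → Prop} {r w : ℝ}
    (hr : 0 ≤ r) (l : List ι) (hF : ∀ i ∈ l, Ensures f (F i) (P i) r w) :
    Ensures f (parList (l.map F)) (fun out => List.Forall₂ P l out) r (l.length * w) := by
  induction l with
  | nil => exact ensures_ret List.Forall₂.nil hr (by simp)
  | cons i l ih =>
    have h := ensures_andThen (r' := 0) (w' := 0)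
      (h := fun z : α × List α => (ret (z.1 :: z.2) : Alg N (List α)))
      (Q := fun out => List.Forall₂ P (i :: l) out)
      (ensures_par (hF i (by simp)) (ih fun j hj => hF j (by simp [hj])))
      (fun z hz => ensures_ret (List.Forall₂.cons hz.1 hz.2) le_rfl le_rfl)
    refine h.mono (fun _ h => h) (by simp) (le_of_eq ?_)
    simp only [List.length_cons]; push_cast; ring

theorem cost_parList_le {ι : Type} {F : ι → Alg N α} {c : ℝ≥0∞} (l : List ι)
    (hF : ∀ i ∈ l, cost f (F i) ≤ c) : cost f (parList (l.map F)) ≤ l.length * c := by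
  induction l with
  | nil => simp [parList, cost_ret]
  | cons i l ih =>
    simp only [List.map_cons, parList, cost_andThen, cost_par, cost_ret, outE_const,
      List.length_cons]
    have := ih fun j hj => hF j (by simp [hj])
    calc cost f (F i) + cost f (parList (l.map F)) + 0 ≤ c + l.length * c := by
          rw [add_zero]; exact add_le_add (hF i (by simp)) this
      _ = _ := by push_cast; ring

theorem failure_ret_of_pos {a : α} {P : α → Prop} (h : P a) :
    failure f (ret a : Alg N α) P = 0 := by
  rw [failure, outE_ret, if_pos h]

theorem failure_ret_le (a : α) (P : α → Prop) : failure f (ret a : Alg N α) P ≤ 1 := by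
  rw [failure, outE_ret]
  split_ifs <;> simp

theorem failure_eq_zero (x : Alg N α) {P : α → Prop} (h : ∀ a, P a) : failure f x P = 0 := by
  unfold failure
  simp only [h, if_true]
  exact outE_const x 0

theorem failure_eq_zero_of_ensures {x : Alg N α} {P Q : α → Prop} {r w : ℝ}
    (hx : Ensures f x P r w) (h : ∀ a, P a → Q a) : failure f x Q = 0 := by
  refine le_antisymm (outE_le_of_ensures hx fun a ha => ?_) zero_le
  simp [h a ha]

theorem failure_le_one (x : Alg N α) (P : α → Prop) : failure f x P ≤ 1 := by
  refine expect_le fun o _ => ?_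
  dsimp only
  split_ifs <;> simp

theorem failure_andThen (x : Alg N α) (h : α → Alg N β) (P : β → Prop) :
    failure f (x.andThen h) P = outE f x fun a => failure f (h a) P :=
  outE_andThen _ _ _

/-- Failure of a sequential composition: the first part fails, or the second one does. -/
theorem failure_andThen_le {x : Alg N α} {h : α → Alg N β} {P R : α → Prop} {r w : ℝ}
    {Q : β → Prop} {c d : ℝ≥0∞} (hx : Ensures f x R r w) (hc : failure f x P ≤ c)
    (hd : ∀ a, R a → P a → failure f (h a) Q ≤ d) : failure f (x.andThen h) Q ≤ c + d := by
  classical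
  rw [failure_andThen]
  calc _ ≤ outE f x (fun a => (if P a then 0 else 1) + d) := by
        refine outE_mono_of_ensures hx fun a hR => ?_
        by_cases ha : P a
        · simpa [ha] using hd a hR ha
        · simp only [ha, if_false]
          exact (failure_le_one _ _).trans le_self_add
    _ = failure f x P + d := by
        simp only [failure, outE, expect_add, expect_const]
    _ ≤ c + d := add_le_add hc le_rfl

/-- Union bound for a parallel composition. -/
theorem failure_parList_le {ι : Type} {F : ι → Alg N α} {P : ι → α → Prop} {c : ℝ≥0∞} (l : List ι)
    (hF : ∀ i ∈ l, failure f (F i) (P i) ≤ c) :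
    failure f (parList (l.map F)) (fun out => List.Forall₂ P l out) ≤ l.length * c := by
  classical
  induction l with
  | nil => simp [parList, failure_ret_of_pos]
  | cons i l ih =>
    simp only [List.map_cons, parList, failure_andThen, outE_par, List.length_cons]
    have h2 := ih fun j hj => hF j (by simp [hj])
    calc _ ≤ outE f (F i) (fun a => (if P i a then 0 else 1) + l.length * c) := by
          refine outE_mono fun a => ?_
          by_cases ha : P i a
          · refine le_trans (outE_mono fun b => ?_) (h2.trans le_add_self)
            by_cases hb : List.Forall₂ P l b
            · rw [failure_ret_of_pos (List.Forall₂.cons ha hb)]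
              exact zero_le
            · simpa [hb] using failure_ret_le _ _
          · simp only [ha, if_false]
            refine le_trans ?_ (le_self_add (a := 1) (b := (l.length : ℝ≥0∞) * c))
            exact expect_le fun o _ => failure_ret_le _ _
      _ = failure f (F i) (P i) + l.length * c := by
          simp only [failure, outE, expect_add, expect_const]
      _ ≤ c + l.length * c := add_le_add (hF i (by simp)) le_rfl
      _ = _ := by push_cast; ring

end Alg

/-! ### Marginal gains -/

section Gains

variable {N : Type} [DecidableEq N]

/-- For `x ∈ T` the gain over `T` is zero, so monotonicity removes the side condition `x ∉ T` of the
definition. -/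
theorem Submodular.gain_antitone {h : Finset N → ℝ} (hs : Submodular h) (hm : Monotone h)
    {S T : Finset N} (hST : S ⊆ T) (x : N) : h (insert x T) - h T ≤ h (insert x S) - h S := by
  by_cases hx : x ∈ T
  · rw [Finset.insert_eq_of_mem hx, sub_self]
    exact sub_nonneg.2 (hm (Finset.subset_insert x S))
  · exact hs S T hST x hx

theorem Submodular.union_sub_le_sum {h : Finset N → ℝ} (hs : Submodular h) (hm : Monotone h)
    (S A : Finset N) : h (S ∪ A) - h S ≤ ∑ x ∈ A, (h (insert x S) - h S) := by
  induction A using Finset.induction_on with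
  | empty => simp
  | insert x A hx ih =>
    rw [Finset.sum_insert hx, Finset.union_insert]
    have := hs.gain_antitone hm (Finset.subset_union_left (s₁ := S) (s₂ := A)) x
    linarith

theorem Submodular.union_left {h : Finset N → ℝ} (hs : Submodular h) (hm : Monotone h)
    (S : Finset N) : Submodular fun T => h (S ∪ T) := by
  intro A B hAB x _
  simp only [Finset.union_insert]
  exact hs.gain_antitone hm (Finset.union_subset_union_right hAB) x

theorem monotone_union_left {h : Finset N → ℝ} (hm : Monotone h) (S : Finset N) :
    Monotone fun T => h (S ∪ T) :=
  fun _ _ hAB => hm (Finset.union_subset_union_right hAB)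

/-- The elements of `A` whose marginal gain with respect to `T` is at least `τ`. -/
noncomputable def cand (g : Finset N → ℝ) (τ : ℝ) (T A : Finset N) : Finset N :=
  open Classical in A.filter fun x => τ ≤ g (insert x T) - g T

theorem mem_cand {g : Finset N → ℝ} {τ : ℝ} {T A : Finset N} {x : N} :
    x ∈ cand g τ T A ↔ x ∈ A ∧ τ ≤ g (insert x T) - g T := by simp [cand]

theorem cand_subset (g : Finset N → ℝ) (τ : ℝ) (T A : Finset N) : cand g τ T A ⊆ A :=
  Finset.filter_subset _ _

theorem notMem_of_mem_cand {g : Finset N → ℝ} {τ : ℝ} (hτ : 0 < τ) {T A : Finset N} {x : N}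
    (hx : x ∈ cand g τ T A) : x ∉ T := by
  intro hT
  have := (mem_cand.1 hx).2
  rw [Finset.insert_eq_of_mem hT, sub_self] at this
  linarith

theorem cand_antitone {h : Finset N → ℝ} (hs : Submodular h) (hm : Monotone h) {τ : ℝ}
    {T T' : Finset N} (hT : T ⊆ T') (A : Finset N) : cand h τ T' A ⊆ cand h τ T A := by
  intro x hx
  rw [mem_cand] at hx ⊢
  exact ⟨hx.1, hx.2.trans (hs.gain_antitone hm hT x)⟩

/-- Gains only decrease as the solution grows, so an element discarded once never returns. The loop
may therefore keep only the filtered set and forget the original ground set. -/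
theorem cand_cand {h : Finset N → ℝ} (hs : Submodular h) (hm : Monotone h) {τ : ℝ}
    {T T' : Finset N} (hT : T ⊆ T') (A : Finset N) :
    cand h τ T' (cand h τ T A) = cand h τ T' A := by
  ext x
  simp only [mem_cand]
  constructor
  · rintro ⟨⟨h1, -⟩, h2⟩; exact ⟨h1, h2⟩
  · rintro ⟨h1, h2⟩; exact ⟨⟨h1, h2.trans (hs.gain_antitone hm hT x)⟩, h2⟩

/-- The number of elements that are still to be treated after `T` has been chosen: none if `T` has
the maximal size `k`. -/
noncomputable def pending (h : Finset N → ℝ) (τ : ℝ) (k : ℕ) (A T : Finset N) : ℕ :=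
  if k ≤ T.card then 0 else (cand h τ T A).card

theorem pending_le (h : Finset N → ℝ) (τ : ℝ) (k : ℕ) (A T : Finset N) :
    pending h τ k A T ≤ A.card := by
  unfold pending
  split_ifs
  · exact Nat.zero_le _
  · exact Finset.card_le_card (cand_subset _ _ _ _)

theorem pending_antitone {h : Finset N → ℝ} (hs : Submodular h) (hm : Monotone h) {τ : ℝ} {k : ℕ}
    {T T' : Finset N} (hT : T ⊆ T') (A : Finset N) :
    pending h τ k A T' ≤ pending h τ k A T := by
  have h1 := Finset.card_le_card hT
  have h2 := Finset.card_le_card (cand_antitone hs hm (τ := τ) hT A)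
  unfold pending
  split_ifs <;> omega

end Gains

/-! ### Extending the current solution along a random order of the candidates -/

section Extend

variable {N : Type} [DecidableEq N]

/-- A uniformly random order of the elements of `A`, if `n = |A|`. -/
noncomputable def shuffle : ℕ → Finset N → PMF (List N)
  | 0, _ => PMF.pure []
  | n + 1, A =>
    if hA : A.Nonempty then
      (PMF.uniformOfFinset A hA).bind fun x => (shuffle n (A.erase x)).map (x :: ·)
    else PMF.pure []

/-- The counter `y` of elements of small marginal gain, updated when `x` is added to `T`. -/
noncomputable def countSmall (g : Finset N → ℝ) (τ : ℝ) (T : Finset N) (x : N) (y : ℕ) : ℕ :=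
  open Classical in if τ ≤ g (insert x T) - g T then y else y + 1

/-- Add the elements of a list to `T` one by one. After `i` steps, `y` counts those whose
marginal gain was below `τ`; the process stops before `y > ε i`, or when `|T| = k`. -/
noncomputable def extend (g : Finset N → ℝ) (τ ε : ℝ) (k : ℕ) :
    ℕ → ℕ → Finset N → List N → Finset N
  | _, _, T, [] => T
  | i, y, T, x :: l =>
    open Classical in
    if T.card < k ∧ (countSmall g τ T x y : ℝ) ≤ ε * (i + 1 : ℕ) then
      extend g τ ε k (i + 1) (countSmall g τ T x y) (insert x T) l
    else T

/-- The sets `T ∪ {x₁, …, xᵢ}` for a list `x₁, …, xₘ`. -/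
def prefixChain : Finset N → List N → List (Finset N)
  | T, [] => [T]
  | T, x :: l => T :: prefixChain (insert x T) l

theorem length_prefixChain (T : Finset N) (l : List N) :
    (prefixChain T l).length = l.length + 1 := by
  induction l generalizing T with
  | nil => rfl
  | cons x l ih => simp [prefixChain, ih]

theorem mem_prefixChain_self (T : Finset N) (l : List N) : T ∈ prefixChain T l := by
  cases l <;> simp [prefixChain]

/-- Only values at prefix sets are read, so the table of oracle answers may be replaced by the true
function. -/
theorem extend_congr {g h : Finset N → ℝ} {τ ε : ℝ} {k : ℕ} {l : List N} {i y : ℕ} {T : Finset N}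
    (hgh : ∀ U ∈ prefixChain T l, g U = h U) :
    extend g τ ε k i y T l = extend h τ ε k i y T l := by
  induction l generalizing i y T with
  | nil => rfl
  | cons x l ih =>
    have h1 : g T = h T := hgh _ (by simp [prefixChain])
    have h2 : g (insert x T) = h (insert x T) :=
      hgh _ (by simp [prefixChain, mem_prefixChain_self])
    have h3 := fun i y => ih (i := i) (y := y) (T := insert x T)
      fun U hU => hgh U (by simp [prefixChain, hU])
    have h4 : countSmall g τ T x y = countSmall h τ T x y := by
      unfold countSmall
      rw [h1, h2]
    rw [extend, extend, h4, h3]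

variable {h : Finset N → ℝ} {τ ε : ℝ} {k : ℕ}

theorem subset_extend (i y : ℕ) (T : Finset N) (l : List N) :
    T ⊆ extend h τ ε k i y T l := by
  induction l generalizing i y T with
  | nil => exact subset_rfl
  | cons x l ih =>
    rw [extend]
    split
    · exact (Finset.subset_insert x T).trans (ih _ _ _)
    · exact subset_rfl

theorem extend_subset (i y : ℕ) (T : Finset N) (l : List N) :
    extend h τ ε k i y T l ⊆ T ∪ l.toFinset := by
  induction l generalizing i y T with
  | nil => simp [extend]
  | cons x l ih =>
    rw [extend]
    split
    · refine (ih _ _ _).trans (le_of_eq ?_)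
      ext z; simp
    · exact Finset.subset_union_left

theorem card_extend_le (i y : ℕ) (T : Finset N) (l : List N) (hT : T.card ≤ k) :
    (extend h τ ε k i y T l).card ≤ k := by
  induction l generalizing i y T with
  | nil => exact hT
  | cons x l ih =>
    rw [extend]
    split
    · next hc => exact ih _ _ _ ((Finset.card_insert_le x T).trans hc.1)
    · exact hT

/-- Each of the `i - y` elements of large gain contributes `τ`, the others at least `0`, and `y ≤ ε
i` turns this into `(1 - ε) τ i`. The size of `T` is only bounded by `c + i` because the list may
repeat elements or meet `T`. -/
theorem gain_extend (hm : Monotone h) (hτ : 0 < τ) (hε : ε ≤ 1) {i y c : ℕ} {v : ℝ}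
    {T : Finset N} {l : List N} (hy : (y : ℝ) ≤ ε * i) (hc : T.card ≤ c + i)
    (hv : v + (i - y) * τ ≤ h T) :
    v + (1 - ε) * τ * ((extend h τ ε k i y T l).card - c) ≤ h (extend h τ ε k i y T l) := by
  have hend : ∀ {i y : ℕ} {T : Finset N}, (y : ℝ) ≤ ε * i → T.card ≤ c + i →
      v + (i - y) * τ ≤ h T → v + (1 - ε) * τ * (T.card - c) ≤ h T := by
    intro i y T hy hc hv
    have h1 : (T.card : ℝ) ≤ c + i := by exact_mod_cast hc
    have h2 : (1 - ε) * τ * (T.card - c) ≤ (1 - ε) * τ * i :=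
      mul_le_mul_of_nonneg_left (by linarith) (mul_nonneg (by linarith) hτ.le)
    have h3 := mul_le_mul_of_nonneg_right hy hτ.le
    linarith
  induction l generalizing i y T with
  | nil => exact hend hy hc hv
  | cons x l ih =>
    rw [extend]
    split
    · next hcond =>
      refine ih hcond.2 ?_ ?_
      · have := Finset.card_insert_le x T
        omega
      · unfold countSmall
        split_ifs with hg
        · push_cast; linarith
        · have := hm (Finset.subset_insert x T)
          push_cast; linarith
    · exact hend hy hc hv

theorem extend_zero_cons (hε : 0 ≤ ε) {T : Finset N} {x : N} {l : List N} (hT : T.card < k)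
    (hx : τ ≤ h (insert x T) - h T) :
    extend h τ ε k 0 0 T (x :: l) = extend h τ ε k 1 0 (insert x T) l := by
  rw [extend]
  simp [countSmall, hx, hT, hε]

theorem mem_support_shuffle {n : ℕ} {A : Finset N} (hn : A.card = n) {l : List N}
    (hl : l ∈ (shuffle n A).support) : l.length = n ∧ l.toFinset ⊆ A := by
  induction n generalizing A l with
  | zero =>
    rw [shuffle, PMF.mem_support_pure_iff] at hl
    subst hl
    simp
  | succ n ih =>
    have hA : A.Nonempty := Finset.card_pos.1 (by omega)
    rw [shuffle, dif_pos hA, PMF.mem_support_bind_iff] at hl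
    obtain ⟨x, hx, hl⟩ := hl
    rw [PMF.mem_support_uniformOfFinset_iff] at hx
    rw [PMF.mem_support_map_iff] at hl
    obtain ⟨l', hl', rfl⟩ := hl
    obtain ⟨h1, h2⟩ := ih (by rw [Finset.card_erase_of_mem hx, hn]; rfl) hl'
    refine ⟨by simp [h1], ?_⟩
    rw [List.toFinset_cons]
    exact Finset.insert_subset hx (h2.trans (Finset.erase_subset x A))

open Real in
/-- The expected number of pending elements along a random order, while fewer than a fraction
`1 - γ` of the elements of `A` have left the candidates: an exponential supermartingale argument. -/
theorem expect_pending_extend_aux (hs : Submodular h) (hm : Monotone h) (hτ : 0 < τ)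
    {γ θ a b : ℝ} (hγ : 0 ≤ γ) (hγ' : γ ≤ 1) (hθ : 0 ≤ θ)
    (hstep : exp (-(θ * a)) * (exp θ - γ * (exp θ - 1)) ≤ 1)
    (hcross : ∀ i y : ℕ, y < i → ε * i < y → b ≤ y - a * i)
    {A : Finset N} (n : ℕ) {B T : Finset N} (hB : B.card = n) (hBA : B ⊆ A)
    (hAT : ∀ x ∈ A, x ∉ B → x ∈ T) {i y : ℕ} (hyi : y < i) :
    expect (shuffle n B) (fun l => (pending h τ k A (extend h τ ε k i y T l) : ℝ≥0∞)) ≤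
      ENNReal.ofReal ((γ + (1 - γ) * exp (θ * (y - a * i - b))) * A.card) := by
  classical
  have hbd : ∀ i y : ℕ, γ * A.card ≤ (γ + (1 - γ) * exp (θ * (y - a * i - b))) * A.card := by
    intro i y
    refine mul_le_mul_of_nonneg_right ?_ (Nat.cast_nonneg _)
    have := mul_nonneg (sub_nonneg.2 hγ') (exp_pos (θ * (y - a * i - b))).le
    linarith
  induction n generalizing B T i y with
  | zero =>
    rw [shuffle, expect_pure, extend]
    -- The order is exhausted, so all of `A` lies in `T`, and elements of `T` have gain `0 < τ`.
    have : pending h τ k A T = 0 := by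
      unfold pending
      split_ifs
      · rfl
      · rw [Finset.card_eq_zero, Finset.eq_empty_iff_forall_notMem]
        intro x hx
        refine notMem_of_mem_cand hτ hx (hAT x (cand_subset _ _ _ _ hx) ?_)
        rw [Finset.card_eq_zero.1 hB]; simp
    simp [this]
  | succ n ih =>
    -- Enough elements are already gone; pending elements never increase, so the first summand `γ
    -- |A|` suffices from here on.
    by_cases hend : (pending h τ k A T : ℝ) ≤ γ * A.card
    · refine expect_le fun l _ => ?_
      rw [← ENNReal.ofReal_natCast]
      refine ENNReal.ofReal_le_ofReal (le_trans ?_ (hend.trans (hbd i y)))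
      exact_mod_cast pending_antitone hs hm (subset_extend i y T l) A
    have hk : T.card < k := by
      by_contra hk
      exact hend (by rw [pending, if_pos (not_lt.1 hk)]; simpa using by positivity)
    have hg : γ * A.card < (cand h τ T A).card := by
      rw [pending, if_neg (by omega)] at hend
      exact not_le.1 hend
    have hBne : B.Nonempty := Finset.card_pos.1 (by omega)
    rw [shuffle, dif_pos hBne, expect_bind, expect_uniformOfFinset, hB]
    set Z : ℝ := exp (θ * (y - a * i - b)) with hZ
    -- Effect of one draw on the exponential: the factor `exp (-θ a)` always, and `exp θ` in
    -- addition if `x` has small gain.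
    have hterm : ∀ x ∈ B,
        expect ((shuffle n (B.erase x)).map (x :: ·))
          (fun l => (pending h τ k A (extend h τ ε k i y T l) : ℝ≥0∞)) ≤
        ENNReal.ofReal ((γ + (1 - γ) * (Z * exp (-(θ * a)) *
          (if x ∈ cand h τ T A then 1 else exp θ))) * A.card) := by
      intro x hx
      have hif : (if x ∈ cand h τ T A then y else y + 1) = countSmall h τ T x y := by
        simp [countSmall, mem_cand, hBA hx]
      set y' : ℕ := if x ∈ cand h τ T A then y else y + 1 with hy'
      have hval : exp (θ * (y' - a * (i + 1 : ℕ) - b)) =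
          Z * exp (-(θ * a)) * (if x ∈ cand h τ T A then 1 else exp θ) := by
        rw [hZ, hy']
        split_ifs
        · rw [mul_one, ← exp_add]; push_cast; congr 1; ring
        · rw [← exp_add, ← exp_add]; push_cast; congr 1; ring
      rw [← hval, expect_map]
      have hy'i : y' < i + 1 := by rw [hy']; split_ifs <;> omega
      simp only [extend, ← hif]
      by_cases hc : (y' : ℝ) ≤ ε * (i + 1 : ℕ)
      · simp only [hk, hc, and_self, if_true]
        refine ih (B := B.erase x) (T := insert x T) ?_ ((Finset.erase_subset x B).trans hBA) ?_ hy'i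
        · rw [Finset.card_erase_of_mem hx, hB]; rfl
        · intro z hz hzB
          by_cases hzx : z = x
          · simp [hzx]
          · exact Finset.mem_insert_of_mem (hAT z hz fun h => hzB (Finset.mem_erase.2 ⟨hzx, h⟩))
      · simp only [hc, and_false, if_false]
        refine expect_le fun l _ => ?_
        rw [← ENNReal.ofReal_natCast]
        refine ENNReal.ofReal_le_ofReal ?_
        have h1 : (pending h τ k A T : ℝ) ≤ A.card := by exact_mod_cast pending_le h τ k A T
        -- The process stops because of too many small gains. Then the exponent is nonnegative, so
        -- the claimed bound is at least `|A|` and holds trivially.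
        have h2 := hcross (i + 1) y' hy'i (not_le.1 hc)
        have h3 : 1 ≤ exp (θ * (y' - a * (i + 1 : ℕ) - b)) :=
          one_le_exp (mul_nonneg hθ (by linarith))
        have h4 : 1 ≤ γ + (1 - γ) * exp (θ * (y' - a * (i + 1 : ℕ) - b)) := by
          nlinarith [mul_le_mul_of_nonneg_left h3 (sub_nonneg.2 hγ')]
        calc (pending h τ k A T : ℝ) ≤ 1 * A.card := by linarith
          _ ≤ _ := mul_le_mul_of_nonneg_right h4 (Nat.cast_nonneg _)
    have hpos : ∀ x, 0 ≤ (γ + (1 - γ) * (Z * exp (-(θ * a)) *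
          (if x ∈ cand h τ T A then 1 else exp θ))) * (A.card : ℝ) := by
      intro x
      have : (0 : ℝ) ≤ if x ∈ cand h τ T A then 1 else exp θ := by split_ifs <;> positivity
      have h1 : 0 ≤ 1 - γ := sub_nonneg.2 hγ'
      have h2 := (exp_pos (-(θ * a))).le
      have h3 : 0 ≤ Z := (exp_pos _).le
      positivity
    refine (mul_le_mul_right (Finset.sum_le_sum hterm) _).trans ?_
    rw [← ENNReal.ofReal_sum_of_nonneg fun x _ => hpos x]
    have hinv : (((n + 1 : ℕ) : ℝ≥0∞))⁻¹ = ENNReal.ofReal (((n + 1 : ℕ) : ℝ)⁻¹) := by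
      rw [ENNReal.ofReal_inv_of_pos (by positivity), ENNReal.ofReal_natCast]
    rw [hinv, ← ENNReal.ofReal_mul (by positivity)]
    refine ENNReal.ofReal_le_ofReal ?_
    rw [← Finset.sum_mul, ← mul_assoc]
    refine mul_le_mul_of_nonneg_right ?_ (Nat.cast_nonneg _)
    rw [inv_mul_le_iff₀ (by positivity), Finset.sum_add_distrib, ← Finset.mul_sum,
      ← Finset.mul_sum, Finset.sum_const, hB, nsmul_eq_mul]
    -- Treated elements are in `T` and are no candidates, so more than `γ |A| ≥ γ |B|` of the
    -- elements eligible for the next draw have large gain.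
    have hsub : cand h τ T A ⊆ B := fun x hx => by
      by_contra hxB
      exact notMem_of_mem_cand hτ hx (hAT x (cand_subset _ _ _ _ hx) hxB)
    have hsum : ∑ x ∈ B, (if x ∈ cand h τ T A then (1 : ℝ) else exp θ) =
        (n + 1 : ℕ) * exp θ - (cand h τ T A).card * (exp θ - 1) := by
      have : ∀ x ∈ B, (if x ∈ cand h τ T A then (1 : ℝ) else exp θ) =
          exp θ - if x ∈ cand h τ T A then (exp θ - 1) else 0 := by
        intro x _; split_ifs <;> ring
      rw [Finset.sum_congr rfl this, Finset.sum_sub_distrib, Finset.sum_const, hB,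
        ← Finset.sum_filter, Finset.filter_mem_eq_inter, Finset.inter_eq_right.2 hsub,
        Finset.sum_const, nsmul_eq_mul, nsmul_eq_mul]
    rw [hsum]
    have hnA : ((n + 1 : ℕ) : ℝ) ≤ A.card := by
      rw [← hB]; exact_mod_cast Finset.card_le_card hBA
    have hθ1 : 0 ≤ exp θ - 1 := sub_nonneg.2 (one_le_exp hθ)
    have hcount : ((n + 1 : ℕ) : ℝ) * exp θ - (cand h τ T A).card * (exp θ - 1) ≤
        (n + 1 : ℕ) * (exp θ - γ * (exp θ - 1)) := by
      have h1 : γ * ((n + 1 : ℕ) : ℝ) ≤ (cand h τ T A).card :=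
        (mul_le_mul_of_nonneg_left hnA hγ).trans hg.le
      nlinarith [mul_le_mul_of_nonneg_right h1 hθ1]
    have hfin : Z * exp (-(θ * a)) *
        ((n + 1 : ℕ) * exp θ - (cand h τ T A).card * (exp θ - 1)) ≤ (n + 1 : ℕ) * Z := by
      have hZ0 : 0 ≤ Z := (exp_pos _).le
      calc _ ≤ Z * exp (-(θ * a)) * ((n + 1 : ℕ) * (exp θ - γ * (exp θ - 1))) :=
            mul_le_mul_of_nonneg_left hcount (by positivity)
        _ = ((n + 1 : ℕ) * Z) * (exp (-(θ * a)) * (exp θ - γ * (exp θ - 1))) := by ring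
        _ ≤ ((n + 1 : ℕ) * Z) * 1 := mul_le_mul_of_nonneg_left hstep (by positivity)
        _ = _ := by ring
    nlinarith [mul_le_mul_of_nonneg_left hfin (sub_nonneg.2 hγ')]

-- The first element of the order is a candidate over `T` itself, so it is accepted and counted as
-- large. The supermartingale thus starts at `i = 1`, `y = 0`, which yields the strict invariant `y
-- < i`.
open Real in
theorem expect_pending_extend (hs : Submodular h) (hm : Monotone h) (hτ : 0 < τ) (hε : 0 ≤ ε)
    {γ θ a b : ℝ} (hγ : 0 ≤ γ) (hγ' : γ ≤ 1) (hθ : 0 ≤ θ) (ha : 0 ≤ a)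
    (hstep : exp (-(θ * a)) * (exp θ - γ * (exp θ - 1)) ≤ 1)
    (hcross : ∀ i y : ℕ, y < i → ε * i < y → b ≤ y - a * i)
    {A T : Finset N} (hT : T.card < k) (hA : cand h τ T A = A) :
    expect (shuffle A.card A) (fun l => (pending h τ k A (extend h τ ε k 0 0 T l) : ℝ≥0∞)) ≤
      ENNReal.ofReal ((γ + (1 - γ) * exp (-(θ * b))) * A.card) := by
  rcases A.eq_empty_or_nonempty with rfl | hne
  · refine expect_le fun l _ => ?_
    simpa using pending_le h τ k ∅ _
  obtain ⟨n, hn⟩ : ∃ n, A.card = n + 1 := ⟨A.card - 1, by have := hne.card_pos; omega⟩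
  rw [hn, shuffle, dif_pos hne, expect_bind]
  refine expect_le fun x hx => ?_
  rw [PMF.mem_support_uniformOfFinset_iff] at hx
  rw [expect_map]
  have hgx : τ ≤ h (insert x T) - h T := (mem_cand.1 (hA.symm ▸ hx)).2
  simp only [extend_zero_cons hε hT hgx]
  refine (expect_pending_extend_aux hs hm hτ hγ hγ' hθ hstep hcross n (A := A) (B := A.erase x)
    (T := insert x T) ?_ (Finset.erase_subset x A) ?_ (i := 1) (y := 0) one_pos).trans ?_
  · rw [Finset.card_erase_of_mem hx, hn]; rfl
  · intro z hz hzB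
    by_cases hzx : z = x
    · simp [hzx]
    · exact absurd (Finset.mem_erase.2 ⟨hzx, hz⟩) hzB
  · rw [hn]
    refine ENNReal.ofReal_le_ofReal (mul_le_mul_of_nonneg_right ?_ (by positivity))
    have : exp (θ * (((0 : ℕ) : ℝ) - a * ((1 : ℕ) : ℝ) - b)) ≤ exp (-(θ * b)) := by
      refine exp_le_exp.2 ?_
      push_cast
      nlinarith [mul_nonneg hθ ha]
    have := mul_le_mul_of_nonneg_left this (sub_nonneg.2 hγ')
    linarith

end Extend

/-! ### Parameters of the supermartingale -/

section Parameters

open Real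

/-- The rate at which the number of candidates decreases in one iteration. -/
noncomputable def shrinkRate (ε : ℝ) : ℝ := -log (1 - ε) / 10000

theorem shrinkRate_pos {ε : ℝ} (h0 : 0 < ε) (h1 : ε < 1) : 0 < shrinkRate ε := by
  have : log (1 - ε) < 0 := log_neg (by linarith) (by linarith)
  unfold shrinkRate
  linarith

theorem le_shrinkRate {ε : ℝ} (h1 : ε < 1) : ε / 10000 ≤ shrinkRate ε := by
  have : log (1 - ε) ≤ 1 - ε - 1 := log_le_sub_one_of_pos (by linarith)
  unfold shrinkRate
  linarith

/-- Bernoulli's inequality for the exponent `1 / 10000`; it makes the expected costs of the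
iterations a geometric series. -/
theorem exp_neg_shrinkRate_le {ε : ℝ} (h1 : ε < 1) :
    exp (-shrinkRate ε) ≤ 1 - ε / 10000 := by
  have h := rpow_one_add_le_one_add_mul_self (s := -ε) (p := 1 / 10000) (by linarith) (by norm_num)
    (by norm_num)
  rw [rpow_def_of_pos (by linarith)] at h
  refine (le_of_eq ?_).trans (h.trans (le_of_eq (by ring)))
  unfold shrinkRate
  congr 1
  rw [← sub_eq_add_neg]
  ring

/-- Two regimes are needed. For `ε` bounded away from `1` the drop only has to be of order `ε`; near
`1` it has to be a power of `1 - ε`, which forces `γ` to tend to `0` and `θ` to infinity. -/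
theorem exists_parameters {ε : ℝ} (h0 : 0 < ε) (h1 : ε < 1) :
    ∃ γ θ a b : ℝ, 0 ≤ γ ∧ γ ≤ 1 ∧ 0 ≤ θ ∧ 0 ≤ a ∧
      exp (-(θ * a)) * (exp θ - γ * (exp θ - 1)) ≤ 1 ∧
      (∀ i y : ℕ, y < i → ε * i < y → b ≤ y - a * i) ∧
      γ + (1 - γ) * exp (-(θ * b)) ≤ exp (-shrinkRate ε) := by
  rcases le_or_gt (1 / 625) (1 - ε) with hp | hp
  · refine ⟨1 - ε / 7, 2, ε / 2, 1 / 2, by linarith, by linarith, by norm_num, by linarith,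
      ?_, ?_, ?_⟩
    · have he : exp 2 ≤ 8 := by
        have h := exp_one_lt_d9
        have : exp 2 = exp 1 * exp 1 := by rw [← exp_add]; norm_num
        rw [this]
        nlinarith [exp_pos 1]
      have h2 : exp 2 - (1 - ε / 7) * (exp 2 - 1) ≤ exp ε := by
        have := add_one_le_exp ε
        nlinarith
      calc _ ≤ exp (-(2 * (ε / 2))) * exp ε := mul_le_mul_of_nonneg_left h2 (exp_pos _).le
        _ = 1 := by rw [← exp_add]; simp; ring
    -- Crossing forces `y ≥ 1`, so `y - ε i / 2 > y / 2 ≥ 1 / 2`.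
    · intro i y _ hy
      have h2 : (1 : ℝ) ≤ y := by
        have : 0 < (y : ℝ) := lt_of_le_of_lt (by positivity) hy
        exact_mod_cast this
      linarith
    · have he : exp (-(2 * (1 / 2))) ≤ 0.37 := by
        have : exp (-(2 * (1 / 2))) = (exp 1)⁻¹ := by rw [← exp_neg]; norm_num
        rw [this, inv_le_comm₀ (exp_pos _) (by norm_num)]
        have := exp_one_gt_d9
        norm_num at this ⊢
        linarith
      have hl : 1 - (1 - ε)⁻¹ ≤ log (1 - ε) := one_sub_inv_le_log_of_pos (by linarith)
      have hinv : (1 - ε)⁻¹ ≤ 625 := by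
        rw [inv_le_comm₀ (by linarith) (by norm_num)]; linarith
      have hinv' : (1 - ε)⁻¹ - 1 = ε * (1 - ε)⁻¹ := by
        have : (1 - ε) ≠ 0 := by linarith
        field_simp; ring
      have h3 : ε * (1 - ε)⁻¹ ≤ ε * 625 := mul_le_mul_of_nonneg_left hinv h0.le
      have h4 := add_one_le_exp (-shrinkRate ε)
      have h5 : shrinkRate ε ≤ ε * 0.0625 := by
        unfold shrinkRate; linarith
      nlinarith
  · set s := √(1 - ε) with hs
    have hs0 : 0 < s := sqrt_pos.2 (by linarith)
    have hs2 : s ^ 2 = 1 - ε := sq_sqrt (by linarith)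
    have hs1 : s < 1 / 25 := by nlinarith
    have hlog : 0 ≤ -log s := by
      have := log_nonpos hs0.le (by linarith)
      linarith
    have hexp : exp (-log s) = s⁻¹ := by rw [exp_neg, exp_log hs0]
    have hlog' : -log s ≤ s⁻¹ - 1 := by
      have := log_le_sub_one_of_pos (inv_pos.2 hs0)
      rwa [log_inv] at this
    -- With `s = √(1 - ε)`, `exp θ = s⁻¹`. The weight `4 s` of the candidates outweighs the loss `2
    -- s² log (1 / s) ≤ 2 s - 2 s²` that comes from `a < 1`.
    refine ⟨4 * s, -log s, 1 - 2 * s ^ 2, 1, by positivity, by linarith, hlog, by nlinarith,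
      ?_, ?_, ?_⟩
    · have h2 : exp (-log s) - 4 * s * (exp (-log s) - 1) ≤ s⁻¹ * exp (-(4 * s * (1 - s))) := by
        have h := add_one_le_exp (-(4 * s * (1 - s)))
        have h' := mul_le_mul_of_nonneg_left h (inv_pos.2 hs0).le
        refine (le_of_eq ?_).trans h'
        rw [hexp]
        field_simp
        ring
      have h3 : s⁻¹ = exp (-log s) := hexp.symm
      calc _ ≤ exp (-(-log s * (1 - 2 * s ^ 2))) * (s⁻¹ * exp (-(4 * s * (1 - s)))) :=
            mul_le_mul_of_nonneg_left h2 (exp_pos _).le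
        _ = exp (2 * s ^ 2 * (-log s) - 4 * s * (1 - s)) := by
            rw [h3, ← exp_add, ← exp_add]; congr 1; ring
        _ ≤ 1 := by
            rw [exp_le_one_iff]
            have h4 : 2 * s ^ 2 * (-log s) ≤ 2 * s ^ 2 * (s⁻¹ - 1) :=
              mul_le_mul_of_nonneg_left hlog' (by positivity)
            have h5 : 2 * s ^ 2 * (s⁻¹ - 1) = 2 * s - 2 * s ^ 2 := by field_simp
            nlinarith
    -- Here `y > i - s² i` and `y ≤ i - 1` give `s² i > 1`; a crossing can only happen late, and `y
    -- - (1 - 2 s²) i > s² i > 1`.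
    · intro i y hyi hy
      have h2 : (y : ℝ) + 1 ≤ i := by exact_mod_cast hyi
      have h3 : ε = 1 - s ^ 2 := by linarith
      rw [h3] at hy
      nlinarith
    -- The left side is at most `5 s ≤ √s` because `s < 1 / 25`, and `exp (-shrinkRate ε) = s ^ (1 /
    -- 5000)` is larger.
    · have h2 : exp (-(-log s * 1)) = s := by rw [mul_one, neg_neg, exp_log hs0]
      rw [h2]
      have h3 : exp (log s / 2) ≤ exp (-shrinkRate ε) := by
        refine exp_le_exp.2 ?_
        unfold shrinkRate
        rw [← hs2, log_pow]
        push_cast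
        linarith
      have h4 : exp (log s / 2) * exp (log s / 2) = s := by
        rw [← exp_add, add_halves, exp_log hs0]
      have h5 : exp (log s / 2) ≤ 1 / 5 := by
        by_contra hc
        have := not_le.1 hc
        nlinarith
      have h6 := exp_pos (log s / 2)
      nlinarith

end Parameters

/-! ### The threshold-sampling procedure -/

section Procedure

variable {N : Type} [DecidableEq N]

/-- The function that takes the value `v i` at the `i`-th set of a list. -/
def lookup (l : List (Finset N)) (v : Fin l.length → ℝ) (T : Finset N) : ℝ :=
  if hT : l.idxOf T < l.length then v ⟨l.idxOf T, hT⟩ else 0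

/-- One round that asks for the values of the sets `S ∪ T` with `T` in a list. The result is
a function of `T`. -/
def queryAbove (S : Finset N) (l : List (Finset N)) : Alg N (Finset N → ℝ) :=
  Alg.ask (fun i : Fin l.length => S ∪ l.get i) fun v => Alg.ret (lookup l v)

/-- The sets whose values determine the marginal gains of the elements of `A` with respect
to `T`. -/
noncomputable def gainQueries (T A : Finset N) : List (Finset N) :=
  T :: A.toList.map fun x => insert x T

/-- The iterations of the threshold-sampling procedure: the current solution `T` is extended along a
random order of the candidates `A`, and the candidates of small marginal gain are removed. -/
noncomputable def sampleLoop (S : Finset N) (k : ℕ) (τ ε : ℝ) :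
    ℕ → Finset N → Finset N → Alg N (Finset N)
  | 0, T, _ => Alg.ret T
  | r + 1, T, A =>
    if A = ∅ ∨ k ≤ T.card then Alg.ret T else
      (Alg.draw (shuffle A.card A)).andThen fun l =>
      (queryAbove S (prefixChain T l)).andThen fun g =>
      (queryAbove S (gainQueries (extend g τ ε k 0 0 T l) A)).andThen fun g' =>
        sampleLoop S k τ ε r (extend g τ ε k 0 0 T l)
          (cand g' τ (extend g τ ε k 0 0 T l) A)

theorem lookup_of_mem {l : List (Finset N)} (v : Finset N → ℝ) {T : Finset N} (hT : T ∈ l) :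
    lookup l (fun i => v (l.get i)) T = v T := by
  have h : l.idxOf T < l.length := List.idxOf_lt_length_iff.2 hT
  simp [lookup, h]

theorem length_gainQueries (T A : Finset N) : (gainQueries T A).length = A.card + 1 := by
  simp [gainQueries]

theorem cand_congr {g h : Finset N → ℝ} {τ : ℝ} {T A : Finset N}
    (H : ∀ U ∈ gainQueries T A, g U = h U) : cand g τ T A = cand h τ T A := by
  have h1 : g T = h T := H T (by simp [gainQueries])
  ext x
  simp only [mem_cand]
  refine and_congr_right fun hx => ?_
  rw [h1, H (insert x T) (by simp only [gainQueries, List.mem_cons, List.mem_map, Finset.mem_toList]; exact Or.inr ⟨x, hx, rfl⟩)]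

variable {f : Finset N → ℝ}

theorem run_queryAbove (S : Finset N) (l : List (Finset N)) :
    (queryAbove S l).run f =
      PMF.pure ⟨lookup l fun i => f (S ∪ l.get i), 1, l.length⟩ := by
  simp [queryAbove, Alg.run_ask, Alg.run_ret, PMF.pure_map]

theorem ensures_queryAbove (S : Finset N) (l : List (Finset N)) :
    Alg.Ensures f (queryAbove S l) (fun g => ∀ U ∈ l, g U = f (S ∪ U)) 1 l.length := by
  intro o ho
  rw [run_queryAbove, PMF.mem_support_pure_iff] at ho
  subst ho
  exact ⟨fun U hU => lookup_of_mem (fun U => f (S ∪ U)) hU, by simp, by simp⟩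

theorem cost_queryAbove (S : Finset N) (l : List (Finset N)) :
    Alg.cost f (queryAbove S l) = l.length := by
  simp [Alg.cost, run_queryAbove, expect_pure]

/-- The first element of the order is always accepted and then has gain `0`. So every iteration
loses a candidate, which is the source of all bounds that hold surely and independently of `ε` and
`δ`. -/
theorem card_cand_extend_lt {h : Finset N → ℝ} {τ ε : ℝ} {k : ℕ} (hτ : 0 < τ) (hε : 0 ≤ ε) {T A : Finset N} {l : List N}
    (hA : cand h τ T A = A) (hT : T.card < k) (hl : l.length = A.card) (hlA : l.toFinset ⊆ A)
    (hne : A.Nonempty) : (cand h τ (extend h τ ε k 0 0 T l) A).card < A.card := by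
  cases l with
  | nil => have := hne.card_pos; simp at hl; omega
  | cons x l =>
    have hx : x ∈ A := hlA (by simp)
    have hgx : τ ≤ h (insert x T) - h T := (mem_cand.1 (hA.symm ▸ hx)).2
    rw [extend_zero_cons hε hT hgx]
    refine Finset.card_lt_card ⟨cand_subset _ _ _ _, fun hsub => ?_⟩
    refine notMem_of_mem_cand hτ (hsub hx) (subset_extend _ _ _ _ (Finset.mem_insert_self x T))

/-- An iteration uses two rounds and `2 (m + 1)` queries for `m` candidates, and `2 (m + 1) + 4 (m -
1)² ≤ 4 m²` for `m ≥ 1`. -/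
theorem ensures_sampleLoop (hs : Submodular f) (hm : Monotone f) {S B : Finset N} {k : ℕ}
    {τ ε : ℝ} (hτ : 0 < τ) (hε : 0 ≤ ε) (hε' : ε ≤ 1) (r : ℕ) {T A : Finset N}
    (hA : cand (fun U => f (S ∪ U)) τ T A = A) (hAB : A ⊆ B) (hTB : T ⊆ B) (hT : T.card ≤ k)
    (hv : f S + (1 - ε) * τ * T.card ≤ f (S ∪ T)) :
    Alg.Ensures f (sampleLoop S k τ ε r T A)
      (fun U => U ⊆ B ∧ U.card ≤ k ∧ f S + (1 - ε) * τ * U.card ≤ f (S ∪ U))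
      (2 * min r A.card : ℕ) (4 * A.card ^ 2) := by
  have hs' := hs.union_left hm S
  have hm' := monotone_union_left hm S
  induction r generalizing T A with
  | zero => exact Alg.ensures_ret ⟨hTB, hT, hv⟩ (by positivity) (by positivity)
  | succ r ih =>
    rw [sampleLoop]
    split
    · exact Alg.ensures_ret ⟨hTB, hT, hv⟩ (by positivity) (by positivity)
    next hcond =>
    push Not at hcond
    obtain ⟨hne, hk⟩ := hcond
    have hpos := hne.card_pos
    refine (Alg.ensures_andThen (Alg.ensures_draw (P := fun l => l.length = A.card ∧ l.toFinset ⊆ A)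
        fun l hl => mem_support_shuffle rfl hl)
      (r' := 1 + (1 + (2 * min r (A.card - 1) : ℕ)))
      (w' := (A.card + 1) + ((A.card + 1) + 4 * (A.card - 1 : ℕ) ^ 2)) fun l hl =>
      Alg.ensures_andThen ((ensures_queryAbove S (prefixChain T l)).mono (fun _ h => h) le_rfl
        (by rw [length_prefixChain, hl.1]; push_cast; rfl)) fun g hg =>
      Alg.ensures_andThen ((ensures_queryAbove S _).mono (fun _ h => h) le_rfl
        (by rw [length_gainQueries]; push_cast; rfl)) fun g' hg' => ?_).mono
      (fun _ h => h) ?_ ?_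
    · rw [cand_congr hg', extend_congr hg]
      set T' := extend (fun U => f (S ∪ U)) τ ε k 0 0 T l with hT'
      have hlt := card_cand_extend_lt (ε := ε) hτ hε hA hk hl.1 hl.2 hne
      rw [← hT'] at hlt
      refine (ih (T := T') (A := cand (fun U => f (S ∪ U)) τ T' A) (cand_cand hs' hm' subset_rfl A)
        ((cand_subset _ _ _ _).trans hAB) ?_ (card_extend_le _ _ _ _ hT) ?_).mono
        (fun _ h => h) ?_ ?_
      · exact (extend_subset _ _ _ _).trans (Finset.union_subset hTB (hl.2.trans hAB))
      · have := gain_extend (h := fun U => f (S ∪ U)) (ε := ε) (k := k) (i := 0) (y := 0)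
          (c := T.card) (l := l) (v := f (S ∪ T)) (T := T) hm' hτ hε' (by simp) (by simp) (by simp)
        rw [← hT'] at this
        linarith
      · gcongr
        omega
      · gcongr
        omega
    · have : 2 * min (r + 1) A.card = 1 + (1 + 2 * min r (A.card - 1)) := by omega
      rw [this]; push_cast; linarith
    · have h1 : (1 : ℝ) ≤ A.card := by exact_mod_cast hpos
      push_cast [hpos]
      nlinarith

theorem expect_pending_extend_le {h : Finset N → ℝ} (hs : Submodular h) (hm : Monotone h)
    {τ ε : ℝ} {k : ℕ} (hτ : 0 < τ) (hε : 0 < ε) (hε' : ε < 1) {T A : Finset N} (hT : T.card < k)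
    (hA : cand h τ T A = A) :
    expect (shuffle A.card A) (fun l => (pending h τ k A (extend h τ ε k 0 0 T l) : ℝ≥0∞)) ≤
      ENNReal.ofReal (Real.exp (-shrinkRate ε)) * A.card := by
  obtain ⟨γ, θ, a, b, h1, h2, h3, h4, h5, h6, h7⟩ := exists_parameters hε hε'
  refine (expect_pending_extend hs hm hτ hε.le h1 h2 h3 h4 h5 h6 hT hA).trans ?_
  rw [← ENNReal.ofReal_natCast, ← ENNReal.ofReal_mul (Real.exp_pos _).le]
  exact ENNReal.ofReal_le_ofReal (mul_le_mul_of_nonneg_right h7 (Nat.cast_nonneg _))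

/-- The potential `(40000 / ε) · pending` pays for the loop: an iteration costs at most `4 |A|`,
exactly the guaranteed expected decrease `(40000 / ε) (ε / 10000) |A|`. -/
theorem cost_sampleLoop_le (hs : Submodular f) (hm : Monotone f) {S B : Finset N} {k : ℕ}
    {τ ε : ℝ} (hτ : 0 < τ) (hε : 0 < ε) (hε' : ε < 1) (r : ℕ) {T : Finset N} :
    Alg.cost f (sampleLoop S k τ ε r T (cand (fun U => f (S ∪ U)) τ T B)) ≤
      ENNReal.ofReal (40000 / ε) * pending (fun U => f (S ∪ U)) τ k B T := by
  have hs' := hs.union_left hm S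
  have hm' := monotone_union_left hm S
  set h : Finset N → ℝ := fun U => f (S ∪ U) with hh
  induction r generalizing T with
  | zero => rw [sampleLoop, Alg.cost_ret]; exact zero_le
  | succ r ih =>
    rw [sampleLoop]
    split
    · rw [Alg.cost_ret]; exact zero_le
    next hcond =>
    push Not at hcond
    set A := cand h τ T B with hA
    obtain ⟨hne, hk⟩ := hcond
    have hAA : cand h τ T A = A := cand_cand hs' hm' subset_rfl B
    have hpend : pending h τ k B T = A.card := by rw [pending, if_neg (by omega)]
    have hpos : (1 : ℝ≥0∞) ≤ A.card := by exact_mod_cast hne.card_pos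
    rw [hpend, Alg.cost_andThen, Alg.cost_draw, zero_add, Alg.outE_draw]
    calc _ ≤ expect (shuffle A.card A) (fun l => 4 * (A.card : ℝ≥0∞) +
          ENNReal.ofReal (40000 / ε) * pending h τ k A (extend h τ ε k 0 0 T l)) := by
          refine expect_mono fun l hl => ?_
          obtain ⟨hl1, hl2⟩ := mem_support_shuffle rfl hl
          have hrest := Alg.cost_andThen_le (f := f) (ensures_queryAbove S (prefixChain T l))
            (c := A.card + 1) (d := (A.card + 1) + ENNReal.ofReal (40000 / ε) *
              pending h τ k A (extend h τ ε k 0 0 T l))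
            (by rw [cost_queryAbove, length_prefixChain, hl1]; push_cast; rfl)
            (h := fun g => (queryAbove S (gainQueries (extend g τ ε k 0 0 T l) A)).andThen fun g' =>
              sampleLoop S k τ ε r (extend g τ ε k 0 0 T l)
                (cand g' τ (extend g τ ε k 0 0 T l) A)) fun g hg => by
              rw [extend_congr hg]
              refine Alg.cost_andThen_le (ensures_queryAbove S _)
                (by rw [cost_queryAbove, length_gainQueries]; push_cast; rfl) fun g' hg' => ?_
              have hsub : T ⊆ extend h τ ε k 0 0 T l := subset_extend _ _ _ _
              rw [cand_congr hg', hA, cand_cand hs' hm' hsub]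
              refine (ih (T := extend h τ ε k 0 0 T l)).trans (le_of_eq ?_)
              rw [pending, pending, cand_cand hs' hm' hsub]
          refine hrest.trans ?_
          rw [← add_assoc]
          refine add_le_add ?_ le_rfl
          calc (A.card : ℝ≥0∞) + 1 + (A.card + 1) ≤ A.card + A.card + (A.card + A.card) := by gcongr
            _ = _ := by ring
      _ = 4 * (A.card : ℝ≥0∞) + ENNReal.ofReal (40000 / ε) *
          expect (shuffle A.card A) fun l => pending h τ k A (extend h τ ε k 0 0 T l) := by
          rw [expect_add, expect_const, expect_mul_left]
      _ ≤ 4 * (A.card : ℝ≥0∞) + ENNReal.ofReal (40000 / ε) *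
          (ENNReal.ofReal (Real.exp (-shrinkRate ε)) * A.card) := by
          gcongr
          exact expect_pending_extend_le hs' hm' hτ hε hε' hk hAA
      _ = ENNReal.ofReal (4 + 40000 / ε * Real.exp (-shrinkRate ε)) * A.card := by
          rw [ENNReal.ofReal_add (by norm_num) (by positivity), ENNReal.ofReal_mul (by positivity),
            add_mul, mul_assoc]
          norm_num
      _ ≤ ENNReal.ofReal (40000 / ε) * A.card := by
          gcongr
          have h1 := mul_le_mul_of_nonneg_left (exp_neg_shrinkRate_le hε')
            (show 0 ≤ 40000 / ε by positivity)
          have h2 : 40000 / ε * (1 - ε / 10000) = 40000 / ε - 4 := by field_simp; ring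
          linarith

/-- `U` has the maximal size `k`, or no element of `A` has a marginal gain of at least `τ` with
respect to `S ∪ U`. -/
def Saturated (f : Finset N → ℝ) (A S : Finset N) (k : ℕ) (τ : ℝ) (U : Finset N) : Prop :=
  U.card = k ∨ ∀ x ∈ A, f (insert x (S ∪ U)) - f (S ∪ U) < τ

/-- Markov's inequality: a final set that is not saturated leaves at least one pending element, so
the failure probability is at most the expected number of pending elements. -/
theorem fail_sampleLoop_le (hs : Submodular f) (hm : Monotone f) {S B : Finset N} {k : ℕ}
    {τ ε : ℝ} (hτ : 0 < τ) (hε : 0 < ε) (hε' : ε < 1) (r : ℕ) {T : Finset N} (hT : T.card ≤ k) :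
    Alg.failure f (sampleLoop S k τ ε r T (cand (fun U => f (S ∪ U)) τ T B))
      (Saturated f B S k τ) ≤
      ENNReal.ofReal (Real.exp (-shrinkRate ε)) ^ r *
        pending (fun U => f (S ∪ U)) τ k B T := by
  have hs' := hs.union_left hm S
  have hm' := monotone_union_left hm S
  set h : Finset N → ℝ := fun U => f (S ∪ U) with hh
  have hfin : ∀ U : Finset N, U.card ≤ k → (cand h τ U B = ∅ ∨ k ≤ U.card) →
      Saturated f B S k τ U := by
    intro U hU hor
    rcases hor with h1 | h1
    · right
      intro x hx
      by_contra hc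
      have : x ∈ cand h τ U B := mem_cand.2 ⟨hx, by simpa [hh] using not_lt.1 hc⟩
      rw [h1] at this
      simp at this
    · left; omega
  induction r generalizing T with
  | zero =>
    rw [sampleLoop, pow_zero, one_mul]
    by_cases hc : Saturated f B S k τ T
    · rw [Alg.failure_ret_of_pos hc]; exact zero_le
    · refine (Alg.failure_ret_le _ _).trans ?_
      have h1 : ¬ k ≤ T.card := fun h => hc (hfin T hT (Or.inr h))
      have h2 : cand h τ T B ≠ ∅ := fun h => hc (hfin T hT (Or.inl h))
      rw [pending, if_neg h1]
      exact_mod_cast (Finset.nonempty_iff_ne_empty.2 h2).card_pos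
  | succ r ih =>
    rw [sampleLoop]
    split
    · next hcond =>
      rw [Alg.failure_ret_of_pos (hfin T hT hcond)]
      exact zero_le
    next hcond =>
    push Not at hcond
    set A := cand h τ T B with hA
    obtain ⟨hne, hk⟩ := hcond
    have hAA : cand h τ T A = A := cand_cand hs' hm' subset_rfl B
    have hpend : pending h τ k B T = A.card := by rw [pending, if_neg (by omega)]
    rw [hpend, Alg.failure_andThen, Alg.outE_draw]
    calc _ ≤ expect (shuffle A.card A) (fun l => ENNReal.ofReal (Real.exp (-shrinkRate ε)) ^ r *
          pending h τ k A (extend h τ ε k 0 0 T l)) := by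
          refine expect_mono fun l hl => ?_
          rw [Alg.failure_andThen]
          refine Alg.outE_le_of_ensures (ensures_queryAbove S _) fun g hg => ?_
          rw [extend_congr hg, Alg.failure_andThen]
          refine Alg.outE_le_of_ensures (ensures_queryAbove S _) fun g' hg' => ?_
          have hsub : T ⊆ extend h τ ε k 0 0 T l := subset_extend _ _ _ _
          rw [cand_congr hg', hA, cand_cand hs' hm' hsub]
          refine (ih (card_extend_le _ _ _ _ hT)).trans (le_of_eq ?_)
          rw [pending, pending, cand_cand hs' hm' hsub]
      _ ≤ ENNReal.ofReal (Real.exp (-shrinkRate ε)) ^ r *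
          (ENNReal.ofReal (Real.exp (-shrinkRate ε)) * A.card) := by
          rw [expect_mul_left]
          gcongr
          exact expect_pending_extend_le hs' hm' hτ hε hε' hk hAA
      _ = _ := by rw [pow_succ, mul_assoc]

variable [Fintype N]

variable (N) in
/-- The number of iterations of the threshold-sampling procedure. -/
noncomputable def iterations (ε δ : ℝ) : ℕ :=
  ⌈Real.log (Fintype.card N / δ) / shrinkRate ε⌉₊

/-- A threshold-sampling procedure. -/
noncomputable def thresholdSampling : ThresholdProc N := fun A S k τ ε δ =>
  open Classical in
  -- The guard makes the sure bounds valid for arbitrary parameters, and an empty `A`, for which the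
  -- budget `C |A| / ε` is zero, costs no query.
  if A.Nonempty ∧ 0 < τ ∧ 0 < ε ∧ ε < 1 ∧ 0 < δ ∧ δ < 1 then
    (queryAbove S (gainQueries ∅ A)).andThen fun g =>
      sampleLoop S k τ ε (iterations N ε δ) ∅ (cand g τ ∅ A)
  else Alg.ret ∅

end Procedure

/-! ### The number of iterations -/

section Iterations

variable {N : Type} [Fintype N]

theorem iterations_le {ε δ : ℝ} (h2 : 2 ≤ Fintype.card N) (hε : 0 < ε) (hε' : ε < 1) (hδ : 0 < δ)
    (hδ' : δ < 1) :
    (iterations N ε δ : ℝ) ≤ Real.log (Fintype.card N / δ) / shrinkRate ε + 1 ∧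
      1 / 2 ≤ Real.log (Fintype.card N / δ) := by
  have hn : (2 : ℝ) ≤ Fintype.card N := by exact_mod_cast h2
  have hlog : 1 / 2 ≤ Real.log (Fintype.card N / δ) := by
    have h3 : (2 : ℝ) ≤ Fintype.card N / δ := by
      rw [le_div_iff₀ hδ]; nlinarith
    have := Real.log_le_log (by norm_num) h3
    have := Real.log_two_gt_d9
    linarith
  refine ⟨(Nat.ceil_lt_add_one ?_).le, hlog⟩
  exact div_nonneg (by linarith) (shrinkRate_pos hε hε').le

/-- The additive `3` from rounding and the first round is absorbed by `log (n / δ) / ε ≥ 1 / 2`. -/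
theorem iterations_le_div {ε δ : ℝ} (h2 : 2 ≤ Fintype.card N) (hε : 0 < ε) (hε' : ε < 1)
    (hδ : 0 < δ) (hδ' : δ < 1) :
    (1 + 2 * iterations N ε δ : ℝ) ≤ 20006 * Real.log (Fintype.card N / δ) / ε := by
  obtain ⟨h, hlog⟩ := iterations_le h2 hε hε' hδ hδ'
  set x := Real.log (Fintype.card N / δ)
  have h3 : x / shrinkRate ε ≤ x / (ε / 10000) := by
    gcongr
    exact le_shrinkRate hε'
  have h4 : x / (ε / 10000) = 10000 * (x / ε) := by field_simp
  have h5 : 1 / 2 ≤ x / ε := by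
    rw [le_div_iff₀ hε]; nlinarith
  calc _ ≤ 1 + 2 * (10000 * (x / ε) + 1) := by linarith
    _ ≤ 20006 * (x / ε) := by linarith
    _ = _ := by ring

end Iterations

/-! ### Guarantees of the threshold-sampling procedure -/

section ProcedureGuarantees

variable {N : Type} [DecidableEq N] [Fintype N] {f : Finset N → ℝ}

/-- Disjointness from `S` holds because elements of `S` have gain `0` and never become candidates;
the greedy analysis needs it to add cardinalities. -/
theorem ensures_thresholdSampling (hs : Submodular f) (hm : Monotone f) (A S : Finset N) (k : ℕ)
    (τ ε δ : ℝ) :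
    Alg.Ensures f (thresholdSampling A S k τ ε δ)
      (fun T => T ⊆ A ∧ T.card ≤ k ∧ Disjoint S T ∧ (1 - ε) * τ * T.card ≤ f (S ∪ T) - f S)
      (1 + 2 * min (iterations N ε δ) A.card : ℕ) (4 * A.card ^ 2 + A.card + 1) := by
  unfold thresholdSampling
  split
  · next hc =>
    obtain ⟨-, hτ, hε, hε', -, -⟩ := hc
    have hs' := hs.union_left hm S
    have hm' := monotone_union_left hm S
    refine (Alg.ensures_andThen ((ensures_queryAbove S (gainQueries ∅ A)).mono (fun _ h => h)
      le_rfl (by rw [length_gainQueries])) (w' := 4 * A.card ^ 2)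
      (r' := (2 * min (iterations N ε δ) A.card : ℕ)) fun g hg => ?_).mono
      (fun _ h => h) (by push_cast; rfl) (by push_cast; linarith)
    rw [cand_congr hg]
    have hcard := Finset.card_le_card (cand_subset (fun U => f (S ∪ U)) τ ∅ A)
    refine (ensures_sampleLoop hs hm hτ hε.le hε'.le _ (cand_cand hs' hm' subset_rfl A)
      subset_rfl (Finset.empty_subset _) (by simp) (by simp)).mono ?_ ?_ ?_
    · rintro T ⟨h1, h2, h3⟩
      refine ⟨h1.trans (cand_subset _ _ _ _), h2, ?_, by linarith⟩
      rw [Finset.disjoint_right]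
      intro x hxT hxS
      have := (mem_cand.1 (h1 hxT)).2
      have hins : S ∪ insert x ∅ = S := by
        ext z; simp; rintro rfl; exact hxS
      rw [hins, Finset.union_empty, sub_self] at this
      linarith
    · gcongr
    · gcongr
  · exact Alg.ensures_ret (by simp) (by positivity) (by positivity)

theorem cost_thresholdSampling_le (hs : Submodular f) (hm : Monotone f) (A S : Finset N) (k : ℕ)
    (τ ε δ : ℝ) :
    Alg.cost f (thresholdSampling A S k τ ε δ) ≤ ENNReal.ofReal (40002 / ε) * A.card := by
  unfold thresholdSampling
  split
  · next hc =>
    obtain ⟨hA, hτ, hε, hε', -, -⟩ := hc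
    have hs' := hs.union_left hm S
    have hm' := monotone_union_left hm S
    have hpos : (1 : ℝ≥0∞) ≤ A.card := by exact_mod_cast hA.card_pos
    refine (Alg.cost_andThen_le (ensures_queryAbove S (gainQueries ∅ A)) (c := A.card + 1)
      (d := ENNReal.ofReal (40000 / ε) * A.card)
      (by rw [cost_queryAbove, length_gainQueries]; push_cast; rfl) fun g hg => ?_).trans ?_
    · rw [cand_congr hg]
      refine (cost_sampleLoop_le hs hm hτ hε hε' _).trans ?_
      gcongr
      exact pending_le _ _ _ _ _
    · calc (A.card : ℝ≥0∞) + 1 + ENNReal.ofReal (40000 / ε) * A.card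
          ≤ A.card + A.card + ENNReal.ofReal (40000 / ε) * A.card := by gcongr
        _ = ENNReal.ofReal (2 + 40000 / ε) * A.card := by
            rw [ENNReal.ofReal_add (by norm_num) (by positivity)]
            norm_num
            ring
        _ ≤ _ := by
            gcongr
            have : 2 ≤ 2 / ε := by rw [le_div_iff₀ hε]; linarith
            calc 2 + 40000 / ε ≤ 2 / ε + 40000 / ε := by linarith
              _ = _ := by ring
  · rw [Alg.cost_ret]; exact zero_le

/-- The number `r` of iterations is chosen such that `exp (-r · shrinkRate ε) ≤ δ / n`, while at
most `n` elements are pending at the start. -/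
theorem fail_thresholdSampling_le [Nonempty N] (hs : Submodular f) (hm : Monotone f)
    (A S : Finset N) (k : ℕ) {τ ε δ : ℝ} (hτ : 0 < τ) (hε : 0 < ε) (hε' : ε < 1) (hδ : 0 < δ)
    (hδ' : δ < 1) :
    Alg.failure f (thresholdSampling A S k τ ε δ) (Saturated f A S k τ) ≤ ENNReal.ofReal δ := by
  unfold thresholdSampling
  split
  · next hc =>
    rw [Alg.failure_andThen]
    refine Alg.outE_le_of_ensures (ensures_queryAbove S _) fun g hg => ?_
    rw [cand_congr hg]
    refine (fail_sampleLoop_le hs hm hτ hε hε' _ (T := ∅) (by simp)).trans ?_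
    set r := iterations N ε δ with hr
    have hn : (0 : ℝ) < Fintype.card N := by exact_mod_cast Fintype.card_pos
    have hρ := shrinkRate_pos hε hε'
    have h1 : Real.log (Fintype.card N / δ) ≤ r * shrinkRate ε := by
      rw [← div_le_iff₀ hρ]
      exact Nat.le_ceil _
    have h2 : Real.exp (-shrinkRate ε) ^ r ≤ δ / Fintype.card N := by
      rw [← Real.exp_nat_mul, ← Real.exp_log (div_pos hδ hn), Real.exp_le_exp,
        ← inv_div, Real.log_inv]
      linarith
    calc _ ≤ ENNReal.ofReal (Real.exp (-shrinkRate ε)) ^ r * Fintype.card N := by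
          gcongr
          exact (pending_le _ _ _ _ _).trans (Finset.card_le_univ A)
      _ = ENNReal.ofReal (Real.exp (-shrinkRate ε) ^ r * Fintype.card N) := by
          rw [ENNReal.ofReal_mul (by positivity), ENNReal.ofReal_pow (Real.exp_pos _).le,
            ENNReal.ofReal_natCast]
      _ ≤ ENNReal.ofReal δ := by
          refine ENNReal.ofReal_le_ofReal ?_
          rwa [le_div_iff₀ hn] at h2
  · next hc =>
    have hA : A = ∅ := by
      by_contra h
      exact hc ⟨Finset.nonempty_iff_ne_empty.2 h, hτ, hε, hε', hδ, hδ'⟩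
    rw [Alg.failure_ret_of_pos (show Saturated f A S k τ ∅ from Or.inr (by simp [hA]))]
    exact zero_le

theorem isThresholdSampling {C : ℝ} (hC : 40002 ≤ C) (h2 : 2 ≤ Fintype.card N) :
    IsThresholdSampling C (thresholdSampling (N := N)) := by
  have : Nonempty N := Fintype.card_pos_iff.1 (by omega)
  intro f hm hs _ A S k τ ε δ hτ hε hε' hδ hδ'
  have hens := ensures_thresholdSampling hs hm A S k τ ε δ
  refine ⟨fun o ho => ?_, ?_, ?_, ?_⟩
  · obtain ⟨⟨h1, h3, -, -⟩, h4, -⟩ := hens o ho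
    refine ⟨h1, h3, h4.trans ?_⟩
    have h5 := iterations_le_div h2 hε hε' hδ hδ'
    have hlog := (iterations_le h2 hε hε' hδ hδ').2
    calc ((1 + 2 * min (iterations N ε δ) A.card : ℕ) : ℝ)
        ≤ ((1 + 2 * iterations N ε δ : ℕ) : ℝ) := by gcongr; omega
      _ ≤ 20006 * Real.log (Fintype.card N / δ) / ε := by push_cast; exact h5
      _ ≤ _ := by gcongr; linarith
  · refine (cost_thresholdSampling_le hs hm A S k τ ε δ).trans ?_
    rw [← ENNReal.ofReal_natCast, ← ENNReal.ofReal_mul (by positivity)]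
    refine ENNReal.ofReal_le_ofReal ?_
    rw [div_mul_eq_mul_div]
    gcongr
  · classical
    -- The average gain bound holds for every nonempty outcome, so the integrands can be compared
    -- pointwise.
    rw [prob_eq_expect, ← expect_mul_left]
    refine expect_mono fun o ho => ?_
    obtain ⟨⟨-, -, -, h4⟩, -⟩ := hens o ho
    by_cases hne : o.output.Nonempty
    · simp only [Set.mem_ofPred_eq, hne, if_true, mul_one]
      refine ENNReal.ofReal_le_ofReal ?_
      rwa [le_div_iff₀ (by exact_mod_cast hne.card_pos)]
    · simp [hne]
  · classical
    obtain ⟨G, hG⟩ : ∃ G : Set (Outcome (Finset N)), G = {o | o.output.card = k ∨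
      ∀ x ∈ A, f (insert x (S ∪ o.output)) - f (S ∪ o.output) < τ} := ⟨_, rfl⟩
    have hfail := fail_thresholdSampling_le hs hm A S k hτ hε hε' hδ hδ'
    have := mul_le_expect_of_prob (μ := (thresholdSampling A S k τ ε δ).run f) (c := 1)
      (s := Gᶜ) (g := fun o => if o ∈ G then 1 else 0) (δ := ENNReal.ofReal δ)
      (le_trans (le_of_eq ?_) hfail) ?_
    · rw [← hG, prob_eq_expect, ENNReal.ofReal_sub _ hδ.le, ENNReal.ofReal_one]
      simpa using this
    · unfold Alg.failure Alg.outE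
      congr 1
      funext o
      subst hG
      simp only [Set.mem_compl_iff, Set.mem_ofPred_eq, Saturated]
      split_ifs <;> simp_all
    · intro o _ ho
      rw [if_pos (not_not.1 ho)]

end ProcedureGuarantees

/-! ### The optimum -/

section Opt

variable {N : Type} {f : Finset N → ℝ} {k : ℕ}

theorem le_opt [Fintype N] {S : Finset N} (hS : S.card ≤ k) : f S ≤ opt f k :=
  Finset.le_sup' f (by simpa using hS)

theorem exists_eq_opt [Fintype N] (f : Finset N → ℝ) (k : ℕ) : ∃ O : Finset N, O.card ≤ k ∧ f O = opt f k := by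
  obtain ⟨O, hO, h⟩ := Finset.exists_mem_eq_sup'
    (s := Finset.univ.filter fun S : Finset N => S.card ≤ k) ⟨∅, by simp⟩ f
  exact ⟨O, by simpa using hO, h.symm⟩

theorem opt_nonneg [Fintype N] (hf : ∀ S, 0 ≤ f S) : 0 ≤ opt f k :=
  (hf ∅).trans (le_opt (by simp))

/-- Saturation becomes an upper bound for the optimum: filling `S` up with `O` costs at most `k`
gains of size `τ`. -/
theorem sub_le_of_gain_le [DecidableEq N] (hs : Submodular f) (hm : Monotone f) {S O : Finset N} {τ : ℝ}
    (hτ : 0 ≤ τ) (hO : O.card ≤ k) (hgain : ∀ x ∈ O, f (insert x S) - f S ≤ τ) :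
    f O - f S ≤ k * τ := by
  have h1 := hm (Finset.subset_union_right (s₁ := S) (s₂ := O))
  have h2 := hs.union_sub_le_sum hm S O
  have h3 := Finset.sum_le_card_nsmul O (fun x => f (insert x S) - f S) τ hgain
  rw [nsmul_eq_mul] at h3
  have h4 : (O.card : ℝ) * τ ≤ k * τ := by gcongr
  linarith

end Opt

/-! ### The greedy blocks -/

section Greedy

open Real

/-- The left side is `exp (2 e - e²) / exp 1 ≤ (1 + 2.7 e) / exp 1`, and `2.7 ≤ exp 1`. -/
theorem exp_neg_sq_le {e : ℝ} (h0 : 0 ≤ e) (h1 : e ≤ 0.16) :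
    exp (-(1 - e) ^ 2) ≤ 1 / exp 1 + e := by
  have h2 : exp (2 * e - e ^ 2) ≤ 1 / (1 - (2 * e - e ^ 2)) :=
    exp_bound_div_one_sub_of_interval (by nlinarith) (by nlinarith)
  have h3 : 1 / (1 - (2 * e - e ^ 2)) ≤ 1 + 2.7 * e := by
    rw [div_le_iff₀ (by nlinarith)]
    nlinarith [mul_nonneg h0 (show (0 : ℝ) ≤ 0.7 - 4.4 * e + 2.7 * e ^ 2 by nlinarith)]
  have h4 : exp (-(1 - e) ^ 2) = (1 / exp 1) * exp (2 * e - e ^ 2) := by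
    rw [one_div, ← exp_neg, ← exp_add]; congr 1; ring
  have h5 : 1 / exp 1 * 2.7 ≤ 1 := by
    rw [one_div, inv_mul_le_iff₀ (exp_pos _)]
    have := exp_one_gt_d9
    linarith
  have h6 := mul_le_mul_of_nonneg_left (h2.trans h3) (show 0 ≤ 1 / exp 1 by positivity)
  rw [h4]
  nlinarith

variable {N : Type} [DecidableEq N] {f : Finset N → ℝ} {k : ℕ}

/-- Each element of `T` brings on average `(1 - e) t ≥ (1 - e)² (V - f S) / k`. So `T` multiplies a
positive deficit by at most `1 - (1 - e)² |T| / k`, which is below the corresponding exponential. -/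
theorem potential_union (hm : Monotone f) (hk : 1 ≤ k)
    {e t V : ℝ} (he1 : e < 1) (hV : 0 ≤ V) {S T : Finset N} (hdis : Disjoint S T)
    (hgain : (1 - e) * t * T.card ≤ f (S ∪ T) - f S) (h1 : (1 - e) * (V - f S) ≤ k * t)
    (h2 : V - f S ≤ exp (-((1 - e) ^ 2 * (S.card / k))) * V) :
    V - f (S ∪ T) ≤ exp (-((1 - e) ^ 2 * ((S ∪ T).card / k))) * V := by
  have hk' : (0 : ℝ) < k := by exact_mod_cast hk
  have hmono := hm (Finset.subset_union_left (s₁ := S) (s₂ := T))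
  rcases le_or_gt (V - f S) 0 with hd | hd
  · have : 0 ≤ exp (-((1 - e) ^ 2 * ((S ∪ T).card / k))) * V := by positivity
    linarith
  have hT : (0 : ℝ) ≤ T.card := Nat.cast_nonneg _
  have h3 : (1 - e) ^ 2 * (T.card / k) * (V - f S) ≤ f (S ∪ T) - f S := by
    refine le_trans ?_ hgain
    have : (1 - e) * (V - f S) / k ≤ t := by rw [div_le_iff₀ hk']; linarith
    calc (1 - e) ^ 2 * (T.card / k) * (V - f S) =
          (1 - e) * T.card * ((1 - e) * (V - f S) / k) := by ring
      _ ≤ (1 - e) * T.card * t := by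
          refine mul_le_mul_of_nonneg_left this (mul_nonneg (by linarith) hT)
      _ = _ := by ring
  have h4 := add_one_le_exp (-((1 - e) ^ 2 * (T.card / k)))
  have hcard : ((S ∪ T).card : ℝ) = S.card + T.card := by
    rw [Finset.card_union_of_disjoint hdis]; push_cast; rfl
  calc V - f (S ∪ T) ≤ (-((1 - e) ^ 2 * (T.card / k)) + 1) * (V - f S) := by linarith
    _ ≤ exp (-((1 - e) ^ 2 * (T.card / k))) * (V - f S) :=
        mul_le_mul_of_nonneg_right h4 hd.le
    _ ≤ exp (-((1 - e) ^ 2 * (T.card / k))) *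
          (exp (-((1 - e) ^ 2 * (S.card / k))) * V) :=
        mul_le_mul_of_nonneg_left h2 (exp_pos _).le
    _ = _ := by
        rw [← mul_assoc, ← exp_add, hcard]; congr 2; ring

variable [Fintype N]

theorem greedyBlock_nil (TS : ThresholdProc N) (k : ℕ) (e δ τ : ℝ) (S : Finset N) :
    greedyBlock TS k e δ τ [] S = Alg.ret S := rfl

theorem greedyBlock_cons (TS : ThresholdProc N) (k : ℕ) (e δ τ : ℝ) (j : ℕ) (js : List ℕ)
    (S : Finset N) :
    greedyBlock TS k e δ τ (j :: js) S =
      (TS Finset.univ S (k - S.card) ((1 - e) ^ j * τ) e δ).andThen fun T =>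
        if (S ∪ T).card = k then Alg.ret (S ∪ T) else greedyBlock TS k e δ τ js (S ∪ T) := by
  rw [greedyBlock]
  show Alg.andThen _ _ = _
  congr 1

variable (N) in
/-- A bound for the number of rounds of the threshold-sampling procedure. -/
noncomputable def roundBound (e δ : ℝ) : ℕ := 1 + 2 * min (iterations N e δ) (Fintype.card N)

variable (N) in
/-- A bound for the number of queries of the threshold-sampling procedure. -/
def queryBound : ℕ := 4 * Fintype.card N ^ 2 + Fintype.card N + 1

theorem ensures_thresholdSampling_card (hs : Submodular f) (hm : Monotone f) (A S : Finset N)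
    (k : ℕ) (τ e δ : ℝ) :
    Alg.Ensures f (thresholdSampling A S k τ e δ)
      (fun T => T ⊆ A ∧ T.card ≤ k ∧ Disjoint S T ∧ (1 - e) * τ * T.card ≤ f (S ∪ T) - f S)
      (roundBound N e δ) (queryBound N) := by
  have hcard : A.card ≤ Fintype.card N := Finset.card_le_univ A
  refine (ensures_thresholdSampling hs hm A S k τ e δ).mono (fun _ h => h) ?_ ?_
  · unfold roundBound
    gcongr
  · unfold queryBound
    push_cast
    gcongr

theorem ensures_greedyBlock (hs : Submodular f) (hm : Monotone f) (e δ τ : ℝ) (js : List ℕ)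
    {S : Finset N} (hS : S.card ≤ k) :
    Alg.Ensures f (greedyBlock thresholdSampling k e δ τ js S) (fun O => O.card ≤ k)
      (js.length * roundBound N e δ) (js.length * queryBound N) := by
  induction js generalizing S with
  | nil => exact Alg.ensures_ret hS (by simp) (by simp)
  | cons j js ih =>
    rw [greedyBlock_cons]
    refine (Alg.ensures_andThen (r' := js.length * roundBound N e δ)
      (w' := js.length * queryBound N)
      (ensures_thresholdSampling_card hs hm _ S (k - S.card) _ e δ) fun T hT => ?_).mono
      (fun _ h => h) (by simp only [List.length_cons]; push_cast; linarith)
      (by simp only [List.length_cons]; push_cast; linarith)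
    have hcard : (S ∪ T).card ≤ k := by
      have := Finset.card_union_le S T
      have := hT.2.1
      omega
    split_ifs
    · exact Alg.ensures_ret hcard (by positivity) (by positivity)
    · exact ih hcard

theorem cost_greedyBlock_le (hs : Submodular f) (hm : Monotone f) (e δ τ : ℝ) (js : List ℕ)
    {S : Finset N} :
    Alg.cost f (greedyBlock thresholdSampling k e δ τ js S) ≤
      js.length * (ENNReal.ofReal (40002 / e) * Fintype.card N) := by
  induction js generalizing S with
  | nil => rw [greedyBlock_nil, Alg.cost_ret]; exact zero_le
  | cons j js ih =>
    rw [greedyBlock_cons]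
    refine (Alg.cost_andThen_le (ensures_thresholdSampling hs hm _ S (k - S.card) _ e δ)
      (cost_thresholdSampling_le hs hm _ S (k - S.card) _ e δ)
      (d := js.length * (ENNReal.ofReal (40002 / e) * Fintype.card N)) fun T hT => ?_).trans
      (le_of_eq ?_)
    · split_ifs
      · rw [Alg.cost_ret]; exact zero_le
      · exact ih
    · rw [Finset.card_univ, List.length_cons]; push_cast; ring

/-- Two invariants are carried along: the threshold is not much below the average deficit `(OPT - f
S) / k`, which saturation restores after each call, and the deficit decays exponentially in `|S|`.
`hend` says that the threshold after all calls is low enough for the first invariant alone to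
suffice. -/
theorem fail_greedyBlock_le [Nonempty N] (hs : Submodular f) (hm : Monotone f)
    (hf : ∀ S, 0 ≤ f S) (hk : 1 ≤ k) {e δ τ : ℝ} (he : 0 < e) (he1 : e ≤ 0.16) (hδ : 0 < δ)
    (hδ' : δ < 1) (hτ : 0 < τ) (len : ℕ) {j : ℕ} {S : Finset N} (hS : S.card ≤ k)
    (hend : k * ((1 - e) ^ (j + len) * τ) ≤ (1 - e) * (opt f k / 4))
    (h1 : (1 - e) * (opt f k - f S) ≤ k * ((1 - e) ^ j * τ))
    (h2 : opt f k - f S ≤ exp (-((1 - e) ^ 2 * (S.card / k))) * opt f k) :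
    Alg.failure f (greedyBlock thresholdSampling k e δ τ (List.range' j len) S)
      (fun O => (1 - 1 / exp 1 - e) * opt f k ≤ f O) ≤
      len * ENNReal.ofReal δ := by
  have hV : 0 ≤ opt f k := opt_nonneg hf
  have hk' : (0 : ℝ) < k := by exact_mod_cast hk
  induction len generalizing j S with
  | zero =>
    rw [List.range'_zero, greedyBlock_nil, Alg.failure_ret_of_pos]
    · exact zero_le
    · rw [add_zero] at hend
      have h3 : opt f k - f S ≤ opt f k / 4 := by
        have := h1.trans hend
        exact le_of_mul_le_mul_left this (by linarith)
      -- All thresholds are used up without reaching size `k`: the deficit is at most a quarter of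
      -- the optimum, better than `1 / e`.
      have h4 : 1 / 4 ≤ 1 / exp 1 := by
        rw [div_le_div_iff₀ (by norm_num) (exp_pos _)]
        have := exp_one_lt_d9
        linarith
      nlinarith [mul_le_mul_of_nonneg_right (show 1 - 1 / exp 1 - e ≤ 3 / 4 by linarith) hV]
  | succ len ih =>
    rw [List.range'_succ, greedyBlock_cons]
    have hpow : 0 < (1 - e) ^ j := pow_pos (by linarith) j
    refine (Alg.failure_andThen_le (ensures_thresholdSampling hs hm _ S (k - S.card) _ e δ)
      (fail_thresholdSampling_le hs hm Finset.univ S (k - S.card) (mul_pos hpow hτ) he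
        (by linarith) hδ hδ') (d := len * ENNReal.ofReal δ) fun T hT hsat => ?_).trans
      (le_of_eq (by push_cast; ring))
    obtain ⟨-, hTk, hdis, hgain⟩ := hT
    have hpot := potential_union hm hk (by linarith) hV hdis hgain h1 h2
    have hcard : (S ∪ T).card = S.card + T.card := Finset.card_union_of_disjoint hdis
    split_ifs with hc
    · rw [Alg.failure_ret_of_pos]
      · exact zero_le
      · rw [hc, div_self hk'.ne', mul_one] at hpot
        have h3 := mul_le_mul_of_nonneg_right (exp_neg_sq_le he.le he1) hV
        linarith
    · refine ih (by omega) ?_ ?_ hpot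
      · rw [show j + 1 + len = j + (len + 1) by ring]; exact hend
      · rcases hsat with h3 | h3
        · omega
        · obtain ⟨O, hO, hfO⟩ := exists_eq_opt f k
          have := sub_le_of_gain_le hs hm (S := S ∪ T) (mul_pos hpow hτ).le hO
            fun x _ => (h3 x (Finset.mem_univ x)).le
          rw [hfO] at this
          calc (1 - e) * (opt f k - f (S ∪ T)) ≤ (1 - e) * (k * ((1 - e) ^ j * τ)) :=
                mul_le_mul_of_nonneg_left this (by linarith)
            _ = _ := by ring

end Greedy

/-! ### Exhaustive maximization -/

section Exhaustive

open Real

variable {N : Type} {f : Finset N → ℝ}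

theorem foldl_better (l : List (Finset N)) (s : Finset N) :
    ∃ t, (l.zip (l.map f)).foldl better (s, f s) = (t, f t) ∧ (t = s ∨ t ∈ l) ∧ f s ≤ f t ∧
      ∀ u ∈ l, f u ≤ f t := by
  induction l generalizing s with
  | nil => exact ⟨s, rfl, Or.inl rfl, le_rfl, by simp⟩
  | cons u l ih =>
    simp only [List.map_cons, List.zip_cons_cons, List.foldl_cons]
    by_cases hlt : f s < f u
    · obtain ⟨t, h1, h2, h3, h4⟩ := ih u
      refine ⟨t, by simpa [better, hlt] using h1, ?_, hlt.le.trans h3, ?_⟩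
      · rcases h2 with h2 | h2 <;> simp [h2]
      · intro v hv
        rcases List.mem_cons.1 hv with rfl | hv
        · exact h3
        · exact h4 v hv
    · obtain ⟨t, h1, h2, h3, h4⟩ := ih s
      refine ⟨t, by simpa [better, hlt] using h1, ?_, h3, ?_⟩
      · rcases h2 with h2 | h2 <;> simp [h2]
      · intro v hv
        rcases List.mem_cons.1 hv with rfl | hv
        · exact (not_lt.1 hlt).trans h3
        · exact h4 v hv

theorem _root_.List.Forall₂.exists_of_mem_right {α β : Type*} {P : α → β → Prop} {l : List α}
    {l' : List β} (h : List.Forall₂ P l l') {b : β} (hb : b ∈ l') : ∃ a ∈ l, P a b := by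
  induction h with
  | nil => simp at hb
  | cons hab _ ih =>
    rcases List.mem_cons.1 hb with rfl | hb
    · exact ⟨_, by simp, hab⟩
    · obtain ⟨a, ha, hP⟩ := ih hb
      exact ⟨a, by simp [ha], hP⟩

theorem _root_.List.Forall₂.exists_of_mem_left {α β : Type*} {P : α → β → Prop} {l : List α}
    {l' : List β} (h : List.Forall₂ P l l') {a : α} (ha : a ∈ l) : ∃ b ∈ l', P a b := by
  induction h with
  | nil => simp at ha
  | cons hab _ ih =>
    rcases List.mem_cons.1 ha with rfl | ha
    · exact ⟨_, by simp, hab⟩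
    · obtain ⟨b, hb, hP⟩ := ih ha
      exact ⟨b, by simp [hb], hP⟩

variable [Fintype N] [DecidableEq N] {k : ℕ}

/-- The number of greedy blocks (less one). -/
noncomputable def blockCount (e R : ℝ) : ℕ := ⌈2 * log R / e⌉₊

/-- The number of thresholds in a greedy block (less one). -/
noncomputable def blockLength (e : ℝ) : ℕ := ⌈log 4 / e⌉₊

/-- The failure probability of one threshold-sampling call in the greedy blocks. -/
noncomputable def blockFailure (e δ R : ℝ) : ℝ := δ / ((blockCount e R + 1) * (blockLength e + 1))

theorem exhaustiveMaximization_eq (TS : ThresholdProc N) (k : ℕ) (e δ L R : ℝ) :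
    exhaustiveMaximization TS k e δ L R =
      (Alg.parList ((List.range (blockCount e R + 1)).map fun i =>
        greedyBlock TS k e (blockFailure e δ R) ((1 + e) ^ i * L / k)
          (List.range (blockLength e + 1)) ∅)).andThen fun sets =>
      (Alg.askAll (∅ :: sets)).andThen fun vals =>
        Alg.ret (((∅ :: sets).zip vals).foldl better (∅, vals.headD 0)).1 := rfl

theorem ensures_exhaustiveMaximization (hs : Submodular f) (hm : Monotone f) (e δ L R : ℝ) :
    Alg.Ensures f (exhaustiveMaximization thresholdSampling k e δ L R) (fun O => O.card ≤ k)
      ((blockLength e + 1) * roundBound N e (blockFailure e δ R) + 1)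
      ((blockCount e R + 1) * ((blockLength e + 1) * queryBound N) + (blockCount e R + 2)) := by
  rw [exhaustiveMaximization_eq]
  refine (Alg.ensures_andThen (Alg.ensures_parList
    (r := (blockLength e + 1) * roundBound N e (blockFailure e δ R))
    (w := (blockLength e + 1) * queryBound N) (P := fun _ O => O.card ≤ k)
    (by positivity) _ fun i _ => (ensures_greedyBlock hs hm _ _ _ _ (by simp)).mono
      (fun _ h => h) (by simp) (by simp)) (r' := 1) (w' := blockCount e R + 2)
      fun sets hsets => ?_).mono (fun _ h => h) le_rfl (by simp)
  have hlen := hsets.length_eq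
  rw [List.length_range] at hlen
  refine (Alg.ensures_andThen (Alg.ensures_askAll _) (r' := 0) (w' := 0) fun vals hvals => ?_).mono
    (fun _ h => h) (by simp) (by simp [← hlen]; norm_num [add_assoc])
  refine Alg.ensures_ret ?_ le_rfl le_rfl
  subst hvals
  obtain ⟨t, h1, h2, -, -⟩ := foldl_better (f := f) (∅ :: sets) ∅
  have hhead : ((∅ :: sets).map f).headD 0 = f ∅ := rfl
  rw [hhead, h1]
  rcases h2 with rfl | h2
  · simp
  · rcases List.mem_cons.1 h2 with rfl | h2
    · simp
    · obtain ⟨_, _, h⟩ := hsets.exists_of_mem_right h2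
      exact h

theorem cost_exhaustiveMaximization_le (hs : Submodular f) (hm : Monotone f) (e δ L R : ℝ) :
    Alg.cost f (exhaustiveMaximization thresholdSampling k e δ L R) ≤
      (blockCount e R + 1) * ((blockLength e + 1) *
        (ENNReal.ofReal (40002 / e) * Fintype.card N)) + (blockCount e R + 2) := by
  rw [exhaustiveMaximization_eq]
  refine Alg.cost_andThen_le (Alg.ensures_parList
    (r := (blockLength e + 1) * roundBound N e (blockFailure e δ R))
    (w := (blockLength e + 1) * queryBound N) (P := fun _ O => O.card ≤ k)
    (by positivity) _ fun i _ => (ensures_greedyBlock hs hm _ _ _ _ (by simp)).mono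
      (fun _ h => h) (by simp) (by simp))
    ((Alg.cost_parList_le _ fun i _ => cost_greedyBlock_le hs hm _ _ _ _).trans (by simp))
    fun sets hsets => ?_
  have hlen := hsets.length_eq
  rw [List.length_range] at hlen
  rw [Alg.cost_andThen, Alg.cost_askAll]
  simp only [Alg.cost_ret, Alg.outE_const, List.length_cons, ← hlen]
  push_cast
  rw [add_zero, add_assoc]
  norm_num

/-- The factor `2` in the number of blocks is due to `exp (e / 2) ≤ 1 + e`. -/
theorem le_pow_blockCount {e R : ℝ} (he : 0 < e) (he1 : e ≤ 1) (hR : 1 ≤ R) :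
    R ≤ (1 + e) ^ blockCount e R := by
  have h1 : exp (e / 2) ≤ 1 + e := by
    refine (exp_bound_div_one_sub_of_interval (by linarith) (by linarith)).trans ?_
    rw [div_le_iff₀ (by linarith)]
    nlinarith
  have h2 : 2 * log R / e ≤ blockCount e R := Nat.le_ceil _
  rw [div_le_iff₀ he] at h2
  calc R = exp (log R) := (exp_log (by linarith)).symm
    _ ≤ exp (blockCount e R * (e / 2)) := exp_le_exp.2 (by linarith)
    _ = exp (e / 2) ^ blockCount e R := exp_nat_mul _ _
    _ ≤ _ := by gcongr

theorem pow_blockLength_le {e : ℝ} (he : 0 < e) (he1 : e < 1) :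
    (1 - e) ^ blockLength e ≤ 1 / 4 := by
  have h2 : log 4 / e ≤ blockLength e := Nat.le_ceil _
  rw [div_le_iff₀ he] at h2
  calc (1 - e) ^ blockLength e ≤ exp (-e) ^ blockLength e := by
        have := add_one_le_exp (-e)
        exact pow_le_pow_left₀ (by linarith) (by linarith) _
    _ = exp (blockLength e * -e) := (exp_nat_mul _ _).symm
    _ ≤ exp (-log 4) := exp_le_exp.2 (by linarith)
    _ = 1 / 4 := by rw [exp_neg, exp_log (by norm_num)]; norm_num

/-- Take the largest grid point below `V`. Either the next one exceeds `V`, and `(1 - e) (1 + e) ≤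
1`, or it is the last one, which is already at least `R L ≥ V`. -/
theorem exists_threshold {e L R V : ℝ} (he : 0 < e) (he1 : e < 1) (hL : 0 < L) (hLV : L ≤ V)
    (hVR : V ≤ R * L) :
    ∃ i ≤ blockCount e R, (1 + e) ^ i * L ≤ V ∧ (1 - e) * V ≤ (1 + e) ^ i * L := by
  set r := blockCount e R
  set i := Nat.findGreatest (fun i => (1 + e) ^ i * L ≤ V) r with hi
  have hP : (1 + e) ^ i * L ≤ V :=
    Nat.findGreatest_spec (P := fun i => (1 + e) ^ i * L ≤ V) (Nat.zero_le r) (by simpa using hLV)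
  refine ⟨i, Nat.findGreatest_le r, hP, ?_⟩
  have hi0 : 0 ≤ (1 + e) ^ i * L := by positivity
  have hV : 0 < V := hL.trans_le hLV
  rcases (Nat.findGreatest_le (P := fun i => (1 + e) ^ i * L ≤ V) r).lt_or_eq with hlt | heq
  · have := Nat.findGreatest_is_greatest (P := fun i => (1 + e) ^ i * L ≤ V)
      (Nat.lt_succ_self i) hlt
    rw [not_le, pow_succ] at this
    calc (1 - e) * V ≤ (1 - e) * ((1 + e) ^ i * (1 + e) * L) :=
          mul_le_mul_of_nonneg_left this.le (by linarith)
      _ = (1 - e ^ 2) * ((1 + e) ^ i * L) := by ring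
      _ ≤ 1 * ((1 + e) ^ i * L) := mul_le_mul_of_nonneg_right (by nlinarith) hi0
      _ = _ := one_mul _
  · have hR : 1 ≤ R := by
      by_contra h
      nlinarith
    rw [← hi] at heq
    have h1 := mul_le_mul_of_nonneg_right (le_pow_blockCount he he1.le hR) hL.le
    rw [heq]
    nlinarith

theorem blockFailure_pos {e δ R : ℝ} (hδ : 0 < δ) : 0 < blockFailure e δ R := by
  unfold blockFailure; positivity

theorem blockFailure_le {e δ R : ℝ} (hδ : 0 < δ) : blockFailure e δ R ≤ δ := by
  unfold blockFailure
  refine div_le_self hδ.le ?_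
  have h1 : (0 : ℝ) ≤ blockCount e R := Nat.cast_nonneg _
  have h2 : (0 : ℝ) ≤ blockLength e := Nat.cast_nonneg _
  nlinarith [mul_nonneg h1 h2]

theorem fail_exhaustiveMaximization_le [Nonempty N] (hs : Submodular f) (hm : Monotone f)
    (hf : ∀ S, 0 ≤ f S) (hk : 1 ≤ k) {e δ L R : ℝ} (he : 0 < e) (he1 : e ≤ 0.16) (hδ : 0 < δ)
    (hδ' : δ < 1) (hL : 0 < L) (hLV : L ≤ opt f k) (hVR : opt f k ≤ R * L) :
    Alg.failure f (exhaustiveMaximization thresholdSampling k e δ L R)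
      (fun O => (1 - 1 / exp 1 - e) * opt f k ≤ f O) ≤ ENNReal.ofReal δ := by
  obtain ⟨i₀, hi₀, hi1, hi2⟩ := exists_threshold he (by linarith) hL hLV hVR
  have hk' : (0 : ℝ) < k := by exact_mod_cast hk
  have hV : 0 ≤ opt f k := opt_nonneg hf
  rw [exhaustiveMaximization_eq]
  set r := blockCount e R with hr
  set m := blockLength e with hm'
  set δ' := blockFailure e δ R with hδ''
  -- Only the block `i₀` has to succeed; for the others the property is vacuous, which lets the
  -- union bound for parallel families apply uniformly.
  have hstep : ∀ i ∈ List.range (r + 1), Alg.failure f (greedyBlock thresholdSampling k e δ'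
      ((1 + e) ^ i * L / k) (List.range (m + 1)) ∅)
      (fun O => i = i₀ → (1 - 1 / exp 1 - e) * opt f k ≤ f O) ≤
      ((m + 1 : ℕ) : ℝ≥0∞) * ENNReal.ofReal δ' := by
    intro i _
    by_cases hi : i = i₀
    · subst hi
      have hτk : (k : ℝ) * ((1 + e) ^ i * L / k) = (1 + e) ^ i * L := by field_simp
      simp only [forall_const]
      rw [List.range_eq_range']
      refine fail_greedyBlock_le hs hm hf hk he he1 (blockFailure_pos hδ)
        ((blockFailure_le hδ).trans_lt hδ') (by positivity) (m + 1) (by simp) ?_ ?_ ?_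
      · rw [zero_add, pow_succ]
        calc (k : ℝ) * ((1 - e) ^ m * (1 - e) * ((1 + e) ^ i * L / k))
            = (1 - e) * ((1 - e) ^ m * (k * ((1 + e) ^ i * L / k))) := by ring
          _ ≤ (1 - e) * (1 / 4 * opt f k) := by
              rw [hτk]
              have h1 := pow_blockLength_le he (show e < 1 by linarith)
              have h2 : 0 ≤ (1 + e) ^ i * L := by positivity
              refine mul_le_mul_of_nonneg_left ?_ (by linarith)
              exact mul_le_mul h1 hi1 h2 (by norm_num)
          _ = _ := by ring
      · rw [pow_zero, one_mul, hτk]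
        have := mul_nonneg (show 0 ≤ 1 - e by linarith) (hf ∅)
        linarith
      · simpa using hf ∅
    · rw [Alg.failure_eq_zero _ fun O h => absurd h hi]
      exact zero_le
  refine (Alg.failure_andThen_le (Alg.ensures_parList
    (r := (blockLength e + 1) * roundBound N e (blockFailure e δ R))
    (w := (blockLength e + 1) * queryBound N) (P := fun _ O => O.card ≤ k)
    (by positivity) _ fun i _ => (ensures_greedyBlock hs hm _ _ _ _ (by simp)).mono
      (fun _ h => h) (by simp [hm', hδ'']) (by simp [hm']))
    (Alg.failure_parList_le _ hstep) (d := 0) fun sets _ hsets => ?_).trans ?_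
  · rw [Alg.failure_andThen, Alg.outE_askAll]
    obtain ⟨t, h1, -, -, h4⟩ := foldl_better (f := f) (∅ :: sets) ∅
    have hhead : ((∅ :: sets).map f).headD 0 = f ∅ := rfl
    rw [hhead, h1]
    obtain ⟨O, hO, hgood⟩ := hsets.exists_of_mem_left (List.mem_range.2 (Nat.lt_succ_of_le hi₀))
    exact (Alg.failure_ret_of_pos (P := fun O => _ ≤ f O)
      ((hgood rfl).trans (h4 O (by simp [hO])))).le
  · rw [add_zero, List.length_range, ← mul_assoc, ← Nat.cast_mul, ← ENNReal.ofReal_natCast,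
      ← ENNReal.ofReal_mul (by positivity)]
    refine ENNReal.ofReal_le_ofReal (le_of_eq ?_)
    rw [hδ'', blockFailure, ← hr, ← hm']
    push_cast
    field_simp

end Exhaustive

/-! ### Random subsets -/

section Subsample

variable {N : Type} [Fintype N]

/-- Independence of the inclusions, as the expansion of a product of sums over subsets. It serves
both for inclusion probabilities and for the moment generating function. -/
theorem expect_subsample_prod [DecidableEq N] (q : NNReal) (hq : q ≤ 1) (w v : N → ℝ≥0∞) :
    expect (subsample N q) (fun A => (∏ i ∈ A, w i) * ∏ i ∈ Finset.univ \ A, v i) =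
      ∏ i, ((q : ℝ≥0∞) * w i + ((1 - q : NNReal) : ℝ≥0∞) * v i) := by
  rw [Finset.prod_add, expect, tsum_fintype, Finset.powerset_univ]
  refine Finset.sum_congr rfl fun A _ => ?_
  rw [Finset.prod_mul_distrib, Finset.prod_mul_distrib, Finset.prod_const, Finset.prod_const,
    Finset.card_sdiff_of_subset (Finset.subset_univ A), Finset.card_univ]
  simp only [subsample, PMF.ofFintype_apply, min_eq_left hq]
  ring

theorem expect_subsample_card_le (q : NNReal) (hq : q ≤ 1) :
    expect (subsample N q) (fun A => (A.card : ℝ≥0∞)) ≤ Fintype.card N * q := by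
  classical
  have h1 : ∀ x : N, expect (subsample N q) (fun A => if x ∈ A then 1 else 0) ≤ q := by
    intro x
    -- With the weight `0` for omitting `x`, the product is the indicator of `x ∈ A`.
    have h := expect_subsample_prod q hq (fun _ => 1) (fun i : N => if i = x then 0 else 1)
    rw [Finset.prod_eq_single x] at h
    · rw [if_pos rfl, mul_zero, add_zero, mul_one] at h
      rw [← h]
      refine expect_mono fun A _ => ?_
      rw [Finset.prod_const_one, one_mul]
      split_ifs with hx
      · rw [Finset.prod_eq_one]
        intro i hi
        rw [if_neg]
        rintro rfl
        exact (Finset.mem_sdiff.1 hi).2 hx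
      · exact zero_le
    · intro i _ hi
      rw [if_neg hi, mul_one, mul_one, ← ENNReal.coe_add, add_tsub_cancel_of_le hq]
      rfl
    · simp
  calc _ = expect (subsample N q) (fun A => ∑ x : N, if x ∈ A then (1 : ℝ≥0∞) else 0) := by
        congr 1; funext A; simp
    _ = ∑ x : N, expect (subsample N q) (fun A => if x ∈ A then 1 else 0) := by
        rw [expect_finsetSum]
    _ ≤ ∑ _x : N, (q : ℝ≥0∞) := Finset.sum_le_sum fun x _ => h1 x
    _ = _ := by simp

open Real in
/-- Lower tail of a weighted count of the elements of a random subset. -/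
theorem subsample_tail [DecidableEq N] (q : NNReal) (hq : q ≤ 1) (a : N → ℝ) {D : ℝ} (hD : 0 < D)
    (ha : ∀ i, 0 ≤ a i) (haD : ∀ i, a i ≤ D) :
    expect (subsample N q)
        (fun A => open Classical in if q * (∑ i, a i) / 4 ≤ ∑ i ∈ A, a i then 0 else 1) ≤
      ENNReal.ofReal (exp (-(q * (∑ i, a i) / (4 * D)))) := by
  classical
  -- Moment generating function of one element at `-1 / D`, where `exp (-z) ≤ 1 - z / 2` on `[0,
  -- 1]`. The exponent `1 / 2` minus the tail level `1 / 4` leaves the `1 / 4` of the conclusion.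
  have hterm : ∀ i, (q : ℝ≥0∞) * ENNReal.ofReal (exp (-(a i / D))) +
      ((1 - q : NNReal) : ℝ≥0∞) * 1 ≤ ENNReal.ofReal (exp (-(q * a i / (2 * D)))) := by
    intro i
    have hz0 : 0 ≤ a i / D := div_nonneg (ha i) hD.le
    have hz1 : a i / D ≤ 1 := (div_le_one hD).2 (haD i)
    have hq0 : (0 : ℝ) ≤ q := q.2
    have hq1 : (q : ℝ) ≤ 1 := hq
    have h1 : exp (-(a i / D)) ≤ 1 - a i / D / 2 := by
      rw [exp_neg, inv_le_comm₀ (exp_pos _) (by linarith)]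
      refine le_trans ?_ (add_one_le_exp _)
      rw [inv_le_comm₀ (by linarith) (by linarith), inv_eq_one_div, div_le_iff₀ (by linarith)]
      nlinarith
    rw [mul_one, ← ENNReal.ofReal_coe_nnreal, ← ENNReal.ofReal_coe_nnreal,
      ← ENNReal.ofReal_mul hq0, ← ENNReal.ofReal_add (by positivity) (NNReal.coe_nonneg (1 - q)),
      NNReal.coe_sub hq]
    refine ENNReal.ofReal_le_ofReal ?_
    have h2 := mul_le_mul_of_nonneg_left h1 hq0
    have h3 := add_one_le_exp (-(q * a i / (2 * D)))
    have h4 : (q : ℝ) * (1 - a i / D / 2) = q - q * a i / (2 * D) := by field_simp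
    push_cast
    linarith
  have hprod := expect_subsample_prod q hq (fun i => ENNReal.ofReal (exp (-(a i / D)))) fun _ => 1
  calc _ ≤ expect (subsample N q) (fun A => ENNReal.ofReal (exp (q * (∑ i, a i) / (4 * D))) *
        ((∏ i ∈ A, ENNReal.ofReal (exp (-(a i / D)))) * ∏ i ∈ Finset.univ \ A, 1)) := by
        refine expect_mono fun A _ => ?_
        split_ifs with h
        · exact zero_le
        · rw [Finset.prod_const_one, mul_one,
            ← ENNReal.ofReal_prod_of_nonneg fun i _ => (exp_pos _).le, ← exp_sum,
            ← ENNReal.ofReal_mul (exp_pos _).le, ← exp_add, ENNReal.one_le_ofReal]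
          refine one_le_exp ?_
          rw [Finset.sum_neg_distrib, ← Finset.sum_div, ← sub_eq_add_neg, sub_nonneg]
          rw [div_le_div_iff₀ hD (by positivity)]
          nlinarith [not_le.1 h]
    _ = ENNReal.ofReal (exp (q * (∑ i, a i) / (4 * D))) *
        ∏ i, ((q : ℝ≥0∞) * ENNReal.ofReal (exp (-(a i / D))) + ((1 - q : NNReal) : ℝ≥0∞) * 1) := by
        rw [expect_mul_left, hprod]
    _ ≤ ENNReal.ofReal (exp (q * (∑ i, a i) / (4 * D))) *
        ∏ i, ENNReal.ofReal (exp (-(q * a i / (2 * D)))) := by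
        gcongr with i
        exact hterm i
    _ = _ := by
        rw [← ENNReal.ofReal_prod_of_nonneg fun i _ => (exp_pos _).le, ← exp_sum,
          ← ENNReal.ofReal_mul (exp_pos _).le, ← exp_add]
        congr 2
        rw [Finset.sum_neg_distrib, ← Finset.sum_div, ← Finset.mul_sum]
        field_simp
        ring

end Subsample

section SubsampleOpt

variable {N : Type} [DecidableEq N] {f : Finset N → ℝ}

/-- A submodular function is bounded from below on the subsets of `O` by a modular one with the
same values at `∅` and at `O`. -/
theorem Submodular.exists_modular_le (hs : Submodular f) (hm : Monotone f) (O : Finset N) :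
    ∃ a : N → ℝ, (∀ i, 0 ≤ a i) ∧ (∀ i, a i ≠ 0 → i ∈ O ∧ a i ≤ f {i} - f ∅) ∧
      (∀ A ⊆ O, f ∅ + ∑ i ∈ A, a i ≤ f A) ∧ f ∅ + ∑ i ∈ O, a i = f O := by
  induction O using Finset.induction_on with
  | empty =>
    refine ⟨fun _ => 0, by simp, by simp, fun A hA => ?_, by simp⟩
    rw [Finset.subset_empty.1 hA]; simp
  | insert x O hx ih =>
    obtain ⟨a, h1, h2, h3, h4⟩ := ih
    have hax : ∀ A : Finset N, x ∉ A →
        ∑ i ∈ A, Function.update a x (f (insert x O) - f O) i = ∑ i ∈ A, a i := by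
      intro A hA
      refine Finset.sum_congr rfl fun i hi => ?_
      rw [Function.update_of_ne]
      rintro rfl
      exact hA hi
    -- The weight of an element is its marginal gain over the elements inserted before it; over a
    -- subset of those the gain can only be larger.
    refine ⟨Function.update a x (f (insert x O) - f O), fun i => ?_, fun i hi => ?_,
      fun A hA => ?_, ?_⟩
    · by_cases hi : i = x
      · subst hi
        simpa using hm (Finset.subset_insert i O)
      · simpa [hi] using h1 i
    · by_cases hix : i = x
      · subst hix
        rw [Function.update_self]
        exact ⟨Finset.mem_insert_self _ _, hs.gain_antitone hm (Finset.empty_subset O) i⟩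
      · rw [Function.update_of_ne hix] at hi ⊢
        exact ⟨Finset.mem_insert_of_mem (h2 i hi).1, (h2 i hi).2⟩
    · by_cases hxA : x ∈ A
      · have hsub : A.erase x ⊆ O := by
          intro z hz
          rw [Finset.mem_erase] at hz
          exact (Finset.mem_insert.1 (hA hz.2)).resolve_left hz.1
        have h5 := h3 _ hsub
        have h6 := hs.gain_antitone hm hsub x
        rw [← Finset.insert_erase hxA, Finset.sum_insert (Finset.notMem_erase x A),
          hax _ (Finset.notMem_erase x A), Function.update_self]
        linarith
      · rw [hax A hxA]
        exact h3 A fun z hz => (Finset.mem_insert.1 (hA hz)).resolve_left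
          fun h => hxA (h ▸ hz)
    · rw [Finset.sum_insert hx, hax O hx, Function.update_self]
      linarith

variable [Fintype N]

-- The tail bound is applied to the modular minorant of `f` on `O`. The constant `f ∅` is present in
-- every subset, so it need not be sampled.
open Real in
theorem subsample_opt_tail (hs : Submodular f) (hm : Monotone f) (hf : ∀ S, 0 ≤ f S)
    (q : NNReal) (hq : q ≤ 1) (O : Finset N) {D : ℝ} (hD : 0 < D)
    (hDx : ∀ x, f {x} ≤ D) :
    expect (subsample N q)
        (fun A => open Classical in if q * f O / 4 ≤ f (O ∩ A) then 0 else 1) ≤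
      ENNReal.ofReal (exp (-(q * (f O - f ∅) / (4 * D)))) := by
  classical
  obtain ⟨a, h1, h2, h3, h4⟩ := hs.exists_modular_le hm O
  have hsum : ∑ i, a i = f O - f ∅ := by
    rw [← h4, add_sub_cancel_left]
    refine (Finset.sum_subset (Finset.subset_univ O) fun i _ hi => ?_).symm
    by_contra h
    exact hi (h2 i h).1
  have haD : ∀ i, a i ≤ D := by
    intro i
    by_cases h : a i = 0
    · rw [h]; exact hD.le
    · have := (h2 i h).2
      have := hDx i
      have := hf ∅
      linarith
  rw [← hsum]
  refine le_trans (expect_mono fun A _ => ?_) (subsample_tail q hq a hD h1 haD)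
  have hq1 : (q : ℝ) ≤ 1 := hq
  have hA : ∑ i ∈ A, a i = ∑ i ∈ O ∩ A, a i := by
    refine (Finset.sum_subset Finset.inter_subset_right fun i hiA hi => ?_).symm
    by_contra h
    exact hi (Finset.mem_inter.2 ⟨(h2 i h).1, hiA⟩)
  by_cases h : q * (∑ i, a i) / 4 ≤ ∑ i ∈ A, a i
  · have h5 := h3 (O ∩ A) Finset.inter_subset_left
    have h6 : (q : ℝ) * f ∅ ≤ f ∅ := mul_le_of_le_one_left (hf ∅) hq1
    have h7 := hf ∅
    have : q * f O / 4 ≤ f (O ∩ A) := by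
      rw [hA] at h
      have : (q : ℝ) * f O = q * (∑ i, a i) + q * f ∅ := by rw [hsum]; ring
      linarith
    simp [this]
  · rw [if_neg h]
    split_ifs <;> simp

end SubsampleOpt

/-! ### The maximum of the singletons -/

section MaxSingleton

variable {N : Type} [Fintype N] {f : Finset N → ℝ}

theorem foldr_max_spec (l : List ℝ) :
    0 ≤ l.foldr max 0 ∧ (∀ x ∈ l, x ≤ l.foldr max 0) ∧ (l.foldr max 0 = 0 ∨ l.foldr max 0 ∈ l) := by
  induction l with
  | nil => simp
  | cons a l ih =>
    obtain ⟨h1, h2, h3⟩ := ih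
    simp only [List.foldr_cons]
    refine ⟨h1.trans (le_max_right _ _), ?_, ?_⟩
    · intro x hx
      rcases List.mem_cons.1 hx with rfl | hx
      · exact le_max_left _ _
      · exact (h2 x hx).trans (le_max_right _ _)
    · rcases max_choice a (l.foldr max 0) with h | h <;> rw [h]
      · right; simp
      · rcases h3 with h3 | h3
        · left; exact h3
        · right; simp [h3]

variable (f) in
/-- The maximal value of a singleton (or `0`). -/
noncomputable def singletonMax : ℝ :=
  (((Finset.univ : Finset N).toList.map fun x => ({x} : Finset N)).map f).foldr max 0

theorem le_singletonMax (x : N) : f {x} ≤ singletonMax f :=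
  (foldr_max_spec _).2.1 _ (by simp)

theorem singletonMax_nonneg : 0 ≤ singletonMax f := (foldr_max_spec _).1

theorem singletonMax_le_opt {k : ℕ} (hk : 1 ≤ k) (hf : ∀ S, 0 ≤ f S) :
    singletonMax f ≤ opt f k := by
  rcases (foldr_max_spec (((Finset.univ : Finset N).toList.map
    fun x => ({x} : Finset N)).map f)).2.2 with h | h
  · exact h.trans_le (opt_nonneg hf)
  · simp only [List.map_map, List.mem_map] at h
    obtain ⟨x, -, hx⟩ := h
    unfold singletonMax
    simp only [List.map_map]
    rw [← hx]
    exact le_opt (by simpa using hk)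

theorem opt_le_card_mul_singletonMax [DecidableEq N] [Nonempty N] {k : ℕ} (hk : 1 ≤ k)
    (hs : Submodular f)
    (hm : Monotone f) (hf : ∀ S, 0 ≤ f S) : opt f k ≤ k * singletonMax f := by
  obtain ⟨O, hO, hfO⟩ := exists_eq_opt f k
  rw [← hfO]
  obtain ⟨x₀⟩ := ‹Nonempty N›
  rcases O.eq_empty_or_nonempty with rfl | ⟨x, hx⟩
  -- An empty optimal set is compared with an arbitrary singleton, using `k ≥ 1`.
  · have h1 := hm (Finset.empty_subset {x₀})
    have h2 := le_singletonMax (f := f) x₀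
    have h3 : (1 : ℝ) ≤ k := by exact_mod_cast hk
    nlinarith [singletonMax_nonneg (f := f)]
  · have h1 := hs.union_sub_le_sum hm {x} (O.erase x)
    have h2 : {x} ∪ O.erase x = O := by
      ext z; by_cases hz : z = x <;> simp [hz, hx]
    rw [h2] at h1
    have h3 := Finset.sum_le_card_nsmul (O.erase x) (fun z => f (insert z {x}) - f {x})
      (singletonMax f) fun z _ => by
        have h4 := hs.gain_antitone hm (Finset.empty_subset {x}) z
        have h5 := le_singletonMax (f := f) z
        have h6 := hf ∅
        simp only [insert_empty_eq] at h4
        linarith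
    rw [nsmul_eq_mul, Finset.card_erase_of_mem hx] at h3
    have h4 := le_singletonMax (f := f) x
    have hpos : 1 ≤ O.card := Finset.card_pos.2 ⟨x, hx⟩
    push_cast [hpos] at h3
    have h5 : (O.card : ℝ) * singletonMax f ≤ k * singletonMax f :=
      mul_le_mul_of_nonneg_right (by exact_mod_cast hO) singletonMax_nonneg
    linarith

theorem maxSingleton_eq : maxSingleton N =
    (Alg.askAll ((Finset.univ : Finset N).toList.map fun x => {x})).andThen fun vals =>
      Alg.ret (vals.foldr max 0) := rfl

theorem ensures_maxSingleton :
    Alg.Ensures f (maxSingleton N) (fun D => D = singletonMax f) 1 (Fintype.card N) := by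
  rw [maxSingleton_eq]
  refine (Alg.ensures_andThen (Alg.ensures_askAll _) (r' := 0) (w' := 0) fun vals hvals =>
    Alg.ensures_ret (by rw [hvals]; rfl) le_rfl le_rfl).mono (fun _ h => h) (by simp) ?_
  simp

end MaxSingleton

/-! ### One ratio reduction -/

section ReduceRatio

theorem _root_.List.takeWhile_length_spec {α : Type*} (p : α → Bool) (l : List α) :
    (∀ i (h : i < l.length), i < (l.takeWhile p).length → p l[i] = true) ∧
      ∀ h : (l.takeWhile p).length < l.length, p l[(l.takeWhile p).length] = false := by
  induction l with
  | nil => simp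
  | cons a l ih =>
    by_cases ha : p a = true
    · rw [List.takeWhile_cons_of_pos ha]
      refine ⟨fun i h hi => ?_, fun h => ?_⟩
      · cases i with
        | zero => simpa using ha
        | succ i => simpa using ih.1 i (by simpa using h) (by simpa using hi)
      · simpa using ih.2 (by simpa using h)
    · rw [List.takeWhile_cons_of_neg ha]
      refine ⟨fun i h hi => by simp at hi, fun h => by simpa using ha⟩

variable {N : Type} [Fintype N] {f : Finset N → ℝ} {k : ℕ}

/-- The number of thresholds (less one) in a ratio reduction. -/
noncomputable def topIndex (R : ℝ) : ℕ := ⌈Real.log R / Real.log 2⌉₊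

/-- The failure probability of one threshold-sampling call in a ratio reduction. -/
noncomputable def callFailure (δ R : ℝ) : ℝ := stageFailure δ R / (topIndex R + 1)

/-- The index of the first value that is below its threshold. -/
noncomputable def firstBelow (p L : ℝ) (vals : List ℝ) : ℕ :=
  (vals.zipIdx.takeWhile fun v => open Classical in decide (p * (2 ^ v.2 * L) ≤ v.1)).length

/-- The new lower end of the feasible interval. -/
noncomputable def newLower (D p L : ℝ) (j : ℕ) : ℝ :=
  if j = 0 then (D + L) / 2 else (D + p * (2 ^ (j - 1) * L)) / 2

theorem reduceRatio_eq (TS : ThresholdProc N) (k : ℕ) (δ D R L : ℝ) :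
    reduceRatio TS k δ D R L =
      (Alg.draw (subsample N (Real.toNNReal (1 / Real.log R ^ 2)))).andThen fun N' =>
      (Alg.parList ((List.range (topIndex R + 1)).map fun i =>
        TS N' ∅ k (2 ^ i * L / k) (1 - 1 / Real.log R) (callFailure δ R))).andThen fun sets =>
      (Alg.askAll sets).andThen fun vals =>
        Alg.ret (newLower D (1 / Real.log R) L (firstBelow (1 / Real.log R) L vals)) := rfl

theorem firstBelow_spec (p L : ℝ) (vals : List ℝ) :
    firstBelow p L vals ≤ vals.length ∧
    (∀ i (h : i < vals.length), i < firstBelow p L vals → p * (2 ^ i * L) ≤ vals[i]) ∧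
      ∀ h : firstBelow p L vals < vals.length,
        vals[firstBelow p L vals] < p * (2 ^ firstBelow p L vals * L) := by
  classical
  have h := List.takeWhile_length_spec
    (fun v : ℝ × ℕ => decide (p * (2 ^ v.2 * L) ≤ v.1)) vals.zipIdx
  have hj : firstBelow p L vals =
      (vals.zipIdx.takeWhile fun v => decide (p * (2 ^ v.2 * L) ≤ v.1)).length := by
    unfold firstBelow; congr!
  rw [← hj] at h
  refine ⟨?_, fun i hi hij => ?_, fun hlt => ?_⟩
  · rw [hj]
    exact (List.takeWhile_prefix _).length_le.trans (by simp)
  · have h1 := h.1 i (by simpa using hi) hij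
    rw [List.getElem_zipIdx] at h1
    simpa using h1
  · have h2 := h.2 (by simpa using hlt)
    rw [List.getElem_zipIdx] at h2
    simpa using h2

/-- What is known about the sets that are computed for the thresholds of a ratio reduction. -/
def CallResult (f : Finset N → ℝ) (N' : Finset N) (k : ℕ) (p L : ℝ) (i : ℕ) (T : Finset N) :
    Prop :=
  T ⊆ N' ∧ T.card ≤ k ∧ p * (2 ^ i * L / k) * T.card ≤ f T

/-- The new lower end is at least half of the maximal value of a singleton, and it is a lower bound
for the optimum. -/
theorem newLower_bounds {p D L : ℝ} (hp : 0 ≤ p) (hL : 0 ≤ L) (hD : D ≤ opt f k)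
    (hLV : L ≤ opt f k) {N' : Finset N} {t : ℕ} {sets : List (Finset N)}
    (h : List.Forall₂ (CallResult f N' k p L) (List.range (t + 1)) sets) :
    D / 2 ≤ newLower D p L (firstBelow p L (sets.map f)) ∧
      newLower D p L (firstBelow p L (sets.map f)) ≤ opt f k := by
  obtain ⟨h1, h2, -⟩ := firstBelow_spec p L (sets.map f)
  set j := firstBelow p L (sets.map f)
  unfold newLower
  split_ifs with hj
  · constructor <;> linarith
  · have hlt : j - 1 < (sets.map f).length := by omega
    have h3 := h2 (j - 1) hlt (by omega)
    have hmem : (sets.map f)[j - 1] ∈ sets.map f := List.getElem_mem hlt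
    obtain ⟨T, hT, hfT⟩ := List.mem_map.1 hmem
    obtain ⟨_, _, hT'⟩ := h.exists_of_mem_right hT
    have h4 : f T ≤ opt f k := le_opt hT'.2.1
    have h5 : 0 ≤ p * (2 ^ (j - 1) * L) := by positivity
    constructor <;> linarith

variable [DecidableEq N]

theorem ensures_calls (hs : Submodular f) (hm : Monotone f) (hf : ∀ S, 0 ≤ f S) (δ R L : ℝ)
    (N' : Finset N) :
    Alg.Ensures f (Alg.parList ((List.range (topIndex R + 1)).map fun i =>
        thresholdSampling N' ∅ k (2 ^ i * L / k) (1 - 1 / Real.log R) (callFailure δ R)))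
      (List.Forall₂ (CallResult f N' k (1 / Real.log R) L) (List.range (topIndex R + 1)))
      (roundBound N (1 - 1 / Real.log R) (callFailure δ R))
      ((topIndex R + 1) * queryBound N) := by
  refine (Alg.ensures_parList (by positivity) _ fun i _ =>
    (ensures_thresholdSampling_card hs hm N' ∅ k _ _ _).mono (fun T hT => ?_) le_rfl le_rfl).mono
    (fun _ h => h) le_rfl (by simp)
  obtain ⟨h1, h2, -, h4⟩ := hT
  refine ⟨h1, h2, ?_⟩
  rw [Finset.empty_union, sub_sub_cancel] at h4
  have := hf ∅
  linarith

/-- The assumptions on `R`, `D` and `L` are placed inside the output property so that the bounds for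
rounds and queries are unconditional. -/
theorem ensures_reduceRatio (hs : Submodular f) (hm : Monotone f) (hf : ∀ S, 0 ≤ f S)
    (δ D R L : ℝ) :
    Alg.Ensures f (reduceRatio thresholdSampling k δ D R L)
      (fun L' => 0 ≤ Real.log R → 0 ≤ L → D ≤ opt f k → L ≤ opt f k → D / 2 ≤ L' ∧ L' ≤ opt f k)
      (roundBound N (1 - 1 / Real.log R) (callFailure δ R) + 1)
      ((topIndex R + 1) * (queryBound N + 1)) := by
  rw [reduceRatio_eq]
  refine (Alg.ensures_andThen (Alg.ensures_draw (P := fun _ => True) fun _ _ => trivial)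
    (r' := roundBound N (1 - 1 / Real.log R) (callFailure δ R) + 1)
    (w' := (topIndex R + 1) * queryBound N + (topIndex R + 1)) fun N' _ => ?_).mono
    (fun _ h => h) (by simp) (by linarith)
  refine Alg.ensures_andThen (ensures_calls hs hm hf δ R L N') fun sets hsets => ?_
  have hlen := hsets.length_eq
  rw [List.length_range] at hlen
  refine (Alg.ensures_andThen (Alg.ensures_askAll _) (r' := 0) (w' := 0) fun vals hvals => ?_).mono
    (fun _ h => h) (by simp) (by simp [← hlen])
  subst hvals
  refine Alg.ensures_ret (fun hR hL hD hLV => ?_) le_rfl le_rfl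
  exact newLower_bounds (by positivity) hL hD hLV hsets

/-- The cost is linear in the size of the subsample, whose mean is at most `n / log² R`; this
outweighs the roughly `log R` thresholds. -/
theorem cost_reduceRatio_le (hs : Submodular f) (hm : Monotone f) (hf : ∀ S, 0 ≤ f S)
    (δ D R L : ℝ) (hR : 1 ≤ Real.log R) :
    Alg.cost f (reduceRatio thresholdSampling k δ D R L) ≤
      (topIndex R + 1 : ℕ) * (ENNReal.ofReal (40002 / (1 - 1 / Real.log R)) *
        (Fintype.card N * ENNReal.ofReal (1 / Real.log R ^ 2))) + (topIndex R + 1 : ℕ) := by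
  rw [reduceRatio_eq, Alg.cost_andThen, Alg.cost_draw, zero_add, Alg.outE_draw]
  have hq : Real.toNNReal (1 / Real.log R ^ 2) ≤ 1 := by
    rw [Real.toNNReal_le_one]
    rw [div_le_one (by positivity)]
    exact one_le_pow₀ hR
  calc _ ≤ expect (subsample N (Real.toNNReal (1 / Real.log R ^ 2))) (fun N' =>
        ((topIndex R + 1 : ℕ) : ℝ≥0∞) * ENNReal.ofReal (40002 / (1 - 1 / Real.log R)) * N'.card +
          (topIndex R + 1 : ℕ)) := by
        refine expect_mono fun N' _ => Alg.cost_andThen_le (ensures_calls hs hm hf δ R L N') ?_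
          fun sets hsets => ?_
        · refine (Alg.cost_parList_le _ fun i _ => cost_thresholdSampling_le hs hm _ _ _ _ _ _).trans
            ?_
          rw [List.length_range, mul_assoc]
        · have hlen := hsets.length_eq
          rw [List.length_range] at hlen
          rw [Alg.cost_andThen, Alg.cost_askAll]
          simp only [Alg.cost_ret, Alg.outE_const, ← hlen, add_zero, le_refl]
    _ ≤ _ := by
        rw [expect_add, expect_const, expect_mul_left, mul_assoc]
        gcongr
        exact expect_subsample_card_le _ hq

/-- A successful ratio reduction encloses the optimum. -/
theorem le_newLower (hs : Submodular f) (hm : Monotone f) (hk : 1 ≤ k)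
    {x R L D δR : ℝ} (hx : 1 ≤ x) (hR : 0 < R) (hδ : 0 < δR)
    (hδ' : δR ≤ 1 / 2)
    (hD : 0 ≤ D) (hL : 0 < L) (hVR : opt f k ≤ R * L)
    {N' O' : Finset N} (hO'N : O' ⊆ N') (hO' : O'.card ≤ k)
    (hOV : 1 / x ^ 2 * opt f k / 4 ≤ f O') {sets : List (Finset N)}
    (h : List.Forall₂ (CallResult f N' k (1 / x) L) (List.range (topIndex R + 1)) sets)
    (hsat : List.Forall₂ (fun i => Saturated f N' ∅ k (2 ^ i * L / k))
      (List.range (topIndex R + 1)) sets) :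
    opt f k ≤ 16 * x ^ 2 / (δR * (1 / x)) *
      newLower D (1 / x) L (firstBelow (1 / x) L (sets.map f)) := by
  obtain ⟨h1, -, h3⟩ := firstBelow_spec (1 / x) L (sets.map f)
  set j := firstBelow (1 / x) L (sets.map f)
  have hlen := h.length_eq
  rw [List.length_range] at hlen
  rw [List.length_map] at h1
  have hk' : (0 : ℝ) < k := by exact_mod_cast hk
  have hx0 : 0 < x := by linarith
  have hp1 : 1 / x ≤ 1 := (div_le_one hx0).2 hx
  have hV : opt f k ≤ 4 * x ^ 2 * f O' := by
    have : 1 / x ^ 2 * opt f k / 4 = opt f k / (4 * x ^ 2) := by field_simp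
    rw [this, div_le_iff₀ (by positivity)] at hOV
    linarith
  -- The ratio equals `16 x³ / δR`; in this deterministic part only `δR ≤ 1 / 2` is used.
  have hcoef : 32 * x ^ 3 ≤ 16 * x ^ 2 / (δR * (1 / x)) := by
    have : 16 * x ^ 2 / (δR * (1 / x)) = 16 * x ^ 3 / δR := by field_simp
    rw [this, le_div_iff₀ hδ]
    have : 0 < x ^ 3 := by positivity
    nlinarith
  have hx3 : x ^ 2 ≤ x ^ 3 := pow_le_pow_right₀ hx (by norm_num)
  -- The value at index `j` is below `p k τ_j`, which excludes a set of full size. So all gains in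
  -- the subsample are below `τ_j`, and `f O'` exceeds the value by at most `k τ_j`.
  have hjle : ∀ hj : j < sets.length, f O' ≤ 2 * (2 ^ j * L) := by
    intro hj
    have hj' : j < (List.range (topIndex R + 1)).length := by rw [List.length_range]; omega
    have hc := h.get hj' hj
    have hs' := hsat.get hj' hj
    simp only [List.get_eq_getElem, List.getElem_range] at hc hs'
    have h4 := h3 (by simpa using hj)
    rw [List.getElem_map] at h4
    set T := sets[j]
    have hτ : 0 ≤ 2 ^ j * L / k := by positivity
    have hkτ : k * (2 ^ j * L / k) = 2 ^ j * L := by field_simp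
    rcases hs' with h5 | h5
    · exfalso
      have h6 := hc.2.2
      rw [h5] at h6
      have : 1 / x * (2 ^ j * L / k) * k = 1 / x * (2 ^ j * L) := by field_simp
      linarith
    · rw [Finset.empty_union] at h5
      have h6 := sub_le_of_gain_le hs hm (S := T) hτ hO' fun z hz => (h5 z (hO'N hz)).le
      rw [hkτ] at h6
      have h7 : 1 / x * (2 ^ j * L) ≤ 1 * (2 ^ j * L) :=
        mul_le_mul_of_nonneg_right hp1 (by positivity)
      linarith
  unfold newLower
  split_ifs with hj0
  · have h4 := hjle (by omega)
    rw [hj0, pow_zero, one_mul] at h4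
    have h5 : opt f k ≤ 8 * x ^ 2 * L := by nlinarith [mul_pos hx0 hx0]
    calc opt f k ≤ 32 * x ^ 3 * (L / 2) := by nlinarith [mul_pos (pow_pos hx0 2) hL]
      _ ≤ _ := by
          refine mul_le_mul hcoef (by linarith) (by positivity) ?_
          exact (by positivity : (0:ℝ) ≤ 32 * x ^ 3).trans hcoef
  · set M := 2 ^ (j - 1) * L with hM
    have hM0 : 0 < M := by positivity
    have h2j : (2 : ℝ) ^ j = 2 * 2 ^ (j - 1) := by
      rw [← pow_succ']; congr 1; omega
    have hbound : opt f k ≤ 16 * x ^ 2 * M := by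
      by_cases hj : j < sets.length
      · have h4 := hjle hj
        rw [h2j, mul_assoc, ← hM] at h4
        have : 4 * x ^ 2 * f O' ≤ 4 * x ^ 2 * (2 * (2 * M)) :=
          mul_le_mul_of_nonneg_left h4 (by positivity)
        linarith
      -- No value was too small; the last threshold already covers the whole interval, as `2 ^
      -- topIndex R ≥ R`.
      · have hjt : j - 1 = topIndex R := by omega
        have h4 : R ≤ 2 ^ (j - 1) := by
          rw [hjt]
          have h5 : Real.log R / Real.log 2 ≤ topIndex R := Nat.le_ceil _
          rw [div_le_iff₀ (Real.log_pos (by norm_num)), ← Real.log_pow,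
            Real.log_le_log_iff hR (by positivity)] at h5
          exact h5
        have h5 : R * L ≤ M := mul_le_mul_of_nonneg_right h4 hL.le
        have : 1 ≤ x ^ 2 := one_le_pow₀ hx
        nlinarith
    calc opt f k ≤ 32 * x ^ 3 * (1 / x * M / 2) := by
          have : 32 * x ^ 3 * (1 / x * M / 2) = 16 * x ^ 2 * M := by field_simp; ring
          rw [this]; exact hbound
      _ ≤ _ := by
          refine mul_le_mul hcoef (by linarith) (by positivity) ?_
          exact (by positivity : (0:ℝ) ≤ 32 * x ^ 3).trans hcoef

/-- Two sources of failure, the subsample and the family of threshold-sampling calls, each have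
probability at most `stageFailure δ R = δ / (2 log R)`. -/
theorem fail_reduceRatio_le [Nonempty N] (hs : Submodular f) (hm : Monotone f)
    (hf : ∀ S, 0 ≤ f S) (hk : 1 ≤ k) {δ D R L : ℝ} (hx : 2 ≤ Real.log R) (hδ : 0 < δ)
    (hδ' : δ < 1) (hD : 0 < D) (hDx : ∀ x, f {x} ≤ D) (hDV : D ≤ opt f k) (hL : 0 < L)
    (hLV : L ≤ opt f k) (hVR : opt f k ≤ R * L) :
    Alg.failure f (reduceRatio thresholdSampling k δ D R L)
      (fun L' => opt f k ≤ reducedRatio δ R * L') ≤ ENNReal.ofReal (δ / Real.log R) := by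
  set x := Real.log R with hxdef
  have hx0 : 0 < x := by linarith
  have hR : 0 < R := by
    by_contra h
    have hV : 0 < opt f k := hL.trans_le hLV
    nlinarith [mul_nonneg (neg_nonneg.2 (not_lt.1 h)) hL.le]
  set δR := stageFailure δ R with hδR
  have hδRx : δR = δ / (2 * x) := rfl
  have hδR0 : 0 < δR := by rw [hδRx]; positivity
  have hδR1 : δR ≤ 1 / 4 := by
    rw [hδRx, div_le_iff₀ (by positivity)]; linarith
  have hR' : reducedRatio δ R = 16 * x ^ 2 / (δR * (1 / x)) := rfl
  have hR'0 : 0 ≤ reducedRatio δ R := by rw [hR']; positivity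
  have hens := ensures_reduceRatio (k := k) hs hm hf δ D R L
  -- In this case the sure bound `D / 2 ≤ L'` is enough. Averaging with `D` in the new lower end
  -- serves this purpose.
  by_cases hbig : opt f k ≤ reducedRatio δ R * (D / 2)
  · rw [Alg.failure_eq_zero_of_ensures hens fun L' hL' => ?_]
    · exact zero_le
    · exact hbig.trans (mul_le_mul_of_nonneg_left (hL' hx0.le hL.le hDV hLV).1 hR'0)
  obtain ⟨O, hO, hfO⟩ := exists_eq_opt f k
  have hq : Real.toNNReal (1 / x ^ 2) ≤ 1 := by
    rw [Real.toNNReal_le_one, div_le_one (by positivity)]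
    exact one_le_pow₀ (by linarith)
  have hqr : ((Real.toNNReal (1 / x ^ 2) : NNReal) : ℝ) = 1 / x ^ 2 :=
    Real.coe_toNNReal _ (by positivity)
  have htail := subsample_opt_tail hs hm hf (Real.toNNReal (1 / x ^ 2)) hq O hD hDx
  rw [hqr, hfO] at htail
  -- Now `D` is tiny compared with the optimum, so the exponent is at least `1 / δR`, and `exp (-z)
  -- ≤ 1 / z`.
  have htail' : Real.exp (-(1 / x ^ 2 * (opt f k - f ∅) / (4 * D))) ≤ δR := by
    rw [not_le, hR'] at hbig
    have h1 : 16 * x ^ 2 / (δR * (1 / x)) * (D / 2) = 8 * x ^ 3 * D / δR := by field_simp; ring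
    rw [h1, div_lt_iff₀ hδR0] at hbig
    obtain ⟨x₀⟩ := ‹Nonempty N›
    have h2 : f ∅ ≤ D := (hm (Finset.empty_subset {x₀})).trans (hDx x₀)
    have hx3 : 2 * x ^ 2 ≤ x ^ 3 := by nlinarith [pow_pos hx0 2]
    have h3 : 2 * D ≤ opt f k := by
      have h4 : 8 * x ^ 3 * D < opt f k * 1 := hbig.trans_le
        (mul_le_mul_of_nonneg_left (by linarith) (by linarith))
      have h5 : 8 ≤ x ^ 3 := by nlinarith [pow_pos hx0 2]
      nlinarith
    have h4 : 1 / δR ≤ 1 / x ^ 2 * (opt f k - f ∅) / (4 * D) := by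
      have h5 : 1 / x ^ 2 * (opt f k - f ∅) / (4 * D) = (opt f k - f ∅) / (4 * D * x ^ 2) := by
        field_simp
      rw [h5, div_le_div_iff₀ hδR0 (by positivity)]
      have h6 : opt f k / 2 * δR ≤ (opt f k - f ∅) * δR :=
        mul_le_mul_of_nonneg_right (by linarith) hδR0.le
      nlinarith
    have h5 := Real.add_one_le_exp (1 / x ^ 2 * (opt f k - f ∅) / (4 * D))
    rw [Real.exp_neg, inv_le_comm₀ (Real.exp_pos _) hδR0, inv_eq_one_div]
    linarith
  rw [reduceRatio_eq, ← hxdef]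
  have hcf : 0 < callFailure δ R := by unfold callFailure; positivity
  have hcf1 : callFailure δ R < 1 := by
    refine (div_le_self hδR0.le ?_).trans_lt (by linarith : δR < 1)
    have : (0 : ℝ) ≤ topIndex R := Nat.cast_nonneg _
    linarith
  have hp : 0 < 1 - 1 / x := by
    rw [sub_pos, div_lt_one hx0]; linarith
  have hp' : 1 - 1 / x < 1 := by
    have : 0 < 1 / x := by positivity
    linarith
  have hcalls : ∀ N' : Finset N, Alg.failure f
      (Alg.parList ((List.range (topIndex R + 1)).map fun i =>
        thresholdSampling N' ∅ k (2 ^ i * L / k) (1 - 1 / x) (callFailure δ R)))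
      (fun sets => List.Forall₂ (fun i => Saturated f N' ∅ k (2 ^ i * L / k))
        (List.range (topIndex R + 1)) sets) ≤ ENNReal.ofReal δR := by
    intro N'
    have hk' : (0 : ℝ) < k := by exact_mod_cast hk
    refine (Alg.failure_parList_le _ fun i _ => fail_thresholdSampling_le hs hm N' ∅ k
      (by positivity) hp hp' hcf hcf1).trans ?_
    rw [List.length_range, ← ENNReal.ofReal_natCast, ← ENNReal.ofReal_mul (by positivity)]
    refine ENNReal.ofReal_le_ofReal (le_of_eq ?_)
    rw [callFailure, ← hδR]
    push_cast
    field_simp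
  refine (Alg.failure_andThen_le (Alg.ensures_draw (P := fun _ => True) fun _ _ => trivial)
    (P := fun N' => 1 / x ^ 2 * opt f k / 4 ≤ f (O ∩ N')) (c := ENNReal.ofReal δR)
    (d := ENNReal.ofReal δR) ?_ fun N' _ hN' => ?_).trans ?_
  · rw [Alg.failure, Alg.outE_draw]
    exact htail.trans (ENNReal.ofReal_le_ofReal htail')
  · refine (Alg.failure_andThen_le (ensures_calls hs hm hf δ R L N') (hcalls N') (d := 0)
      fun sets hsets hsat => ?_).trans (add_zero _).le
    rw [Alg.failure_andThen, Alg.outE_askAll]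
    refine (Alg.failure_ret_of_pos ?_).le
    rw [hR']
    exact le_newLower hs hm hk (by linarith) hR hδR0 (by linarith) hD.le hL hVR
      Finset.inter_subset_right ((Finset.card_le_card Finset.inter_subset_left).trans hO) hN'
      hsets hsat
  · rw [← ENNReal.ofReal_add hδR0.le hδR0.le, hδRx]
    refine ENNReal.ofReal_le_ofReal (le_of_eq ?_)
    field_simp
    ring

end ReduceRatio

/-! ### The sequence of ratios -/

section Ratios

open Real

theorem reducedRatio_eq {δ R : ℝ} : reducedRatio δ R = 32 * log R ^ 4 / δ := by
  unfold reducedRatio stageFailure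
  by_cases h : log R = 0
  · simp [h]
  by_cases hδ : δ = 0
  · simp [hδ]
  field_simp
  norm_num

theorem log_ge_of_ratioStop_le {δ R : ℝ} (hδ : 0 < δ) (hδ1 : δ ≤ 0.16) (hR : ratioStop δ ≤ R) :
    18 ≤ log R := by
  have h1 : (10 : ℝ) ^ 8 ≤ ratioStop δ := by
    unfold ratioStop
    rw [le_div_iff₀ (by positivity)]
    nlinarith
  rw [le_log_iff_exp_le (by linarith [show (0 : ℝ) < 10 ^ 8 by norm_num])]
  have h2 : exp 18 = exp 1 ^ 18 := by rw [← exp_nat_mul]; norm_num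
  have h3 : exp 1 ^ 18 ≤ 2.72 ^ 18 := by
    gcongr
    have := exp_one_lt_d9
    linarith
  have h4 : (2.72 : ℝ) ^ 18 ≤ 10 ^ 8 := by norm_num
  linarith

/-- Tangent line of the exponential at `x / 8 = 2.25`, that is at `x = 18`. -/
theorem le_exp_div_eight {x : ℝ} (hx : 18 ≤ x) : 0.43 * x ≤ exp (x / 8) := by
  have h1 : exp (x / 8) = exp 1 * exp 1 * exp 0.25 * exp (x / 8 - 2.25) := by
    rw [← exp_add, ← exp_add, ← exp_add]; congr 1; norm_num
  have h2 : 2.7 ≤ exp 1 := by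
    have := exp_one_gt_d9
    linarith
  have h3 : (1.25 : ℝ) ≤ exp 0.25 := by
    have := add_one_le_exp (0.25 : ℝ)
    norm_num at this ⊢
    linarith
  have h4 := add_one_le_exp (x / 8 - 2.25)
  have h5 : (2.7 : ℝ) * 2.7 * 1.25 ≤ exp 1 * exp 1 * exp 0.25 := by gcongr
  have h6 : (2.7 : ℝ) * 2.7 * 1.25 * (x / 8 - 1.25) ≤ exp (x / 8) := by
    rw [h1]
    refine mul_le_mul h5 (by linarith) (by linarith) (by positivity)
  linarith

/-- The square root of the hypothesis, since `ratioStop δ = (2000 / δ)²`. It trades `1 / δ` for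
`√R`. -/
theorem inv_le_of_ratioStop_le {δ R : ℝ} (hδ : 0 < δ) (hR : ratioStop δ ≤ R) :
    1 / δ ≤ exp (log R / 2) / 2000 := by
  unfold ratioStop at hR
  have hR0 : 0 < R := lt_of_lt_of_le (by positivity) hR
  have h1 : exp (log R / 2) ^ 2 = R := by
    rw [← exp_nat_mul]
    push_cast
    rw [mul_div_cancel₀ _ (two_ne_zero), exp_log hR0]
  rw [div_le_iff₀ (by positivity)] at hR
  rw [div_le_iff₀ hδ]
  have h2 : (2000 : ℝ) ^ 2 ≤ (exp (log R / 2) * δ) ^ 2 := by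
    rw [mul_pow, h1]; norm_num at hR ⊢; linarith
  have h3 := (pow_le_pow_iff_left₀ (by norm_num) (by positivity) (by norm_num)).1 h2
  linarith

/-- With `log⁴ R ≤ 31 √R` and `1 / δ ≤ √R / 2000` the new ratio is at most `(32 · 31 / 2000) R`.
This crude bound serves termination and monotonicity. -/
theorem reducedRatio_le_half {δ R : ℝ} (hδ : 0 < δ) (hδ1 : δ ≤ 0.16) (hR : ratioStop δ ≤ R) :
    reducedRatio δ R ≤ R / 2 := by
  have hx := log_ge_of_ratioStop_le hδ hδ1 hR
  have hR0 : 0 < R := by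
    refine lt_of_lt_of_le ?_ hR
    unfold ratioStop; positivity
  have h1 := inv_le_of_ratioStop_le hδ hR
  set x := log R with hxdef
  have h2 := le_exp_div_eight hx
  have h3 : x ^ 4 ≤ 31 * exp (x / 2) := by
    have h4 : (0.43 * x) ^ 4 ≤ exp (x / 8) ^ 4 := by gcongr
    rw [← exp_nat_mul, mul_pow] at h4
    have h5 : ((4 : ℕ) : ℝ) * (x / 8) = x / 2 := by push_cast; ring
    rw [h5] at h4
    norm_num at h4
    nlinarith [pow_pos (show 0 < x by linarith) 4]
  have h4 : R = exp (x / 2) * exp (x / 2) := by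
    rw [← exp_add, add_halves, hxdef, exp_log hR0]
  rw [reducedRatio_eq, ← hxdef]
  calc 32 * x ^ 4 / δ = 32 * x ^ 4 * (1 / δ) := by ring
    _ ≤ 32 * (31 * exp (x / 2)) * (exp (x / 2) / 2000) := by gcongr
    _ ≤ R / 2 := by
        rw [h4]
        nlinarith [mul_pos (exp_pos (x / 2)) (exp_pos (x / 2))]

theorem log_le_add_div_sixteen {x : ℝ} (hx : 0 < x) : log x ≤ 1.7727 + x / 16 := by
  have h1 : log (x / 16) ≤ x / 16 - 1 := log_le_sub_one_of_pos (by positivity)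
  have h2 : log x = log 16 + log (x / 16) := by
    rw [← log_mul (by norm_num) (by positivity)]; congr 1; ring
  have h3 : log 16 = 4 * log 2 := by
    rw [show (16 : ℝ) = 2 ^ 4 by norm_num, log_pow]; norm_num
  have := log_two_lt_d9
  linarith

/-- As the new ratio `R'` is still above the stopping value, `1 / δ ≤ √R' / 2000`, so `√R' ≤ 0.016
log⁴ R`. Fourth roots give `exp (1 + log R' / 8) ≤ log R`: the logarithm of `R'` is of order `log
log R`, far more than the factor `1.1` requires. -/
theorem loglog_reducedRatio_le {δ R : ℝ} (hδ : 0 < δ) (hδ1 : δ ≤ 0.16) (hR : ratioStop δ ≤ R)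
    (hR' : ratioStop δ ≤ reducedRatio δ R) :
    1.1 * log (log (reducedRatio δ R)) ≤ log (log R) := by
  have hx := log_ge_of_ratioStop_le hδ hδ1 hR
  have hx' := log_ge_of_ratioStop_le hδ hδ1 hR'
  have h1 := inv_le_of_ratioStop_le hδ hR'
  have hR'0 : 0 < reducedRatio δ R := by
    refine lt_of_lt_of_le ?_ hR'
    unfold ratioStop; positivity
  have heq : reducedRatio δ R = 32 * log R ^ 4 * (1 / δ) := by rw [reducedRatio_eq]; ring
  set x' := log (reducedRatio δ R) with hx'def
  set x := log R
  have h2 : exp (x' / 2) ≤ 0.016 * x ^ 4 := by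
    have h3 : exp (x' / 2) * exp (x' / 2) ≤ 32 * x ^ 4 * (exp (x' / 2) / 2000) := by
      rw [← exp_add, add_halves, hx'def, exp_log hR'0]
      rw [← hx'def]
      exact heq.le.trans (mul_le_mul_of_nonneg_left h1 (by positivity))
    have h4 : exp (x' / 2) * exp (x' / 2) ≤ (0.016 * x ^ 4) * exp (x' / 2) := by
      refine h3.trans (le_of_eq ?_); ring
    exact le_of_mul_le_mul_right h4 (exp_pos _)
  have h3 : exp (1 + x' / 8) ≤ x := by
    have h4 : exp (1 + x' / 8) ^ 4 ≤ x ^ 4 := by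
      have h5 : exp (1 + x' / 8) ^ 4 = exp 1 ^ 4 * exp (x' / 2) := by
        rw [← exp_nat_mul, ← exp_nat_mul, ← exp_add]; congr 1; push_cast; ring
      have h6 : exp 1 ^ 4 ≤ 2.72 ^ 4 := by
        gcongr
        have := exp_one_lt_d9
        linarith
      rw [h5]
      calc exp 1 ^ 4 * exp (x' / 2) ≤ 2.72 ^ 4 * (0.016 * x ^ 4) := by gcongr
        _ ≤ x ^ 4 := by
            have : 0 ≤ x ^ 4 := by positivity
            nlinarith
    exact (pow_le_pow_iff_left₀ (exp_pos _).le (by linarith) (by norm_num)).1 h4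
  have h4 : 1 + x' / 8 ≤ log x := (le_log_iff_exp_le (by linarith)).2 h3
  have h5 := log_le_add_div_sixteen (show 0 < x' by linarith)
  linarith

variable {k : ℕ} {δ : ℝ}

/-- The ratio in the `s`-th step. -/
noncomputable def ratio (k : ℕ) (δ : ℝ) (s : ℕ) : ℝ := (reducedRatio δ)^[s] (k : ℝ)

theorem ratio_succ (k : ℕ) (δ : ℝ) (s : ℕ) : ratio k δ (s + 1) = reducedRatio δ (ratio k δ s) :=
  Function.iterate_succ_apply' _ _ _

theorem ratioStop_le_ratio {s : ℕ} (hs : s < numStages k δ) : ratioStop δ ≤ ratio k δ s := by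
  have := Nat.notMem_of_lt_sInf hs
  exact not_lt.1 this

theorem ratio_le_div_pow (hδ : 0 < δ) (hδ1 : δ ≤ 0.16) {s : ℕ}
    (h : ∀ i < s, ratioStop δ ≤ ratio k δ i) : ratio k δ s ≤ k / 2 ^ s := by
  induction s with
  | zero => simp [ratio]
  | succ s ih =>
    have h1 := ih fun i hi => h i (by omega)
    have h2 := reducedRatio_le_half hδ hδ1 (h s (by omega))
    rw [ratio_succ, pow_succ]
    calc _ ≤ ratio k δ s / 2 := h2
      _ ≤ k / 2 ^ s / 2 := by gcongr
      _ = _ := by rw [div_div]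

/-- Halving brings the ratio below the stopping value within `k` steps at the latest. Hence the set
in `numStages` is nonempty and its infimum is not the default value `0` of an empty set. -/
theorem ratio_numStages_lt (hδ : 0 < δ) (hδ1 : δ ≤ 0.16) :
    ratio k δ (numStages k δ) < ratioStop δ := by
  have hne : {i : ℕ | (reducedRatio δ)^[i] (k : ℝ) < ratioStop δ}.Nonempty := by
    by_contra hc
    rw [Set.not_nonempty_iff_eq_empty] at hc
    have hall : ∀ i, ratioStop δ ≤ ratio k δ i := by
      intro i
      by_contra hi
      have : i ∈ {i : ℕ | (reducedRatio δ)^[i] (k : ℝ) < ratioStop δ} := not_le.1 hi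
      rw [hc] at this
      exact this
    have h1 : ratioStop δ ≤ k / 2 ^ k :=
      (hall k).trans (ratio_le_div_pow hδ hδ1 fun i _ => hall i)
    have h2 : (k : ℝ) / 2 ^ k ≤ 1 := by
      rw [div_le_one (by positivity)]
      exact_mod_cast (Nat.lt_two_pow_self (n := k)).le
    have h3 : 1 < ratioStop δ := by
      unfold ratioStop
      rw [lt_div_iff₀ (by positivity)]
      nlinarith
    linarith
  exact Nat.sInf_mem hne

theorem ratio_le (hδ : 0 < δ) (hδ1 : δ ≤ 0.16) {s : ℕ} (hs : s ≤ numStages k δ) :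
    ratio k δ s ≤ k := by
  refine (ratio_le_div_pow hδ hδ1 fun i hi => ratioStop_le_ratio (hi.trans_le hs)).trans ?_
  exact div_le_self (Nat.cast_nonneg k) (one_le_pow₀ (by norm_num))

theorem ratio_pos (hk : 1 ≤ k) (hδ : 0 < δ) (hδ1 : δ ≤ 0.16) {s : ℕ} (hs : s ≤ numStages k δ) :
    0 < ratio k δ s := by
  cases s with
  | zero => simp only [ratio, Function.iterate_zero, id_eq, Nat.cast_pos]; omega
  | succ s =>
    have := log_ge_of_ratioStop_le hδ hδ1 (ratioStop_le_ratio (k := k) (s := s) (by omega))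
    rw [ratio_succ, reducedRatio_eq]
    have : 0 < log (ratio k δ s) := by linarith
    positivity

/-- The logarithm of the ratio in a step that is performed. -/
theorem eighteen_le_log_ratio (hδ : 0 < δ) (hδ1 : δ ≤ 0.16) {s : ℕ} (hs : s < numStages k δ) :
    18 ≤ log (ratio k δ s) :=
  log_ge_of_ratioStop_le hδ hδ1 (ratioStop_le_ratio hs)

/-- A sequence growing by the factor `1.1` is dominated by its last term; `11` is `1 / (1 - 1 /
1.1)`. -/
theorem sum_le_of_geometric {b : ℕ → ℝ} {B : ℝ} (hB : 0 ≤ B) (K : ℕ) (hb0 : ∀ s < K, 0 ≤ b s)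
    (h : ∀ s, s + 1 < K → 1.1 * b s ≤ b (s + 1)) (hb : ∀ s < K, b s ≤ B) :
    ∑ s ∈ Finset.range K, b s ≤ 11 * B := by
  have key : ∀ M < K, ∑ s ∈ Finset.range (M + 1), b s ≤ 11 * b M := by
    intro M
    induction M with
    | zero => intro h0; have := hb0 0 h0; simp; linarith
    | succ M ih =>
      intro hM
      have h1 := h M hM
      rw [Finset.sum_range_succ]
      linarith [ih (by omega)]
  cases K with
  | zero => simpa using hB
  | succ K => exact (key K (by omega)).trans (by linarith [hb K (by omega)])

theorem loglog_ratio_pos (hδ : 0 < δ) (hδ1 : δ ≤ 0.16) {s : ℕ} (hs : s < numStages k δ) :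
    2.75 ≤ log (log (ratio k δ s)) := by
  have hx := eighteen_le_log_ratio hδ hδ1 hs
  have h1 : log 16 ≤ log (log (ratio k δ s)) := log_le_log (by norm_num) (by linarith)
  have h3 : log 16 = 4 * log 2 := by
    rw [show (16 : ℝ) = 2 ^ 4 by norm_num, log_pow]; norm_num
  have := log_two_gt_d9
  linarith

/-- The summands grow geometrically, and the last one is at most `1 / 2.75`, so the sum is at most
`11 / 2.75 = 4`. -/
theorem sum_inv_loglog_le (hδ : 0 < δ) (hδ1 : δ ≤ 0.16) :
    ∑ s ∈ Finset.range (numStages k δ), 1 / log (log (ratio k δ s)) ≤ 4 := by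
  refine (sum_le_of_geometric (B := 1 / 2.75) (by norm_num) _ (fun s hs => ?_) (fun s hs => ?_)
    fun s hs => ?_).trans (by norm_num)
  · have := loglog_ratio_pos hδ hδ1 hs
    positivity
  · have h1 := loglog_ratio_pos (k := k) hδ hδ1 (show s < numStages k δ by omega)
    have h2 := loglog_ratio_pos hδ hδ1 hs
    have h3 := loglog_reducedRatio_le hδ hδ1
      (ratioStop_le_ratio (k := k) (s := s) (by omega))
      (by rw [← ratio_succ]; exact ratioStop_le_ratio hs)
    rw [← ratio_succ] at h3
    rw [mul_one_div, div_le_div_iff₀ (by linarith) (by linarith)]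
    linarith
  · have h2 := loglog_ratio_pos hδ hδ1 hs
    exact one_div_le_one_div_of_le (by norm_num) h2

/-- Comparison with the previous sum, since `log x ≤ x / 4` for `x ≥ 18`. -/
theorem sum_inv_log_le (hδ : 0 < δ) (hδ1 : δ ≤ 0.16) :
    ∑ s ∈ Finset.range (numStages k δ), 1 / log (ratio k δ s) ≤ 1 := by
  have h : ∀ s ∈ Finset.range (numStages k δ),
      1 / log (ratio k δ s) ≤ 1 / 4 * (1 / log (log (ratio k δ s))) := by
    intro s hs
    rw [Finset.mem_range] at hs
    have h1 := loglog_ratio_pos hδ hδ1 hs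
    have h2 := eighteen_le_log_ratio hδ hδ1 hs
    have h3 := log_le_add_div_sixteen (show 0 < log (ratio k δ s) by linarith)
    rw [div_mul_div_comm, one_mul]
    exact one_div_le_one_div_of_le (by linarith) (by linarith)
  refine (Finset.sum_le_sum h).trans ?_
  rw [← Finset.mul_sum]
  linarith [sum_inv_loglog_le (k := k) hδ hδ1]

theorem log_ratio_le (hk : 1 ≤ k) (hδ : 0 < δ) (hδ1 : δ ≤ 0.16) {s : ℕ}
    (hs : s ≤ numStages k δ) : log (ratio k δ s) ≤ log k :=
  log_le_log (ratio_pos hk hδ hδ1 hs) (ratio_le hδ hδ1 hs)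

/-- Each stage contributes at least `1` to `log k · ∑ 1 / log log R_s`, because `log log R_s ≤ log
R_s ≤ log k`. -/
theorem numStages_le (hk : 1 ≤ k) (hδ : 0 < δ) (hδ1 : δ ≤ 0.16) :
    (numStages k δ : ℝ) ≤ 4 * log k := by
  have h : ∀ s ∈ Finset.range (numStages k δ), 1 ≤ log k * (1 / log (log (ratio k δ s))) := by
    intro s hs
    rw [Finset.mem_range] at hs
    have h1 := loglog_ratio_pos hδ hδ1 hs
    have h2 := eighteen_le_log_ratio hδ hδ1 hs
    have h3 := log_le_sub_one_of_pos (show 0 < log (ratio k δ s) by linarith)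
    have h4 := log_ratio_le hk hδ hδ1 hs.le
    rw [mul_one_div, le_div_iff₀ (by linarith)]
    linarith
  have h2 := Finset.sum_le_sum h
  rw [← Finset.mul_sum] at h2
  have h3 : 0 ≤ log (k : ℝ) := log_natCast_nonneg k
  have h4 := mul_le_mul_of_nonneg_left (sum_inv_loglog_le (k := k) hδ hδ1) h3
  simp only [Finset.sum_const, Finset.card_range, nsmul_eq_mul, mul_one] at h2
  linarith

end Ratios

/-! ### Subsample preprocessing -/

section Preprocessing

variable {N : Type} [Fintype N] {f : Finset N → ℝ} {k : ℕ} {δ : ℝ}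

theorem reduceLoop_zero (TS : ThresholdProc N) (k : ℕ) (δ D : ℝ) (s : ℕ) (L : ℝ) :
    reduceLoop TS k δ D 0 s L = Alg.ret L := rfl

theorem reduceLoop_succ (TS : ThresholdProc N) (k : ℕ) (δ D : ℝ) (t s : ℕ) (L : ℝ) :
    reduceLoop TS k δ D (t + 1) s L =
      (reduceRatio TS k δ D (ratio k δ s) L).andThen fun L' => reduceLoop TS k δ D t (s + 1) L' :=
  rfl

theorem subsamplePreprocessing_eq (TS : ThresholdProc N) (k : ℕ) (δ : ℝ) :
    subsamplePreprocessing TS k δ =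
      (maxSingleton N).andThen fun D =>
      (reduceLoop TS k δ D (numStages k δ) 0 D).andThen fun L =>
        Alg.ret (L, ratio k δ (numStages k δ)) := rfl

variable (N) in
/-- A bound for the number of rounds of a ratio reduction. -/
noncomputable def stageRounds (δ R : ℝ) : ℝ :=
  roundBound N (1 - 1 / Real.log R) (callFailure δ R) + 1

variable (N) in
/-- A bound for the number of queries of a ratio reduction. -/
noncomputable def stageQueries (R : ℝ) : ℝ := (topIndex R + 1) * (queryBound N + 1)

/-- `L` is positive and a lower bound for the optimum, provided that the maximal value `D` of
a singleton is positive. -/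
def LowerEnd (f : Finset N → ℝ) (k : ℕ) (D L : ℝ) : Prop :=
  0 < D → 0 < L ∧ L ≤ opt f k

variable [DecidableEq N]

theorem ensures_reduceRatio_lowerEnd (hs : Submodular f) (hm : Monotone f) (hf : ∀ S, 0 ≤ f S)
    {D R L : ℝ} (hR : 0 ≤ Real.log R) (hDV : D ≤ opt f k) (hL : LowerEnd f k D L) :
    Alg.Ensures f (reduceRatio thresholdSampling k δ D R L) (LowerEnd f k D)
      (stageRounds N δ R) (stageQueries N R) := by
  refine (ensures_reduceRatio hs hm hf δ D R L).mono (fun L' hL' hD => ?_) le_rfl le_rfl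
  obtain ⟨h1, h2⟩ := hL hD
  obtain ⟨h3, h4⟩ := hL' hR h1.le hDV h2
  exact ⟨by linarith, h4⟩

theorem ensures_reduceLoop (hs : Submodular f) (hm : Monotone f) (hf : ∀ S, 0 ≤ f S)
    (hδ : 0 < δ) (hδ1 : δ ≤ 0.16) {D : ℝ} (hDV : D ≤ opt f k) (t : ℕ) {s : ℕ} {L : ℝ}
    (hst : s + t ≤ numStages k δ) (hL : LowerEnd f k D L) :
    Alg.Ensures f (reduceLoop thresholdSampling k δ D t s L) (LowerEnd f k D)
      (∑ i ∈ Finset.range t, stageRounds N δ (ratio k δ (s + i)))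
      (∑ i ∈ Finset.range t, stageQueries N (ratio k δ (s + i))) := by
  induction t generalizing s L with
  | zero => exact Alg.ensures_ret hL (by simp) (by simp)
  | succ t ih =>
    rw [reduceLoop_succ, Finset.sum_range_succ', Finset.sum_range_succ', add_comm (Finset.sum _ _),
      add_comm (Finset.sum _ _)]
    have hx := eighteen_le_log_ratio hδ hδ1 (show s < numStages k δ by omega)
    refine Alg.ensures_andThen
      (ensures_reduceRatio_lowerEnd hs hm hf (by simpa using by linarith) hDV hL) fun L' hL' => ?_
    have h := ih (s := s + 1) (by omega) hL'
    simp only [show ∀ i, s + 1 + i = s + (i + 1) by intro i; ring] at h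
    exact h

theorem cost_reduceLoop_le (hs : Submodular f) (hm : Monotone f) (hf : ∀ S, 0 ≤ f S)
    {D : ℝ} (c : ℕ → ℝ≥0∞)
    (hc : ∀ s < numStages k δ, ∀ L,
      Alg.cost f (reduceRatio thresholdSampling k δ D (ratio k δ s) L) ≤ c s)
    (t : ℕ) {s : ℕ} {L : ℝ} (hst : s + t ≤ numStages k δ) :
    Alg.cost f (reduceLoop thresholdSampling k δ D t s L) ≤
      ∑ i ∈ Finset.range t, c (s + i) := by
  induction t generalizing s L with
  | zero => rw [reduceLoop_zero, Alg.cost_ret]; exact zero_le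
  | succ t ih =>
    rw [reduceLoop_succ, Finset.sum_range_succ', add_comm (Finset.sum _ _)]
    refine Alg.cost_andThen_le (ensures_reduceRatio hs hm hf δ D (ratio k δ s) L)
      (hc s (by omega) L) fun L' _ => ?_
    have h := ih (s := s + 1) (L := L') (by omega)
    simp only [show ∀ i, s + 1 + i = s + (i + 1) by intro i; ring] at h
    exact h

theorem fail_reduceLoop_le [Nonempty N] (hs : Submodular f) (hm : Monotone f)
    (hf : ∀ S, 0 ≤ f S) (hk : 1 ≤ k) (hδ : 0 < δ) (hδ1 : δ ≤ 0.16) {D : ℝ} (hD : 0 < D)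
    (hDx : ∀ x, f {x} ≤ D) (hDV : D ≤ opt f k) (t : ℕ) {s : ℕ} {L : ℝ}
    (hst : s + t ≤ numStages k δ) (hL : LowerEnd f k D L) (hVR : opt f k ≤ ratio k δ s * L) :
    Alg.failure f (reduceLoop thresholdSampling k δ D t s L)
      (fun L' => opt f k ≤ ratio k δ (s + t) * L') ≤
      ∑ i ∈ Finset.range t, ENNReal.ofReal (δ / Real.log (ratio k δ (s + i))) := by
  induction t generalizing s L with
  | zero =>
    rw [reduceLoop_zero]
    exact (Alg.failure_ret_of_pos (P := fun L' => opt f k ≤ ratio k δ (s + 0) * L') hVR).le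
  | succ t ih =>
    rw [reduceLoop_succ, Finset.sum_range_succ', add_comm (Finset.sum _ _)]
    have hx := eighteen_le_log_ratio hδ hδ1 (show s < numStages k δ by omega)
    refine Alg.failure_andThen_le
      (ensures_reduceRatio_lowerEnd hs hm hf (by simpa using by linarith) hDV hL)
      (fail_reduceRatio_le hs hm hf hk (by linarith) hδ (by linarith) hD hDx hDV (hL hD).1
        (hL hD).2 hVR) fun L' hL' hVR' => ?_
    rw [← ratio_succ] at hVR'
    have h := ih (s := s + 1) (by omega) hL' hVR'
    simp only [show ∀ i, s + 1 + i = s + (i + 1) by intro i; ring] at h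
    exact h

theorem ensures_subsamplePreprocessing (hs : Submodular f) (hm : Monotone f)
    (hf : ∀ S, 0 ≤ f S) (hk : 1 ≤ k) (hδ : 0 < δ) (hδ1 : δ ≤ 0.16) :
    Alg.Ensures f (subsamplePreprocessing thresholdSampling k δ)
      (fun I => LowerEnd f k (singletonMax f) I.1 ∧ I.2 = ratio k δ (numStages k δ))
      (1 + ∑ s ∈ Finset.range (numStages k δ), stageRounds N δ (ratio k δ s))
      (Fintype.card N + ∑ s ∈ Finset.range (numStages k δ), stageQueries N (ratio k δ s)) := by
  rw [subsamplePreprocessing_eq]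
  refine Alg.ensures_andThen ensures_maxSingleton fun D hD => ?_
  subst hD
  have hDV := singletonMax_le_opt hk hf
  have h := ensures_reduceLoop hs hm hf hδ hδ1 hDV (numStages k δ) (s := 0) (by simp)
    (L := singletonMax f) fun h => ⟨h, hDV⟩
  simp only [zero_add] at h
  exact (Alg.ensures_andThen h fun L hL => Alg.ensures_ret ⟨hL, rfl⟩ le_rfl le_rfl).mono
    (fun _ h => h) (by simp) (by simp)

theorem cost_subsamplePreprocessing_le (hs : Submodular f) (hm : Monotone f)
    (hf : ∀ S, 0 ≤ f S) (c : ℕ → ℝ≥0∞)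
    (hc : ∀ s < numStages k δ, ∀ D L,
      Alg.cost f (reduceRatio thresholdSampling k δ D (ratio k δ s) L) ≤ c s) :
    Alg.cost f (subsamplePreprocessing thresholdSampling k δ) ≤
      Fintype.card N + ∑ s ∈ Finset.range (numStages k δ), c s := by
  rw [subsamplePreprocessing_eq]
  refine Alg.cost_andThen_le ensures_maxSingleton
    ((Alg.cost_le_of_ensures ensures_maxSingleton).trans (by simp)) fun D _ => ?_
  rw [Alg.cost_andThen]
  simp only [Alg.cost_ret, Alg.outE_const, add_zero]
  simpa using cost_reduceLoop_le hs hm hf c (fun s hs L => hc s hs D L) (numStages k δ) (s := 0)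
    (L := D) (by simp)

/-- The stages fail with probabilities `δ / log R_s`, whose sum is at most `δ`. Positivity of the
largest singleton value keeps all lower ends positive. -/
theorem fail_subsamplePreprocessing_le [Nonempty N] (hs : Submodular f) (hm : Monotone f)
    (hf : ∀ S, 0 ≤ f S) (hk : 1 ≤ k) (hδ : 0 < δ) (hδ1 : δ ≤ 0.16)
    (hD : 0 < singletonMax f) :
    Alg.failure f (subsamplePreprocessing thresholdSampling k δ)
      (fun I => opt f k ≤ I.2 * I.1) ≤ ENNReal.ofReal δ := by
  rw [subsamplePreprocessing_eq, Alg.failure_andThen]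
  refine Alg.outE_le_of_ensures ensures_maxSingleton fun D hD' => ?_
  subst hD'
  have hDV := singletonMax_le_opt hk hf
  have hL : LowerEnd f k (singletonMax f) (singletonMax f) := fun h => ⟨h, hDV⟩
  have h := fail_reduceLoop_le hs hm hf hk hδ hδ1 hD le_singletonMax hDV (numStages k δ) (s := 0)
    (by simp) hL (opt_le_card_mul_singletonMax hk hs hm hf)
  simp only [zero_add] at h
  have hens := ensures_reduceLoop hs hm hf hδ hδ1 hDV (numStages k δ) (s := 0) (by simp) hL
  refine (Alg.failure_andThen_le hens h (d := 0) fun L _ hVL =>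
    (Alg.failure_ret_of_pos (P := fun I : ℝ × ℝ => opt f k ≤ I.2 * I.1) hVL).le).trans ?_
  rw [add_zero, ← ENNReal.ofReal_sum_of_nonneg fun s hs => ?_]
  · refine ENNReal.ofReal_le_ofReal ?_
    have h1 := mul_le_mul_of_nonneg_left (sum_inv_log_le (k := k) hδ hδ1) hδ.le
    rw [Finset.mul_sum] at h1
    simpa only [mul_one_div, mul_one] using h1
  · have := eighteen_le_log_ratio hδ hδ1 (Finset.mem_range.1 hs)
    have : 0 < Real.log (ratio k δ s) := by linarith
    positivity

end Preprocessing

/-! ### Bounds for rounds, queries and the expected value -/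

section Bounds

open Real

theorem topIndex_add_one_le {R : ℝ} (hR : 18 ≤ log R) : (topIndex R + 1 : ℝ) ≤ 2 * log R := by
  have h1 : (topIndex R : ℝ) ≤ log R / log 2 + 1 := by
    refine (Nat.ceil_lt_add_one ?_).le
    exact div_nonneg (by linarith) (log_nonneg (by norm_num))
  have h2 : log R / log 2 ≤ log R * 1.5 := by
    rw [div_le_iff₀ (log_pos (by norm_num))]
    have := log_two_gt_d9
    nlinarith
  linarith

variable {N : Type} [Fintype N] {k : ℕ} {δ : ℝ}

theorem half_le_log_card (h2 : 2 ≤ Fintype.card N) : 1 / 2 ≤ log (Fintype.card N : ℝ) := by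
  have h3 : (2 : ℝ) ≤ Fintype.card N := by exact_mod_cast h2
  have := log_le_log (by norm_num) h3
  have := log_two_gt_d9
  linarith

theorem log_le_card (h2 : 2 ≤ Fintype.card N) : log (Fintype.card N : ℝ) ≤ Fintype.card N := by
  have h3 : (0 : ℝ) < Fintype.card N := by exact_mod_cast (by omega : 0 < Fintype.card N)
  have := log_le_sub_one_of_pos h3
  linarith

theorem log_ratio_le_log_card (hk : 1 ≤ k) (hkn : k ≤ Fintype.card N) (hδ : 0 < δ)
    (hδ1 : δ ≤ 0.16) {s : ℕ} (hs : s ≤ numStages k δ) :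
    log (ratio k δ s) ≤ log (Fintype.card N : ℝ) :=
  (log_ratio_le hk hδ hδ1 hs).trans
    (log_le_log (by exact_mod_cast hk) (by exact_mod_cast hkn))

/-- With error `1 - 1 / log R` the shrink rate is `log log R / 10000`. A stage is performed only if
`n ≥ R ≥ ratioStop δ ≥ 1 / δ`, so all failure probabilities are polynomial in `1 / n` and `δ`
disappears from the bound. -/
theorem stageRounds_le (h2 : 2 ≤ Fintype.card N) (hk : 1 ≤ k) (hkn : k ≤ Fintype.card N)
    (hδ : 0 < δ) (hδ1 : δ ≤ 0.16) {s : ℕ} (hs : s < numStages k δ) :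
    stageRounds N δ (ratio k δ s) ≤
      4 + 120000 * log (Fintype.card N : ℝ) * (1 / log (log (ratio k δ s))) := by
  set R := ratio k δ s with hR
  set n : ℝ := (Fintype.card N : ℝ) with hn
  have hn2 : (2 : ℝ) ≤ n := by rw [hn]; exact_mod_cast h2
  have hx := eighteen_le_log_ratio hδ hδ1 hs
  rw [← hR] at hx
  have hu := loglog_ratio_pos hδ hδ1 hs
  rw [← hR] at hu
  have hxn : log R ≤ n := (log_ratio_le_log_card hk hkn hδ hδ1 hs.le).trans (log_le_card h2)
  set x := log R
  have hp0 : 0 < 1 - 1 / x := by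
    rw [sub_pos, div_lt_one (by linarith)]; linarith
  have hp1 : 1 - 1 / x < 1 := by
    have : 0 < 1 / x := by positivity
    linarith
  have hrate : shrinkRate (1 - 1 / x) = log x / 10000 := by
    unfold shrinkRate
    rw [sub_sub_cancel, one_div, log_inv, neg_neg]
  have hδinv : 1 / δ ≤ n := by
    have h1 : ratioStop δ ≤ n := (ratioStop_le_ratio hs).trans
      ((ratio_le hδ hδ1 hs.le).trans (by rw [hn]; exact_mod_cast hkn))
    refine le_trans ?_ h1
    unfold ratioStop
    rw [div_le_div_iff₀ hδ (by positivity)]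
    nlinarith
  have ht := topIndex_add_one_le hx
  have hcf : callFailure δ R = δ / (2 * x * (topIndex R + 1)) := by
    unfold callFailure stageFailure
    rw [div_div]
  have hcf0 : 0 < callFailure δ R := by rw [hcf]; positivity
  have hT : (0 : ℝ) ≤ topIndex R := Nat.cast_nonneg _
  have hcf1 : callFailure δ R < 1 := by
    rw [hcf, div_lt_one (by positivity)]
    nlinarith
  have hlog : log (n / callFailure δ R) ≤ 6 * log n := by
    have h3 : n / callFailure δ R ≤ n ^ 6 := by
      have h4 : n / callFailure δ R = n * (2 * x * (topIndex R + 1)) * (1 / δ) := by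
        rw [hcf]; field_simp
      rw [h4]
      calc n * (2 * x * (topIndex R + 1)) * (1 / δ) ≤ n * (2 * n * (2 * n)) * n := by
            gcongr
            linarith
        _ = 2 * 2 * n ^ 4 := by ring
        _ ≤ n * n * n ^ 4 := by gcongr
        _ = n ^ 6 := by ring
    have h5 := log_le_log (by positivity) h3
    rw [log_pow] at h5
    exact_mod_cast h5
  have hit := (iterations_le (N := N) h2 hp0 hp1 hcf0 hcf1).1
  rw [hrate, ← hn] at hit
  have h6 : log (n / callFailure δ R) / (log x / 10000) ≤ 6 * log n / (log x / 10000) := by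
    gcongr
  have h7 : 6 * log n / (log x / 10000) = 60000 * log n * (1 / log x) := by ring
  have h8 : ((roundBound N (1 - 1 / x) (callFailure δ R) : ℕ) : ℝ) ≤
      ((1 + 2 * iterations N (1 - 1 / x) (callFailure δ R) : ℕ) : ℝ) := by
    unfold roundBound
    gcongr
    omega
  push_cast at h8
  unfold stageRounds
  linarith

theorem sum_stageRounds_le (h2 : 2 ≤ Fintype.card N) (hk : 1 ≤ k) (hkn : k ≤ Fintype.card N)
    (hδ : 0 < δ) (hδ1 : δ ≤ 0.16) :
    ∑ s ∈ Finset.range (numStages k δ), stageRounds N δ (ratio k δ s) ≤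
      480016 * log (Fintype.card N : ℝ) := by
  have h := Finset.sum_le_sum fun s hs => stageRounds_le h2 hk hkn hδ hδ1
    (Finset.mem_range.1 hs)
  refine h.trans ?_
  rw [Finset.sum_add_distrib, ← Finset.mul_sum, Finset.sum_const, Finset.card_range,
    nsmul_eq_mul]
  have h3 := numStages_le hk hδ hδ1
  have h4 : log (k : ℝ) ≤ log (Fintype.card N : ℝ) :=
    log_le_log (by exact_mod_cast hk) (by exact_mod_cast hkn)
  have h5 := half_le_log_card h2
  have h6 := mul_le_mul_of_nonneg_left (sum_inv_loglog_le (k := k) hδ hδ1)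
    (show 0 ≤ 120000 * log (Fintype.card N : ℝ) by positivity)
  linarith

theorem queryBound_add_one_le (h2 : 2 ≤ Fintype.card N) :
    (queryBound N + 1 : ℝ) ≤ 7 * (Fintype.card N : ℝ) ^ 2 := by
  have hn2 : (2 : ℝ) ≤ Fintype.card N := by exact_mod_cast h2
  unfold queryBound
  push_cast
  nlinarith

theorem sum_stageQueries_le (h2 : 2 ≤ Fintype.card N) (hk : 1 ≤ k) (hkn : k ≤ Fintype.card N)
    (hδ : 0 < δ) (hδ1 : δ ≤ 0.16) :
    ∑ s ∈ Finset.range (numStages k δ), stageQueries N (ratio k δ s) ≤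
      56 * (Fintype.card N : ℝ) ^ 4 := by
  set n : ℝ := (Fintype.card N : ℝ) with hn
  have hn2 : (2 : ℝ) ≤ n := by rw [hn]; exact_mod_cast h2
  have hq := queryBound_add_one_le h2
  have h : ∀ s ∈ Finset.range (numStages k δ), stageQueries N (ratio k δ s) ≤ 2 * n * (7 * n ^ 2) := by
    intro s hs
    rw [Finset.mem_range] at hs
    have hx := eighteen_le_log_ratio hδ hδ1 hs
    have ht := topIndex_add_one_le hx
    have hxn := (log_ratio_le_log_card hk hkn hδ hδ1 hs.le).trans (log_le_card h2)
    unfold stageQueries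
    gcongr
    linarith
  refine (Finset.sum_le_sum h).trans ?_
  rw [Finset.sum_const, Finset.card_range, nsmul_eq_mul]
  have h3 := numStages_le hk hδ hδ1
  have h4 : log (k : ℝ) ≤ log (Fintype.card N : ℝ) :=
    log_le_log (by exact_mod_cast hk) (by exact_mod_cast hkn)
  have h5 := log_le_card h2
  calc (numStages k δ : ℝ) * (2 * n * (7 * n ^ 2)) ≤ 4 * n * (2 * n * (7 * n ^ 2)) := by
        gcongr; linarith
    _ = _ := by ring

theorem log_sq_le {x : ℝ} (hx : 1 ≤ x) : log x ^ 2 ≤ 4 * x := by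
  have h1 := log_le_sub_one_of_pos (sqrt_pos.2 (by linarith : 0 < x))
  rw [log_sqrt (by linarith)] at h1
  have h2 : 0 ≤ log x := log_nonneg hx
  have h3 : √x ^ 2 = x := sq_sqrt (by linarith)
  have h4 : log x ≤ 2 * √x := by linarith
  nlinarith [sqrt_nonneg x]

theorem third_le_log_one_div {ε : ℝ} (hε : 0 < ε) (hε1 : ε ≤ 0.64) : 1 / 3 ≤ log (1 / ε) := by
  have h1 := log_le_sub_one_of_pos hε
  rw [one_div ε, log_inv]
  linarith

/-- The number of greedy blocks in terms of `ε`. -/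
theorem blockCount_add_one_le {ε R : ℝ} (hε : 0 < ε) (hε1 : ε ≤ 0.64) (hR0 : 0 < R)
    (hR : R < ratioStop (ε / 4)) :
    (blockCount (ε / 4) R + 1 : ℝ) ≤ 454 * log (1 / ε) / ε := by
  have hl := third_le_log_one_div hε hε1
  have hlogR : log R ≤ 56 * log (1 / ε) := by
    have h1 : ratioStop (ε / 4) = 64 * 10 ^ 6 * (1 / ε) ^ 2 := by
      unfold ratioStop; field_simp; norm_num
    have h2 := log_le_log hR0 hR.le
    rw [h1, log_mul (by norm_num) (by positivity), log_pow] at h2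
    -- Additive constants are absorbed by `log (1 / ε) ≥ 1 / 3`, which holds as `ε` is bounded away
    -- from `1`.
    have h3 : log (64 * 10 ^ 6) ≤ 54 * (1 / 3) := by
      rw [log_le_iff_le_exp (by norm_num)]
      have h4 : exp 18 = exp 1 ^ 18 := by rw [← exp_nat_mul]; norm_num
      have h5 : 2.71828 ^ 18 ≤ exp 1 ^ 18 := by
        gcongr
        have := exp_one_gt_d9
        linarith
      have h6 : (64 * 10 ^ 6 : ℝ) ≤ 2.71828 ^ 18 := by norm_num
      linarith
    calc log R ≤ log (64 * 10 ^ 6) + 2 * log (1 / ε) := by exact_mod_cast h2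
      _ ≤ 54 * (1 / 3) + 2 * log (1 / ε) := by gcongr
      _ ≤ 56 * log (1 / ε) := by linarith
  have h1 : (blockCount (ε / 4) R : ℝ) ≤ 448 * log (1 / ε) / ε + 1 := by
    -- For a ratio of at most `1`, as for `k = 1`, the natural ceiling is `0`.
    rcases le_or_gt (log R) 0 with h0 | h0
    · have : blockCount (ε / 4) R = 0 := by
        unfold blockCount
        rw [Nat.ceil_eq_zero]
        exact div_nonpos_of_nonpos_of_nonneg (by linarith) (by linarith)
      rw [this]
      have : 0 ≤ 448 * log (1 / ε) / ε := by positivity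
      push_cast
      linarith
    · refine (Nat.ceil_lt_add_one (by positivity)).le.trans ?_
      have h3 : 2 * log R / (ε / 4) = 8 * log R / ε := by field_simp; norm_num
      rw [h3]
      have h4 : 8 * log R / ε ≤ 8 * (56 * log (1 / ε)) / ε := by gcongr
      calc _ ≤ 8 * (56 * log (1 / ε)) / ε + 1 := by linarith
        _ = _ := by ring
  have h2 : 2 ≤ 6 * log (1 / ε) / ε := by
    rw [le_div_iff₀ hε]
    nlinarith
  calc (blockCount (ε / 4) R + 1 : ℝ) ≤ 448 * log (1 / ε) / ε + 6 * log (1 / ε) / ε := by linarith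
    _ = _ := by ring

theorem blockLength_add_one_le {ε : ℝ} (hε : 0 < ε) (hε1 : ε ≤ 0.64) :
    (blockLength (ε / 4) + 1 : ℝ) ≤ 7 / ε := by
  have hlog4 : log 4 = 2 * log 2 := by
    rw [show (4 : ℝ) = 2 ^ 2 by norm_num, log_pow]; norm_num
  have h0 := log_two_gt_d9
  have h1 := log_two_lt_d9
  have h2 : (blockLength (ε / 4) : ℝ) ≤ log 4 / (ε / 4) + 1 :=
    (Nat.ceil_lt_add_one (by rw [hlog4]; positivity)).le
  have h3 : log 4 / (ε / 4) = 8 * log 2 / ε := by rw [hlog4]; field_simp; norm_num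
  have h4 : 2 ≤ 1.4 / ε := by rw [le_div_iff₀ hε]; linarith
  have h5 : 8 * log 2 / ε ≤ 5.6 / ε := by gcongr; linarith
  calc _ ≤ 5.6 / ε + 1.4 / ε := by linarith
    _ = _ := by ring

theorem log_one_div_le {ε : ℝ} (hε : 0 < ε) : log (1 / ε) ≤ 1 / ε := by
  have := log_le_sub_one_of_pos (show 0 < 1 / ε by positivity)
  linarith

/-- If `1 / ε ≤ n`, the failure probability is polynomial in `1 / n` and the number of iterations is
`O(log n / ε)`. Otherwise `log (1 / ε)` is not controlled by `log n`, but the sure bound of `1 + 2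
n` rounds is at most `3 / ε`. -/
theorem roundBound_block_le (h2 : 2 ≤ Fintype.card N) {ε R : ℝ} (hε : 0 < ε) (hε1 : ε ≤ 0.64)
    (hR0 : 0 < R) (hR : R < ratioStop (ε / 4)) :
    (roundBound N (ε / 4) (blockFailure (ε / 4) (ε / 4) R) : ℝ) ≤
      1600000 * log (Fintype.card N : ℝ) / ε := by
  have hlogn := half_le_log_card h2
  set n : ℝ := (Fintype.card N : ℝ) with hn
  have hn2 : (2 : ℝ) ≤ n := by rw [hn]; exact_mod_cast h2
  set δ' := blockFailure (ε / 4) (ε / 4) R with hδ'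
  rcases le_or_gt (1 / ε) n with hcase | hcase
  · have h3 : ((roundBound N (ε / 4) δ' : ℕ) : ℝ) ≤ ((1 + 2 * iterations N (ε / 4) δ' : ℕ) : ℝ) := by
      unfold roundBound
      gcongr
      omega
    push_cast at h3
    have hδ0 : 0 < δ' := blockFailure_pos (by positivity)
    have hδ1 : δ' < 1 := (blockFailure_le (by positivity)).trans_lt (by linarith)
    have h4 := iterations_le_div (N := N) h2 (show 0 < ε / 4 by positivity) (by linarith) hδ0 hδ1
    have h5 : log (n / δ') ≤ 19 * log n := by
      have h6 : n / δ' ≤ n ^ 19 := by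
        have h7 : n / δ' = n * (blockCount (ε / 4) R + 1) * (blockLength (ε / 4) + 1) *
            (4 * (1 / ε)) := by
          rw [hδ', blockFailure]; field_simp
        have h8 : (blockCount (ε / 4) R + 1 : ℝ) ≤ 454 * n * n := by
          refine (blockCount_add_one_le hε hε1 hR0 hR).trans ?_
          have h9 : 454 * log (1 / ε) / ε = 454 * log (1 / ε) * (1 / ε) := by ring
          rw [h9]
          gcongr
          exact (log_one_div_le hε).trans hcase
        have h10 : (blockLength (ε / 4) + 1 : ℝ) ≤ 7 * n := by
          refine (blockLength_add_one_le hε hε1).trans ?_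
          have h9 : 7 / ε = 7 * (1 / ε) := by ring
          rw [h9]
          gcongr
        rw [h7]
        calc _ ≤ n * (454 * n * n) * (7 * n) * (4 * n) := by gcongr
          _ = 12712 * n ^ 5 := by ring
          _ ≤ 2 ^ 14 * n ^ 5 := by gcongr; norm_num
          _ ≤ n ^ 14 * n ^ 5 := by gcongr
          _ = n ^ 19 := by ring
      have h7 := log_le_log (by positivity) h6
      rw [log_pow] at h7
      exact_mod_cast h7
    calc _ ≤ 20006 * log (n / δ') / (ε / 4) := h3.trans h4
      _ ≤ 20006 * (19 * log n) / (ε / 4) := by gcongr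
      _ = 1520456 * log n / ε := by field_simp; norm_num
      _ ≤ _ := by gcongr; norm_num
  · have h3 : ((roundBound N (ε / 4) δ' : ℕ) : ℝ) ≤ ((1 + 2 * Fintype.card N : ℕ) : ℝ) := by
      unfold roundBound
      gcongr
      omega
    push_cast at h3
    rw [← hn] at h3
    calc _ ≤ 3 * n := by linarith
      _ ≤ 3 * (1 / ε) := by gcongr
      _ = 3 / ε := by ring
      _ ≤ _ := by gcongr; linarith

variable [DecidableEq N] {f : Finset N → ℝ}

theorem subsampleMaximization_eq (TS : ThresholdProc N) (k : ℕ) (ε : ℝ) :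
    subsampleMaximization TS k ε =
      (subsamplePreprocessing TS k (ε / 4)).andThen fun I =>
        exhaustiveMaximization TS k (ε / 4) (ε / 4) I.1 I.2 := rfl

theorem ensures_subsampleMaximization (hs : Submodular f) (hm : Monotone f) (hf : ∀ S, 0 ≤ f S)
    (h2 : 2 ≤ Fintype.card N) (hk : 1 ≤ k) (hkn : k ≤ Fintype.card N) {ε : ℝ} (hε : 0 < ε)
    (hε1 : ε ≤ 0.64) :
    Alg.Ensures f (subsampleMaximization thresholdSampling k ε) (fun O => O.card ≤ k)
      (10 ^ 9 * log (Fintype.card N : ℝ) / ε ^ 2) (10 ^ 9 * ((Fintype.card N : ℝ) / ε) ^ 4) := by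
  have hδ : 0 < ε / 4 := by positivity
  have hδ1 : ε / 4 ≤ 0.16 := by linarith
  set R := ratio k (ε / 4) (numStages k (ε / 4)) with hR
  have hR0 : 0 < R := ratio_pos hk hδ hδ1 le_rfl
  have hRs : R < ratioStop (ε / 4) := ratio_numStages_lt hδ hδ1
  have hlogn := half_le_log_card h2
  set n : ℝ := (Fintype.card N : ℝ) with hn
  have hn2 : (2 : ℝ) ≤ n := by rw [hn]; exact_mod_cast h2
  have hBL := blockLength_add_one_le hε hε1
  have hBC : (blockCount (ε / 4) R + 1 : ℝ) ≤ 454 * (1 / ε) * (1 / ε) := by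
    refine (blockCount_add_one_le hε hε1 hR0 hRs).trans ?_
    have h9 : 454 * log (1 / ε) / ε = 454 * log (1 / ε) * (1 / ε) := by ring
    rw [h9]
    gcongr
    exact log_one_div_le hε
  have hRB := roundBound_block_le h2 hε hε1 hR0 hRs
  rw [← hn] at hRB
  have hinv : 1 ≤ 1 / ε := by rw [le_div_iff₀ hε]; linarith
  rw [subsampleMaximization_eq]
  refine (Alg.ensures_andThen (r' := 11200000 * log n / ε ^ 2 + 1)
    (w' := 454 * (1 / ε) * (1 / ε) * (7 / ε * (7 * n ^ 2)) + 908 * (1 / ε) * (1 / ε))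
    (ensures_subsamplePreprocessing hs hm hf hk hδ hδ1) fun I hI => ?_).mono
    (fun _ h => h) ?_ ?_
  · rw [hI.2, ← hR]
    refine (ensures_exhaustiveMaximization hs hm _ _ _ _).mono (fun _ h => h) ?_ ?_
    · have : 11200000 * log n / ε ^ 2 = 7 / ε * (1600000 * log n / ε) := by field_simp; norm_num
      rw [this]
      gcongr
    · refine add_le_add ?_ ?_
      · have hq := queryBound_add_one_le h2
        gcongr
        linarith
      · have : (0 : ℝ) ≤ blockCount (ε / 4) R := Nat.cast_nonneg _
        linarith
  · have h3 := sum_stageRounds_le h2 hk hkn hδ hδ1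
    rw [← hn] at h3
    have h4 : log n ≤ log n / ε ^ 2 := by
      rw [le_div_iff₀ (by positivity)]
      exact mul_le_of_le_one_right (by linarith) (pow_le_one₀ hε.le (by linarith))
    have h5 : 10 ^ 9 * log n / ε ^ 2 = 10 ^ 9 * (log n / ε ^ 2) := by ring
    have h6 : 11200000 * log n / ε ^ 2 = 11200000 * (log n / ε ^ 2) := by ring
    rw [h5, h6]
    linarith
  · have h3 := sum_stageQueries_le h2 hk hkn hδ hδ1
    rw [← hn] at h3 ⊢
    set y := n / ε with hy
    have hyn : n ≤ y := by rw [hy, le_div_iff₀ hε]; nlinarith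
    have hye : 1 / ε ≤ y := by rw [hy]; gcongr; linarith
    have hy1 : 1 ≤ y := hinv.trans hye
    have hn4 : n ^ 4 ≤ y ^ 4 := by gcongr
    have hn1 : n ≤ y ^ 4 := hyn.trans (le_self_pow₀ hy1 (by norm_num))
    have he2 : (1 / ε) * (1 / ε) ≤ y ^ 4 := by
      calc (1 / ε) * (1 / ε) ≤ y * y := by gcongr
        _ = y ^ 2 := by ring
        _ ≤ y ^ 4 := pow_le_pow_right₀ hy1 (by norm_num)
    -- The worst case of the maximization phase is of order `n² / ε³`; this and the `n⁴` of the
    -- preprocessing fix the exponent `4`.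
    have he3 : (1 / ε) * (1 / ε) * (1 / ε * n ^ 2) ≤ y ^ 4 := by
      have h7 : 1 / ε * n ^ 2 ≤ y * y := by
        rw [hy]
        have h8 : 1 / ε * n ^ 2 = n / ε * n := by ring
        rw [h8]
        gcongr
      calc (1 / ε) * (1 / ε) * (1 / ε * n ^ 2) ≤ y * y * (y * y) := by gcongr
        _ = y ^ 4 := by ring
    have h9 : 454 * (1 / ε) * (1 / ε) * (7 / ε * (7 * n ^ 2)) =
        22246 * ((1 / ε) * (1 / ε) * (1 / ε * n ^ 2)) := by ring
    rw [h9]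
    linarith

/-- About `2 log R` thresholds on a subsample of mean size at most `n / log² R` cost `O(n / log R)`,
which is summable; `2 log R` bounds the final evaluations. -/
theorem cost_stage_le (hs : Submodular f) (hm : Monotone f) (hf : ∀ S, 0 ≤ f S) {R : ℝ}
    (hR : 18 ≤ log R) (D L : ℝ) :
    Alg.cost f (reduceRatio thresholdSampling k δ D R L) ≤
      ENNReal.ofReal (160008 * Fintype.card N * (1 / log R) + 2 * log R) := by
  have ht := topIndex_add_one_le hR
  refine (cost_reduceRatio_le hs hm hf δ D R L (by linarith)).trans ?_
  set x := log R
  set n : ℝ := (Fintype.card N : ℝ) with hn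
  have hp : 1 / 2 ≤ 1 - 1 / x := by
    have : 1 / x ≤ 1 / 2 := one_div_le_one_div_of_le (by norm_num) (by linarith)
    linarith
  rw [← ENNReal.ofReal_natCast (topIndex R + 1), ← ENNReal.ofReal_natCast (Fintype.card N),
    ← ENNReal.ofReal_mul (by positivity), ← ENNReal.ofReal_mul (by positivity),
    ← ENNReal.ofReal_mul (by positivity), ← ENNReal.ofReal_add (by positivity) (by positivity)]
  refine ENNReal.ofReal_le_ofReal ?_
  rw [← hn]
  push_cast
  refine add_le_add ?_ ht
  calc (topIndex R + 1 : ℝ) * (40002 / (1 - 1 / x) * (n * (1 / x ^ 2)))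
      ≤ (2 * x) * (40002 / (1 / 2) * (n * (1 / x ^ 2))) := by gcongr
    _ = _ := by field_simp; norm_num; ring

theorem cost_subsampleMaximization_le (hs : Submodular f) (hm : Monotone f) (hf : ∀ S, 0 ≤ f S)
    (h2 : 2 ≤ Fintype.card N) (hk : 1 ≤ k) (hkn : k ≤ Fintype.card N) {ε : ℝ} (hε : 0 < ε)
    (hε1 : ε ≤ 0.64) :
    Alg.cost f (subsampleMaximization thresholdSampling k ε) ≤
      ENNReal.ofReal (10 ^ 9 * (Fintype.card N * log (1 / ε) / ε ^ 3)) := by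
  have hδ : 0 < ε / 4 := by positivity
  have hδ1 : ε / 4 ≤ 0.16 := by linarith
  set R := ratio k (ε / 4) (numStages k (ε / 4)) with hR
  have hR0 : 0 < R := ratio_pos hk hδ hδ1 le_rfl
  have hRs : R < ratioStop (ε / 4) := ratio_numStages_lt hδ hδ1
  have hlogn := half_le_log_card h2
  have hBL := blockLength_add_one_le hε hε1
  have hBC := blockCount_add_one_le hε hε1 hR0 hRs
  have hpre := cost_subsamplePreprocessing_le hs hm hf (k := k) (δ := ε / 4) _
    fun s hs' D L => cost_stage_le hs hm hf (eighteen_le_log_ratio hδ hδ1 hs') D L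
  have hl := third_le_log_one_div hε hε1
  set n : ℝ := (Fintype.card N : ℝ) with hn
  have hn2 : (2 : ℝ) ≤ n := by rw [hn]; exact_mod_cast h2
  set l := log (1 / ε)
  have hpre' : Alg.cost f (subsamplePreprocessing thresholdSampling k (ε / 4)) ≤
      ENNReal.ofReal (160041 * n) := by
    refine hpre.trans ?_
    have hpos : ∀ s ∈ Finset.range (numStages k (ε / 4)),
        0 ≤ 160008 * n * (1 / log (ratio k (ε / 4) s)) + 2 * log (ratio k (ε / 4) s) := by
      intro s hs'
      have := eighteen_le_log_ratio hδ hδ1 (Finset.mem_range.1 hs')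
      have : 0 < log (ratio k (ε / 4) s) := by linarith
      positivity
    rw [← ENNReal.ofReal_sum_of_nonneg hpos, ← ENNReal.ofReal_natCast,
      ← ENNReal.ofReal_add (by positivity) (Finset.sum_nonneg hpos), ← hn]
    refine ENNReal.ofReal_le_ofReal ?_
    rw [Finset.sum_add_distrib, ← Finset.mul_sum, ← Finset.mul_sum]
    have h3 := mul_le_mul_of_nonneg_left (sum_inv_log_le (k := k) hδ hδ1)
      (show 0 ≤ 160008 * n by positivity)
    -- The evaluations need no decay: at most `4 log n` stages of `O(log n)` queries are `O(log² n)
    -- = O(n)`.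
    have h4 : ∑ s ∈ Finset.range (numStages k (ε / 4)), log (ratio k (ε / 4) s) ≤
        4 * log n ^ 2 := by
      refine (Finset.sum_le_sum fun s hs' => log_ratio_le_log_card hk hkn hδ hδ1
        (Finset.mem_range.1 hs').le).trans ?_
      rw [Finset.sum_const, Finset.card_range, nsmul_eq_mul, ← hn]
      have h5 := numStages_le hk hδ hδ1
      have h6 : log (k : ℝ) ≤ log n :=
        log_le_log (by exact_mod_cast hk) (by rw [hn]; exact_mod_cast hkn)
      calc (numStages k (ε / 4) : ℝ) * log n ≤ 4 * log n * log n := by gcongr; linarith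
        _ = _ := by ring
    have h5 := log_sq_le (show 1 ≤ n by linarith)
    linarith
  have hex : ∀ L, Alg.cost f (exhaustiveMaximization thresholdSampling k (ε / 4) (ε / 4) L R) ≤
      ENNReal.ofReal (508505424 * (n * l / ε ^ 3) + 908 * l / ε) := by
    intro L
    refine (cost_exhaustiveMaximization_le hs hm _ _ _ _).trans ?_
    have hc1 : ((blockCount (ε / 4) R : ℝ≥0∞) + 1) =
        ENNReal.ofReal (blockCount (ε / 4) R + 1 : ℝ) := by
      rw [ENNReal.ofReal_add (by positivity) (by norm_num)]; simp
    have hc2 : ((blockLength (ε / 4) : ℝ≥0∞) + 1) =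
        ENNReal.ofReal (blockLength (ε / 4) + 1 : ℝ) := by
      rw [ENNReal.ofReal_add (by positivity) (by norm_num)]; simp
    have hc3 : ((blockCount (ε / 4) R : ℝ≥0∞) + 2) =
        ENNReal.ofReal (blockCount (ε / 4) R + 2 : ℝ) := by
      rw [ENNReal.ofReal_add (by positivity) (by norm_num)]; simp
    rw [hc1, hc2, hc3, ← ENNReal.ofReal_natCast, ← ENNReal.ofReal_mul (by positivity),
      ← ENNReal.ofReal_mul (by positivity), ← ENNReal.ofReal_mul (by positivity),
      ← ENNReal.ofReal_add (by positivity) (by positivity), ← hn]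
    refine ENNReal.ofReal_le_ofReal (add_le_add ?_ ?_)
    · calc (blockCount (ε / 4) R + 1 : ℝ) * ((blockLength (ε / 4) + 1) * (40002 / (ε / 4) * n))
          ≤ (454 * l / ε) * (7 / ε * (40002 / (ε / 4) * n)) := by gcongr
        _ = _ := by field_simp; norm_num
    · have : (0 : ℝ) ≤ blockCount (ε / 4) R := Nat.cast_nonneg _
      calc (blockCount (ε / 4) R + 2 : ℝ) ≤ 2 * (454 * l / ε) := by linarith
        _ = _ := by ring
  rw [subsampleMaximization_eq]
  refine (Alg.cost_andThen_le (ensures_subsamplePreprocessing hs hm hf hk hδ hδ1) hpre'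
    fun I hI => by rw [hI.2]; exact hex I.1).trans ?_
  rw [← ENNReal.ofReal_add (by positivity) (by positivity)]
  refine ENNReal.ofReal_le_ofReal ?_
  have hε3 : ε ^ 3 ≤ 1 := pow_le_one₀ hε.le (by linarith)
  have h7 : n ≤ 3 * (n * l / ε ^ 3) := by
    rw [← mul_div_assoc, le_div_iff₀ (by positivity)]
    calc n * ε ^ 3 ≤ n * 1 := by gcongr
      _ ≤ 3 * (n * l) := by nlinarith
  have h8 : l / ε ≤ n * l / ε ^ 3 := by
    rw [div_le_div_iff₀ hε (by positivity)]
    calc l * ε ^ 3 = l * ε * ε ^ 2 := by ring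
      _ ≤ l * ε * n := by gcongr; nlinarith
      _ = _ := by ring
  have h9 : 908 * l / ε = 908 * (l / ε) := by ring
  have h10 : 0 ≤ n * l / ε ^ 3 := by positivity
  linarith

theorem fail_subsampleMaximization_le [Nonempty N] (hs : Submodular f) (hm : Monotone f)
    (hf : ∀ S, 0 ≤ f S) (hk : 1 ≤ k) {ε : ℝ} (hε : 0 < ε) (hε1 : ε ≤ 0.64)
    (hD : 0 < singletonMax f) :
    Alg.failure f (subsampleMaximization thresholdSampling k ε)
      (fun O => (1 - 1 / exp 1 - ε / 4) * opt f k ≤ f O) ≤ ENNReal.ofReal (ε / 2) := by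
  have hδ : 0 < ε / 4 := by positivity
  have hδ1 : ε / 4 ≤ 0.16 := by linarith
  rw [subsampleMaximization_eq]
  refine (Alg.failure_andThen_le (ensures_subsamplePreprocessing hs hm hf hk hδ hδ1)
    (fail_subsamplePreprocessing_le hs hm hf hk hδ hδ1 hD) fun I hI hVR =>
    fail_exhaustiveMaximization_le hs hm hf hk hδ hδ1 hδ (by linarith) (hI.1 hD).1 (hI.1 hD).2
      hVR).trans (le_of_eq ?_)
  rw [← ENNReal.ofReal_add hδ.le hδ.le]
  congr 1
  ring

/-- If every singleton has value `0`, so has the optimum. Otherwise the value `(1 - 1 / e - ε / 4)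
OPT` is reached with probability at least `1 - ε / 2`, and nonnegativity of `f` covers the rest. -/
theorem le_expect_subsampleMaximization [Nonempty N] (hs : Submodular f) (hm : Monotone f)
    (hf : ∀ S, 0 ≤ f S) (hk : 1 ≤ k) {ε : ℝ} (hε : 0 < ε) (hε1 : ε < 1 - 1 / exp 1)
    (hε2 : ε ≤ 0.64) :
    ENNReal.ofReal ((1 - 1 / exp 1 - ε) * opt f k) ≤
      expect ((subsampleMaximization thresholdSampling k ε).run f)
        (fun o => ENNReal.ofReal (f o.output)) := by
  classical
  rcases (singletonMax_nonneg (f := f)).eq_or_lt with hD | hD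
  · have h1 := opt_le_card_mul_singletonMax hk hs hm hf
    rw [← hD, mul_zero] at h1
    rw [le_antisymm h1 (opt_nonneg hf), mul_zero, ENNReal.ofReal_zero]
    exact zero_le
  have hV : 0 ≤ opt f k := opt_nonneg hf
  have he : 0 < 1 / exp 1 := by positivity
  have hfail := fail_subsampleMaximization_le hs hm hf hk hε hε2 hD
  have h := mul_le_expect_of_prob (μ := (subsampleMaximization thresholdSampling k ε).run f)
    (s := {o | ¬ (1 - 1 / exp 1 - ε / 4) * opt f k ≤ f o.output})
    (g := fun o => ENNReal.ofReal (f o.output))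
    (c := ENNReal.ofReal ((1 - 1 / exp 1 - ε / 4) * opt f k))
    (δ := ENNReal.ofReal (ε / 2)) (le_trans (le_of_eq ?_) hfail) ?_
  · refine le_trans ?_ h
    rw [← ENNReal.ofReal_one, ← ENNReal.ofReal_sub _ (by linarith),
      ← ENNReal.ofReal_mul (by linarith)]
    refine ENNReal.ofReal_le_ofReal ?_
    rw [← mul_assoc]
    refine mul_le_mul_of_nonneg_right ?_ hV
    nlinarith
  · unfold Alg.failure Alg.outE
    congr 1
    funext o
    simp only [Set.mem_ofPred_eq]
    split_ifs <;> simp_all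
  · intro o _ ho
    simp only [Set.mem_ofPred_eq, not_not] at ho
    exact ENNReal.ofReal_le_ofReal ho

end Bounds

end SubMax

/-! ### The main theorem -/

theorem mainTheorem1 :
    ∃ (C : ℝ) (d : ℕ), 0 < C ∧
      ∀ (N : Type) [Fintype N] [DecidableEq N], 2 ≤ Fintype.card N →
        ∃ TS : SubMax.ThresholdProc N, SubMax.IsThresholdSampling C TS ∧
          ∀ (k : ℕ) (ε : ℝ), 1 ≤ k → k ≤ Fintype.card N →
            0 < ε → ε < 1 - 1 / Real.exp 1 →
            ∀ f : Finset N → ℝ, Monotone f → SubMax.Submodular f → (∀ S, 0 ≤ f S) →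
              (∀ o ∈ ((SubMax.subsampleMaximization TS k ε).run f).support,
                o.output.card ≤ k ∧
                (o.rounds : ℝ) ≤ C * Real.log (Fintype.card N) / ε ^ 2 ∧
                (o.queries : ℝ) ≤ C * (Fintype.card N / ε) ^ d) ∧
              SubMax.expect ((SubMax.subsampleMaximization TS k ε).run f)
                  (fun o => (o.queries : ENNReal)) ≤
                ENNReal.ofReal (C * (Fintype.card N * Real.log (1 / ε) / ε ^ 3)) ∧
              ENNReal.ofReal ((1 - 1 / Real.exp 1 - ε) * SubMax.opt f k) ≤
                SubMax.expect ((SubMax.subsampleMaximization TS k ε).run f)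
                  (fun o => ENNReal.ofReal (f o.output)) := by
  refine ⟨10 ^ 9, 4, by norm_num, fun N _ _ h2 => ⟨SubMax.thresholdSampling,
    SubMax.isThresholdSampling (by norm_num) h2, fun k ε hk hkn hε hε1 f hm hs hf => ?_⟩⟩
  have : Nonempty N := Fintype.card_pos_iff.1 (by omega)
  -- A numerical form of `ε < 1 - 1 / e`; it gives `ε / 4 ≤ 0.16`, the bound assumed by the
  -- estimates for both phases.
  have hε2 : ε ≤ 0.64 := by
    have h3 : 0.36 ≤ 1 / Real.exp 1 := by
      rw [le_div_iff₀ (Real.exp_pos _)]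
      have := Real.exp_one_lt_d9
      linarith
    linarith
  exact ⟨SubMax.ensures_subsampleMaximization hs hm hf h2 hk hkn hε hε2,
    SubMax.cost_subsampleMaximization_le hs hm hf h2 hk hkn hε hε2,
    SubMax.le_expect_subsampleMaximization hs hm hf hk hε hε1 hε2⟩
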